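/- **Conventions.** For $n\ge 1$ let $RS_n$ be the normalized bar resolution of $\mathbb Z$ over $\mathbb Z S_n$: it is $\mathbb Z$-free on symbols $g[g_1|\cdots|g_p]$ (degree $p$) with $g,g_i\in S_n$, $g_i\neq 1$, a symbol with some $g_i=1$ being read as $0$; $S_n$ acts by left multiplication on $g$; $\partial$ is the alternating sum of the faces $gg_1[g_2|\cdots|g_p]$, $g[g_1|\cdots|g_ig_{i+1}|\cdots|g_p]$ $(0<i<p)$, $g[g_1|\cdots|g_{p-1}]$. Let $A(S_n,1)$ be spanned by the symbols with $g=1$, and let $\varphi(g[g_1|\cdots|g_p])=1[g|g_1|\cdots|g_p]$. The operad $\mathfrak S$ has components $RS_n$, unit $[\,]\in RS_1$, and compositions $\circ_i:RS_n\otimes RS_m\to RS_{n+m-1}$ $(1\le i\le m)$ given by $[\,]\circ_i[\,]=[\,]$, by $a\circ_i b=\varphi(\partial a\circ_i b+(-1)^{|a|}a\circ_i\partial b)$ for $a\in A(S_n,1)$, $b\in A(S_m,1)$ of positive total degree, and by $(\tau a)\circ_{\sigma(i)}(\sigma b)=T_i(\sigma)\,(1\oplus\cdots\oplus\tau\oplus\cdots\oplus1)\,(a\circ_i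 b)$, where $\tau$ stands at the $i$-th place and $T_i(\sigma)$ is the block permutation carrying the $j$-th block to the $\sigma(j)$-th place, the $i$-th block having length $n$ and the others length $1$. For a chain complex $C$, $C^n$ is the $n$-fold tensor power over $\mathbb Z$, with $S_n$ permuting the factors and with Koszul signs. A coalgebra over $\mathfrak S$ is a chain complex $C$ with $S_n$-equivariant chain maps $f_n:RS_n\otimes C\to C^n$, $n\ge1$, such that $f_1([\,]\otimes c)=c$ and $$f_{n+m-1}((a\circ_i b)\otimes c)=\bigl(1^{\otimes (i-1)}\otimes f_n(a\otimes -)\otimes 1^{\otimes (m-i)}\bigr)\bigl(f_m(b\otimes c)\bigr)$$ for all $a\in RS_n$, $b\in RS_m$, $1\le i\le m$, with the Koszul sign for moving $a$ past the first $i-1$ factors. A morphism is a chain map commuting with all $f_n$. An m-coalgebra over $\mathfrak S$ is a coalgebra over $\mathfrak S$ whose complex is $\mathbb Z$-free with $C_0\cong\mathbb Z$, $C_1=0$; morphisms of m-coalgebras are morphisms of coalgebras over $\mathfrak S$ inducing isomorphisms on $H_0$ and $H_1$. Let $C(X)$ be the normalized simplicial chain complex of a simplicial set $X$, and let $SS$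 be the category of pointed, simply-connected, $2$-reduced simplicial sets (a single simplex in each of the dimensions $0$ and $1$). **Theorem.** There is a functor $\mathscr C:SS\to\{\text{m-coalgebras over }\mathfrak S\}$ whose underlying chain-complex functor is $X\mapsto C(X)$. Moreover, its structure maps are the restriction to $SS$ of coalgebra structures over $\mathfrak S$ $$f_n: RS_n\otimes C(X)\to C(X)^n,\qquad n\ge 1,$$ defined for all simplicial sets $X$ and natural in $X$, which on the standard simplices $s^k=[0,\dots,k]$ are given by the following construction. Let $s([i_0,\dots,i_j])=(-1)^{j+1}[i_0,\dots,i_j,k]$ (zero if $i_j=k$), let $\epsilon$ send each vertex of $s^k$ to $[k]$ and every simplex of positive dimension to $0$, and let $\Phi=s\otimes1\otimes\cdots\otimes1+\epsilon\otimes s\otimes1\otimes\cdots\otimes 1+\cdots+\epsilon\otimes\cdots\otimes\epsilon\otimes s$ on $C(s^k)^n$. Then $f_n([\,]\otimes[0])=[0]\otimes\cdots\otimes[0]$ on $s^0$, and for every $A=1[a_1|\cdots|a_p]\in A(S_n,1)$ with $p+k>0$, $$f_n(A\otimes s^k)=\Phi f_n(\partial A\otimes s^k)+(-1)^{p}\,\Phi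 f_n(A\otimes\partial s^k).$$ -/

import Mathlib

open CategoryTheory

universe u

noncomputable section

open TensorProduct Limits Opposite

/-! ### The components `RS_n`: normalized bar resolutions of `ℤ` over `ℤ[S_n]` -/

namespace SymOperad

/-- Bilinear extension of a function on pairs of basis elements. -/
def bilin {α β M : Type*} [AddCommMonoid M] [Module ℤ M] (f : α → β → M) :
    (α →₀ ℤ) →ₗ[ℤ] (β →₀ ℤ) →ₗ[ℤ] M :=
  Finsupp.linearCombination ℤ fun a => Finsupp.linearCombination ℤ (f a)

/-- The `ℤ`-basis of `RS_n`: symbols `g[g₁|…|g_p]` with `g, g₁, …, g_p ∈ S_n`, `g_i ≠ 1`. -/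
abbrev BarWord (n : ℕ) : Type :=
  Equiv.Perm (Fin n) × List {g : Equiv.Perm (Fin n) // g ≠ 1}

/-- The degree `p` of `g[g₁|…|g_p]`. -/
def BarWord.deg {n : ℕ} (w : BarWord n) : ℕ := w.2.length

/-- The underlying graded group of `RS_n`, as the sum of all its degrees. -/
abbrev RS (n : ℕ) : Type := BarWord n →₀ ℤ

/-- The basis element of `RS_n` given by a bar word. -/
def word {n : ℕ} (w : BarWord n) : RS n := Finsupp.single w 1

/-- The element `g[g₁|…|g_p]` for arbitrary `g_i ∈ S_n`: it is zero as soon as some `g_i = 1`. -/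
def symbol {n : ℕ} (g : Equiv.Perm (Fin n)) (l : List (Equiv.Perm (Fin n))) : RS n :=
  open Classical in
  if h : ∀ a ∈ l, a ≠ 1 then word (g, l.attachWith (fun a => a ≠ 1) h) else 0

/-- The faces of `g[g₁|…|g_p]`, `p ≥ 1`: `F_0 = g g₁[g₂|…|g_p]`,
`F_i = g[g₁|…|g_i g_{i+1}|…|g_p]` for `0 < i < p`, and `F_p = g[g₁|…|g_{p-1}]`. -/
def face {G : Type*} [Mul G] : ℕ → G → List G → G × List G
  | _, g, [] => (g, [])
  | 0, g, a :: l => (g * a, l)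
  | _ + 1, g, [_] => (g, [])
  | i + 1, g, a :: b :: l => (g, (face i a (b :: l)).1 :: (face i a (b :: l)).2)

/-- The differential of `RS_n`: the alternating sum of the faces. -/
def bdry {n : ℕ} : RS n →ₗ[ℤ] RS n :=
  Finsupp.linearCombination ℤ fun w =>
    if w.2 = [] then 0 else
      ∑ i ∈ Finset.range (w.deg + 1),
        (-1 : ℤ) ^ i • symbol (face i w.1 (w.2.map (fun a => a.1))).1
          (face i w.1 (w.2.map (fun a => a.1))).2

/-- The left action of `S_n` on `RS_n`: `σ · g[g₁|…|g_p] = σg[g₁|…|g_p]`. -/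
def act {n : ℕ} (σ : Equiv.Perm (Fin n)) : RS n →ₗ[ℤ] RS n :=
  Finsupp.lmapDomain ℤ ℤ fun w : BarWord n => (σ * w.1, w.2)

/-- The contracting homotopy of `RS_n`: `g[g₁|…|g_p] ↦ 1[g|g₁|…|g_p]` if `g ≠ 1`, and
`1[g₁|…|g_p] ↦ 0`. -/
def contr {n : ℕ} : RS n →ₗ[ℤ] RS n :=
  Finsupp.linearCombination ℤ fun w =>
    if h : w.1 = 1 then 0 else word (1, ⟨w.1, h⟩ :: w.2)

/-! ### Substituting a block of `n` letters for the `i`-th of `m + 1` letters -/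

/-- Position, in a row of `m + n` letters, of the letters of a row of `m + 1` letters whose `i`-th
letter has been replaced by a block of `n` letters. -/
def slotFun {m : ℕ} (i : Fin (m + 1)) (n : ℕ) :
    {j : Fin (m + 1) // j ≠ i} ⊕ Fin n → Fin (m + n)
  | .inl j => ⟨if j.1 < i then j.1.1 else j.1.1 + n - 1, by
      have h1 := j.1.2
      have h2 := i.2
      have h3 : j.1.1 ≠ i.1 := fun h => j.2 (Fin.ext h)
      split_ifs with h
      · have h : j.1.1 < i.1 := h
        omega
      · have h : ¬ j.1.1 < i.1 := h
        omega⟩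
  | .inr t => ⟨i.1 + t.1, by have h1 := t.2; have h2 := i.2; omega⟩

theorem slotFun_injective {m : ℕ} (i : Fin (m + 1)) (n : ℕ) :
    Function.Injective (slotFun i n) := by
  rintro (⟨j, hj⟩ | t) (⟨k, hk⟩ | s) h
  · have hj' : j.1 ≠ i.1 := fun h => hj (Fin.ext h)
    have hk' : k.1 ≠ i.1 := fun h => hk (Fin.ext h)
    have h := congrArg Fin.val h
    simp only [slotFun, Fin.lt_def] at h
    have : j = k := by
      apply Fin.ext
      split_ifs at h <;> omega
    subst this
    rfl
  · exfalso
    have hj' : j.1 ≠ i.1 := fun h => hj (Fin.ext h)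
    have h := congrArg Fin.val h
    have := s.2
    simp only [slotFun, Fin.lt_def] at h
    split_ifs at h <;> omega
  · exfalso
    have hk' : k.1 ≠ i.1 := fun h => hk (Fin.ext h)
    have h := congrArg Fin.val h
    have := t.2
    simp only [slotFun, Fin.lt_def] at h
    split_ifs at h <;> omega
  · have h := congrArg Fin.val h
    simp only [slotFun] at h
    exact congrArg Sum.inr (Fin.ext (by omega))

/-- `slotFun` as a bijection. -/
def slotEquiv {m : ℕ} (i : Fin (m + 1)) (n : ℕ) :
    ({j : Fin (m + 1) // j ≠ i} ⊕ Fin n) ≃ Fin (m + n) :=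
  Equiv.ofBijective (slotFun i n)
    ((Fintype.bijective_iff_injective_and_card _).2 ⟨slotFun_injective i n, by
      simp [Fintype.card_subtype_compl]⟩)

/-- The block permutation `T_{1,…,n,…,1}(σ)`, with the block of length `n` in position `i`: it
carries the `j`-th block to the `σ j`-th place. -/
def blockPerm {m : ℕ} (i : Fin (m + 1)) (n : ℕ) (σ : Equiv.Perm (Fin (m + 1))) :
    Equiv.Perm (Fin (m + n)) :=
  (slotEquiv i n).symm.trans
    ((Equiv.sumCongr (σ.subtypeEquiv fun j => by simp) (Equiv.refl (Fin n))).trans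
      (slotEquiv (σ i) n))

/-- The block sum `1 ⊕ ⋯ ⊕ τ ⊕ ⋯ ⊕ 1`, with `τ` acting on the block in position `i`. -/
def blockIncl {m n : ℕ} (i : Fin (m + 1)) (τ : Equiv.Perm (Fin n)) :
    Equiv.Perm (Fin (m + n)) :=
  (slotEquiv i n).symm.trans ((Equiv.sumCongr (Equiv.refl _) τ).trans (slotEquiv i n))

/-! ### The composition operations of `𝔖` -/

/-- The composition `∘_i` on pairs of words of total degree `N`, by recursion on `N`.
For `a = 1[a₁|…]` and `b = 1[b₁|…]` one has `[] ∘_i [] = []` and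
`a ∘_i b = φ (∂a ∘_i b + (-1)^{|a|} a ∘_i ∂b)` in positive degree; in general
`(τ a) ∘_{σ i} (σ b) = T_{1,…,n,…,1}(σ) (1 ⊕ ⋯ ⊕ τ ⊕ ⋯ ⊕ 1) (a ∘_i b)`. -/
def circAux {n m : ℕ} : ℕ → Fin (m + 1) → (RS n →ₗ[ℤ] RS (m + 1) →ₗ[ℤ] RS (m + n))
  | 0, i => bilin fun a b =>
      act (blockPerm (b.1⁻¹ i) n b.1 * blockIncl (b.1⁻¹ i) a.1) (word (1, []))
  | N + 1, i => bilin fun a b =>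
      act (blockPerm (b.1⁻¹ i) n b.1 * blockIncl (b.1⁻¹ i) a.1)
        (contr (circAux N (b.1⁻¹ i) (bdry (word (1, a.2))) (word (1, b.2)) +
          (-1 : ℤ) ^ a.deg • circAux N (b.1⁻¹ i) (word (1, a.2)) (bdry (word (1, b.2)))))

/-- The composition operation `∘_i : RS_n ⊗ RS_{m+1} → RS_{m+n}` of the operad `𝔖`. -/
def circ {n m : ℕ} (i : Fin (m + 1)) : RS n →ₗ[ℤ] RS (m + 1) →ₗ[ℤ] RS (m + n) :=
  bilin fun a b => circAux (a.deg + b.deg) i (word a) (word b)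

end SymOperad

/-! ### Total modules of chain complexes and their tensor powers -/

/-- The direct sum of all the terms of a chain complex. -/
def Tot (C : ChainComplex AddCommGrpCat.{u} ℕ) : Type u := DirectSum ℕ fun k => C.X k

instance (C : ChainComplex AddCommGrpCat.{u} ℕ) : AddCommGroup (Tot C) :=
  inferInstanceAs (AddCommGroup (DirectSum ℕ fun k => C.X k))

namespace Tot

variable (C : ChainComplex AddCommGrpCat.{u} ℕ)

/-- The inclusion of the term of degree `k`. -/
def of (k : ℕ) : C.X k →+ Tot C := DirectSum.of (fun k => C.X k) k

variable {C} in
/-- The linear map with given restrictions to the terms of the complex. -/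
def desc {M : Type*} [AddCommGroup M] (f : ∀ k, C.X k →+ M) : Tot C →ₗ[ℤ] M :=
  AddMonoidHom.toIntLinearMap (DirectSum.toAddMonoid f : (DirectSum ℕ fun k => C.X k) →+ M)

/-- The differential of a chain complex. -/
def d : Tot C →ₗ[ℤ] Tot C := desc fun k => (of C (k - 1)).comp (C.d k (k - 1)).hom

/-- The map `c ↦ (-1)^{p |c|} c`. -/
def sgn (p : ℕ) : Tot C →ₗ[ℤ] Tot C := desc fun k => (-1 : ℤ) ^ (p * k) • of C k

/-- The projection to the elements of odd degree (for `true`) or even degree (for `false`). -/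
def parity (e : Bool) : Tot C →ₗ[ℤ] Tot C :=
  desc fun k => if decide (Odd k) = e then of C k else 0

variable {C} in
/-- The map induced by a chain map. -/
def map {D : ChainComplex AddCommGrpCat.{u} ℕ} (f : C ⟶ D) : Tot C →ₗ[ℤ] Tot D :=
  desc fun k => (of D k).comp (f.f k).hom

@[simp]
theorem desc_of {M : Type*} [AddCommGroup M] (f : ∀ k, C.X k →+ M) (k : ℕ) (x : C.X k) :
    desc f (of C k x) = f k x :=
  DirectSum.toAddMonoid_of f k x

variable {C} in
theorem hom_ext {M : Type*} [AddCommGroup M] {f g : Tot C →ₗ[ℤ] M}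
    (h : ∀ k x, f (of C k x) = g (of C k x)) : f = g := by
  have : f.toAddMonoidHom = g.toAddMonoidHom :=
    DirectSum.addHom_ext (β := fun k => C.X k)
      (f := f.toAddMonoidHom) (g := g.toAddMonoidHom) h
  exact LinearMap.ext fun x => DFunLike.congr_fun this x

end Tot

/-- The `n`-fold tensor power `C^n` over `ℤ` of a chain complex. -/
abbrev TP (C : ChainComplex (AddCommGrpCat.{u}) ℕ) (n : ℕ) : Type u :=
  ⨂[ℤ] _ : Fin n, Tot C

namespace TP

variable (C : ChainComplex (AddCommGrpCat.{u}) ℕ)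

/-- The elements of degree `k` of `C^n`. -/
def deg (n k : ℕ) : Submodule ℤ (TP C n) :=
  Submodule.span ℤ {z | ∃ (p : Fin n → ℕ) (x : ∀ j, C.X (p j)), ∑ j, p j = k ∧
    z = PiTensorProduct.tprod ℤ fun j => Tot.of C (p j) (x j)}

/-- The differential `∑_j 1 ⊗ ⋯ ⊗ ∂ ⊗ ⋯ ⊗ 1` of `C^n`, with the Koszul signs. -/
def d (n : ℕ) : TP C n →ₗ[ℤ] TP C n :=
  ∑ j : Fin n, PiTensorProduct.map fun k : Fin n =>
    if k < j then Tot.sgn C 1 else if k = j then Tot.d C else LinearMap.id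

/-- The Koszul sign of `σ` on a tensor product of homogeneous elements with parities `e`. -/
def koszul {n : ℕ} (σ : Equiv.Perm (Fin n)) (e : Fin n → Bool) : ℤ :=
  ∏ j : Fin n, ∏ k : Fin n, if j < k ∧ σ k < σ j ∧ e j = true ∧ e k = true then -1 else 1

/-- The left action of `S_n` on `C^n`: the factor in position `j` is moved to position `σ j`, with
the Koszul sign. -/
def perm {n : ℕ} (σ : Equiv.Perm (Fin n)) : TP C n →ₗ[ℤ] TP C n :=
  ∑ e : Fin n → Bool, koszul σ e •
    ((PiTensorProduct.reindex ℤ (fun _ : Fin n => Tot C) σ).toLinearMap ∘ₗ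
      PiTensorProduct.map fun j => Tot.parity C (e j))

variable {C} in
/-- The map of tensor powers induced by a chain map. -/
def map {D : ChainComplex (AddCommGrpCat.{u}) ℕ} (f : C ⟶ D) (n : ℕ) : TP C n →ₗ[ℤ] TP D n :=
  PiTensorProduct.map fun _ => Tot.map f

variable {C} in
/-- The map `1 ⊗ ⋯ ⊗ f ⊗ ⋯ ⊗ 1 : C^{m+1} → C^{m+n}` (without signs) with
`f : C → C^n` applied to the factor in position `i`. -/
def insert {m n : ℕ} (i : Fin (m + 1)) (f : Tot C →ₗ[ℤ] TP C n) :
    TP C (m + 1) →ₗ[ℤ] TP C (m + n) :=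
  (PiTensorProduct.reindex ℤ (fun _ => Tot C) (SymOperad.slotEquiv i n)).toLinearMap ∘ₗ
    (PiTensorProduct.tmulEquiv ℤ (Tot C)).toLinearMap ∘ₗ
    TensorProduct.map LinearMap.id
      (f ∘ₗ (PiTensorProduct.subsingletonEquiv (R := ℤ) (s := fun _ => Tot C)
        (0 : Fin 1)).toLinearMap) ∘ₗ
    (PiTensorProduct.tmulEquiv ℤ (Tot C)).symm.toLinearMap ∘ₗ
    (PiTensorProduct.reindex ℤ (fun _ => Tot C) (SymOperad.slotEquiv i 1).symm).toLinearMap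

variable {C} in
/-- The map `1 ⊗ ⋯ ⊗ f ⊗ ⋯ ⊗ 1` for `f` of degree `p`, with the Koszul sign
`(-1)^{p (|c_1| + ⋯ + |c_{i-1}|)}` for moving `f` past the factors before position `i`. -/
def insertKoszul {m n : ℕ} (i : Fin (m + 1)) (p : ℕ) (f : Tot C →ₗ[ℤ] TP C n) :
    TP C (m + 1) →ₗ[ℤ] TP C (m + n) :=
  insert i f ∘ₗ PiTensorProduct.map fun j => if j < i then Tot.sgn C p else LinearMap.id

end TP

/-! ### Coalgebras over `𝔖` -/

open SymOperad in
/-- The structure of a coalgebra over the operad `𝔖` on a chain complex `C`, in adjoint form: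
chain maps `f_n : RS_n ⊗ C → C^n`, `n ≥ 1` (here `diag n` is `f_{n+1}`), that are
`S_n`-equivariant, unital, and carry the compositions of `𝔖` to compositions of maps. -/
structure SCoalgStr (C : ChainComplex (AddCommGrpCat.{u}) ℕ) where
  diag : ∀ n : ℕ, RS (n + 1) →ₗ[ℤ] Tot C →ₗ[ℤ] TP C (n + 1)
  diag_deg : ∀ (n : ℕ) (a : BarWord (n + 1)) (k : ℕ) (c : C.X k),
    diag n (word a) (Tot.of C k c) ∈ TP.deg C (n + 1) (a.deg + k)
  diag_bdry : ∀ (n : ℕ) (a : BarWord (n + 1)) (c : Tot C),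
    TP.d C (n + 1) (diag n (word a) c) =
      diag n (bdry (word a)) c + (-1 : ℤ) ^ a.deg • diag n (word a) (Tot.d C c)
  diag_act : ∀ (n : ℕ) (σ : Equiv.Perm (Fin (n + 1))) (a : RS (n + 1)) (c : Tot C),
    diag n (act σ a) c = TP.perm C σ (diag n a c)
  diag_one : ∀ c : Tot C, diag 0 (word (1, [])) c = PiTensorProduct.tprod ℤ fun _ => c
  diag_circ : ∀ (n m : ℕ) (i : Fin (m + 1)) (a : BarWord (n + 1)) (b : BarWord (m + 1))
    (c : Tot C),
    diag (m + n) (circ i (word a) (word b)) c =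
      TP.insertKoszul i a.deg (diag n (word a)) (diag m (word b) c)

/-- A chain map is a morphism of coalgebras over `𝔖` if it commutes with the structure maps. -/
def IsCoalgHom {C D : ChainComplex (AddCommGrpCat.{u}) ℕ} (S : SCoalgStr C) (T : SCoalgStr D)
    (f : C ⟶ D) : Prop :=
  ∀ (n : ℕ) (a : SymOperad.RS (n + 1)) (c : Tot C),
    T.diag n a (Tot.map f c) = TP.map f (n + 1) (S.diag n a c)

/-- An m-coalgebra over `𝔖`: a `ℤ`-free chain complex `C` with `C_0 = ℤ` and `C_1 = 0`, with the
structure of a coalgebra over `𝔖`. -/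
structure MCoalg where
  cx : ChainComplex (AddCommGrpCat.{u}) ℕ
  str : SCoalgStr cx
  free : ∀ k, Module.Free ℤ (cx.X k)
  zero : Nonempty (cx.X 0 ≃+ ℤ)
  one : Subsingleton (cx.X 1)

namespace MCoalg

/-- A morphism of m-coalgebras over `𝔖`: a morphism of coalgebras over `𝔖` that preserves homology
in dimensions `0` and `1`. -/
@[ext]
structure Hom (A B : MCoalg.{u}) where
  toHom : A.cx ⟶ B.cx
  isCoalgHom : IsCoalgHom A.str B.str toHom
  iso_zero : IsIso (HomologicalComplex.homologyMap toHom 0)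
  iso_one : IsIso (HomologicalComplex.homologyMap toHom 1)

end MCoalg

theorem Tot.map_id (C : ChainComplex (AddCommGrpCat.{u}) ℕ) :
    Tot.map (𝟙 C) = LinearMap.id := by
  refine Tot.hom_ext fun k x => ?_
  simp [Tot.map]

theorem Tot.map_comp {C D E : ChainComplex (AddCommGrpCat.{u}) ℕ} (f : C ⟶ D) (g : D ⟶ E) :
    Tot.map (f ≫ g) = Tot.map g ∘ₗ Tot.map f := by
  refine Tot.hom_ext fun k x => ?_
  simp [Tot.map]

namespace MCoalg

instance : Category MCoalg.{u} where
  Hom := Hom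
  id A :=
    { toHom := 𝟙 A.cx
      isCoalgHom := by
        intro n a c
        simp only [TP.map, Tot.map_id, PiTensorProduct.map_id, LinearMap.id_apply]
      iso_zero := by rw [HomologicalComplex.homologyMap_id]; infer_instance
      iso_one := by rw [HomologicalComplex.homologyMap_id]; infer_instance }
  comp f g :=
    { toHom := f.toHom ≫ g.toHom
      isCoalgHom := by
        intro n a c
        simp only [TP.map, Tot.map_comp, PiTensorProduct.map_comp, LinearMap.comp_apply]
        rw [g.isCoalgHom n a, f.isCoalgHom n a]
        rfl
      iso_zero := by
        have := f.iso_zero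
        have := g.iso_zero
        rw [HomologicalComplex.homologyMap_comp]; infer_instance
      iso_one := by
        have := f.iso_one
        have := g.iso_one
        rw [HomologicalComplex.homologyMap_comp]; infer_instance }

/-- The underlying chain complex of an m-coalgebra. -/
def toComplex : MCoalg.{u} ⥤ ChainComplex (AddCommGrpCat.{u}) ℕ where
  obj A := A.cx
  map f := Hom.toHom f

end MCoalg

/-! ### Simplicial sets and their chains -/

section SimplicialSets

open Simplicial

/-- The functor sending a simplicial set to its (normalized) simplicial chain complex with integer
coefficients, with basis the nondegenerate simplices. -/
def simplicialChains : SSet.{u} ⥤ ChainComplex (AddCommGrpCat.{u}) ℕ :=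
  SSet.normalizedChainComplexFunctorObj (AddCommGrpCat.of (ULift.{u} ℤ))

/-- A pointed simplicial set is simply-connected and 2-reduced if its realization is
simply-connected and it has only one simplex in each of the dimensions `0` and `1`. -/
def isSimplyConnectedTwoReduced : ObjectProperty (Under (Δ[0] : SSet.{u})) := fun X =>
  SimplyConnectedSpace (SSet.toTop.obj X.right) ∧
    ∀ k < 2, Subsingleton (X.right.obj (op (SimplexCategory.mk k)))

/-- The category `SS` of pointed, simply-connected, 2-reduced simplicial sets. -/
abbrev SS : Type (u + 1) := (isSimplyConnectedTwoReduced.{u}).FullSubcategory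

/-- The underlying simplicial set. -/
def SS.forget : SS.{u} ⥤ SSet.{u} :=
  (isSimplyConnectedTwoReduced.{u}).ι ⋙ Under.forget (Δ[0] : SSet.{u})

/-- The chain given by a simplex; it is zero if the simplex is degenerate. -/
def chain (X : SSet.{u}) {k : ℕ} (x : X _⦋k⦌) : Tot (simplicialChains.obj X) :=
  Tot.of (simplicialChains.obj X) k
    ((SSet.ιNormalizedChainComplex (R := AddCommGrpCat.of (ULift.{u} ℤ)) X x).hom (ULift.up 1))

/-- The homomorphism on `j`-chains with given values on the nondegenerate simplices. -/
def chainDesc (X : SSet.{u}) {j : ℕ} {M : Type u} [AddCommGroup M] (f : X _⦋j⦌ → M) :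
    (simplicialChains.obj X).X j →+ M :=
  ((SSet.isColimitCofanNormalizedChainComplex X (AddCommGrpCat.of (ULift.{u} ℤ)) j).desc
    (Cofan.mk (AddCommGrpCat.of M) fun x =>
      AddCommGrpCat.ofHom ((zmultiplesHom M (f x.1)).comp
        (AddEquiv.ulift : ULift.{u} ℤ ≃+ ℤ).toAddMonoidHom))).hom

namespace StandardSimplex

variable (k : ℕ)

/-- The simplex `[i_0, …, i_j, k]` of `Δ[k]`, for a simplex `[i_0, …, i_j]`. -/
def append {j : ℕ} (x : (Δ[k] : SSet.{u}) _⦋j⦌) : (Δ[k] : SSet.{u}) _⦋j + 1⦌ :=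
  SSet.stdSimplex.objMk
    { toFun := Fin.snoc (α := fun _ => Fin (k + 1)) (fun t : Fin (j + 1) => x t) (Fin.last k)
      monotone' := by
        intro a b hab
        induction b using Fin.lastCases with
        | last => simpa using Fin.le_last _
        | cast b =>
          induction a using Fin.lastCases with
          | last => exact absurd hab (not_le.2 (Fin.castSucc_lt_last b))
          | cast a =>
            simp only [Fin.snoc_castSucc]
            exact (SSet.stdSimplex.asOrderHom x).monotone (Fin.castSucc_le_castSucc_iff.1 hab) }

/-- The `k`-simplex `[0, …, k]` of `Δ[k]`. -/
def top : (Δ[k] : SSet.{u}) _⦋k⦌ := SSet.stdSimplex.objEquiv.symm (𝟙 _)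

/-- The vertex `[k]` of `Δ[k]`. -/
def lastVertex : (Δ[k] : SSet.{u}) _⦋0⦌ :=
  SSet.stdSimplex.objMk (n := ⦋k⦌) (m := op ⦋0⦌) (OrderHom.const _ (Fin.last k))

/-- The contraction `[i_0, …, i_j] ↦ (-1)^{j+1} [i_0, …, i_j, k]` of the chains of `Δ[k]`; it is
zero on `[i_0, …, i_j]` if `i_j = k`. -/
def contr : Tot (simplicialChains.obj (Δ[k] : SSet.{u})) →ₗ[ℤ]
    Tot (simplicialChains.obj (Δ[k] : SSet.{u})) :=
  Tot.desc fun j => chainDesc (Δ[k] : SSet.{u}) (j := j) fun x =>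
    (-1 : ℤ) ^ (j + 1) • chain (Δ[k] : SSet.{u}) (append k x)

/-- The augmentation followed by the inclusion of `[k]`: vertices go to `[k]`, simplices of positive
dimension to zero. -/
def aug : Tot (simplicialChains.obj (Δ[k] : SSet.{u})) →ₗ[ℤ]
    Tot (simplicialChains.obj (Δ[k] : SSet.{u})) :=
  Tot.desc fun j => chainDesc (Δ[k] : SSet.{u}) (j := j) fun _ =>
    if j = 0 then chain (Δ[k] : SSet.{u}) (lastVertex k) else 0

/-- The contraction `Φ = ∑_j ε ⊗ ⋯ ⊗ ε ⊗ s ⊗ 1 ⊗ ⋯ ⊗ 1` of the `n`-th tensor power of the chains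
of `Δ[k]`. -/
def contrTP (n : ℕ) : TP (simplicialChains.obj (Δ[k] : SSet.{u})) n →ₗ[ℤ]
    TP (simplicialChains.obj (Δ[k] : SSet.{u})) n :=
  ∑ j : Fin n, PiTensorProduct.map fun i : Fin n =>
    if i < j then aug k else if i = j then contr k else LinearMap.id

end StandardSimplex

open SymOperad StandardSimplex in
/-- Coalgebra structures over `𝔖` on the chains of all standard simplices are given by the Cartan
construction if `f_n([] ⊗ [0]) = [0] ⊗ ⋯ ⊗ [0]` on `Δ[0]` and, for `A = 1[a₁|…|a_p]` and
`s^k = [0, …, k]` with `p + k > 0`,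
`f_n(A ⊗ s^k) = Φ f_n(∂A ⊗ s^k) + (-1)^p Φ f_n(A ⊗ ∂s^k)`. -/
def IsCartanConstruction (S : ∀ k : ℕ, SCoalgStr (simplicialChains.obj (Δ[k] : SSet.{u}))) :
    Prop :=
  (∀ n : ℕ, (S 0).diag n (word (1, [])) (chain _ (top 0)) =
      PiTensorProduct.tprod ℤ fun _ => chain _ (top 0)) ∧
  ∀ (n k : ℕ) (l : List {g : Equiv.Perm (Fin (n + 1)) // g ≠ 1}), 0 < l.length + k →
    (S k).diag n (word (1, l)) (chain _ (top k)) =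
      contrTP k (n + 1) ((S k).diag n (bdry (word (1, l))) (chain _ (top k))) +
      (-1 : ℤ) ^ l.length • contrTP k (n + 1)
        ((S k).diag n (word (1, l)) (Tot.d _ (chain _ (top k))))

end SimplicialSets

end

noncomputable section

open TensorProduct Limits Opposite

namespace SymOperad

/-! ### Bar resolutions -/

/-! This is an acyclic-models argument in which the contractions satisfy enough side conditions to
turn homotopies into equalities. Two contractions are used: `contr` (φ) on RS_n, with ∂φ + φ∂ = 1 −
ε (`bdry_contr`), and Φ = `contrTP` on C(Δ[k])^n, with dΦ + Φd = 1 − ε⊗⋯⊗ε (`d_contrTP`). Since ss =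
sε = εs = 0 on C(Δ[k]), also ΦΦ = 0 and (ε⊗⋯⊗ε)Φ = 0. Hence any u killed by Φ and by ε⊗⋯⊗ε equals
Φ(du): it is determined by its boundary.

Recursion on p + k gives the values f(1[a₁|…|a_p] ⊗ [0,…,k]), and equivariance and naturality extend
them to all words and all nondegenerate simplices. The extension is natural for every simplicial map
only if the values die on degenerate simplices. They do, because a degeneracy Δ[j+1] → Δ[j]
preserves the last vertex and therefore commutes with Φ (`map_value_of_degenerate`).

The chain map property (`d_value`) is the usual one: if y denotes f(∂A ⊗ s^k) ± f(A ⊗ ∂s^k), then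
dΦy = y − Φdy − (ε⊗⋯⊗ε)y, where dy = 0 by induction and the augmentation of y vanishes. The same
computation on the bar side shows that ∘_i is a chain map (`circ_bdry_aux`).

Compatibility with ∘_i (`diag_circ_aux`) compares two elements, each equal to Φ of its boundary. For
f((a ∘_i b) ⊗ s^k) this is the recursion, which applies because a ∘_i b stays in the span of the
symbols 1[…] (`circ_mem_homogOne`). For the composite of f(b ⊗ –) with f(a ⊗ –) it is the vanishing
in `contrTP_insertKoszul_diag`, which holds because the recursion is valid on every
positive-dimensional simplex ending in the last vertex, so that f(a ⊗ s(x)) again lies in the image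
of Φ. The boundaries agree by induction on p + q + k and the Leibniz rules. General words are
reduced to those with g = 1 by equivariance, where all the work is in the Koszul signs
(`insertKoszul_perm`).

For a 2-reduced simplicial set C_0 = ℤ and C_1 = 0, so the conditions on m-coalgebras and on H_0,
H_1 are immediate. -/

theorem bilin_word {n m : ℕ} {M : Type*} [AddCommMonoid M] [Module ℤ M]
    (f : BarWord n → BarWord m → M) (a : BarWord n) (b : BarWord m) :
    bilin f (word a) (word b) = f a b := by
  simp [bilin, word]

theorem RS_hom_ext {n : ℕ} {M : Type*} [AddCommMonoid M] [Module ℤ M] {f g : RS n →ₗ[ℤ] M}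
    (h : ∀ w, f (word w) = g (word w)) : f = g :=
  Finsupp.lhom_ext' fun w => LinearMap.ext_ring (h w)

theorem act_word {n : ℕ} (σ : Equiv.Perm (Fin n)) (w : BarWord n) :
    act σ (word w) = word (σ * w.1, w.2) := by
  simp [act, word, Finsupp.lmapDomain_apply]

theorem act_mul {n : ℕ} (σ τ : Equiv.Perm (Fin n)) (x : RS n) :
    act (σ * τ) x = act σ (act τ x) := by
  have : act (σ * τ) = act σ ∘ₗ act τ := RS_hom_ext fun w => by simp [act_word, mul_assoc]
  exact LinearMap.congr_fun this x

theorem act_one {n : ℕ} (x : RS n) : act 1 x = x := by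
  have : act (1 : Equiv.Perm (Fin n)) = LinearMap.id := RS_hom_ext fun w => by simp [act_word]
  exact LinearMap.congr_fun this x

theorem act_symbol {n : ℕ} (σ g : Equiv.Perm (Fin n)) (l : List (Equiv.Perm (Fin n))) :
    act σ (symbol g l) = symbol (σ * g) l := by
  unfold symbol
  split_ifs <;> simp [act_word]

theorem symbol_map {n : ℕ} (g : Equiv.Perm (Fin n)) (l : List {g : Equiv.Perm (Fin n) // g ≠ 1}) :
    symbol g (l.map (fun a => a.1)) = word (g, l) := by
  unfold symbol
  have h : ∀ a ∈ l.map (fun a => a.1), a ≠ 1 := by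
    intro a ha
    obtain ⟨b, -, rfl⟩ := List.mem_map.1 ha
    exact b.2
  rw [dif_pos h]
  congr 2
  apply List.map_injective_iff.2 Subtype.val_injective
  simp

theorem contr_word {n : ℕ} (w : BarWord n) :
    contr (word w) = if h : w.1 = 1 then 0 else word (1, ⟨w.1, h⟩ :: w.2) := by
  simp [contr, word]

theorem contr_word_one {n : ℕ} (l : List {g : Equiv.Perm (Fin n) // g ≠ 1}) :
    contr (word (1, l)) = 0 := by
  simp [contr_word]

theorem contr_symbol {n : ℕ} (g : Equiv.Perm (Fin n)) (l : List (Equiv.Perm (Fin n))) :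
    contr (symbol g l) = symbol 1 (g :: l) := by
  by_cases h : ∀ a ∈ l, a ≠ 1
  · by_cases hg : g = 1
    · rw [symbol, dif_pos h, contr_word, symbol, dif_pos hg,
        dif_neg (fun h' => h' g (List.mem_cons_self ..) hg)]
    · have h' : ∀ a ∈ g :: l, a ≠ 1 := by simpa [hg] using h
      rw [symbol, dif_pos h, contr_word, symbol, dif_pos h', dif_neg hg]
      rfl
  · have h' : ¬ ∀ a ∈ g :: l, a ≠ 1 := fun h' => h fun a ha => h' a (List.mem_cons_of_mem _ ha)
    rw [symbol, dif_neg h, symbol, dif_neg h', map_zero]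

theorem face_mul {G : Type*} [Group G] (i : ℕ) (s g : G) (l : List G) :
    face i (s * g) l = (s * (face i g l).1, (face i g l).2) := by
  match i, l with
  | _, [] => simp [face]
  | 0, a :: l => simp [face, mul_assoc]
  | i + 1, [a] => simp [face]
  | i + 1, a :: b :: l => simp [face]

theorem length_face {G : Type*} [Group G] (i : ℕ) (g : G) (l : List G) :
    (face i g l).2.length = l.length - 1 := by
  induction l generalizing i g with
  | nil => simp [face]
  | cons a l ih =>
    match i, l with
    | 0, l => simp [face]
    | i + 1, [] => simp [face]
    | i + 1, b :: l => simp [face, ih]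

/-- The boundary of a symbol `g[g₁|…|g_p]`, as a sum of its faces. -/
def symbolBdry {n : ℕ} (g : Equiv.Perm (Fin n)) (l : List (Equiv.Perm (Fin n))) : RS n :=
  if l = [] then 0 else
    ∑ i ∈ Finset.range (l.length + 1), (-1 : ℤ) ^ i • symbol (face i g l).1 (face i g l).2

theorem bdry_word {n : ℕ} (g : Equiv.Perm (Fin n))
    (l : List {g : Equiv.Perm (Fin n) // g ≠ 1}) :
    bdry (word (g, l)) = symbolBdry g (l.map (fun a => a.1)) := by
  rw [bdry, word, Finsupp.linearCombination_single, one_smul, symbolBdry]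
  simp only [List.map_eq_nil_iff, BarWord.deg, List.length_map]

theorem bdry_word_nil {n : ℕ} (g : Equiv.Perm (Fin n)) : bdry (word (g, [])) = 0 := by
  simp [bdry_word, symbolBdry]

theorem symbolBdry_mul {n : ℕ} (s g : Equiv.Perm (Fin n)) (l : List (Equiv.Perm (Fin n))) :
    symbolBdry (s * g) l = act s (symbolBdry g l) := by
  unfold symbolBdry
  split_ifs
  · simp
  · simp [face_mul, act_symbol]

theorem bdry_act {n : ℕ} (σ : Equiv.Perm (Fin n)) (x : RS n) :
    bdry (act σ x) = act σ (bdry x) := by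
  have : bdry ∘ₗ act σ = act σ ∘ₗ bdry := RS_hom_ext fun ⟨g, l⟩ => by
    simp [act_word, bdry_word, symbolBdry_mul]
  exact LinearMap.congr_fun this x

theorem symbolBdry_singleton {n : ℕ} (g a : Equiv.Perm (Fin n)) :
    symbolBdry g [a] = word (g * a, []) - word (g, []) := by
  have h : ∀ g : Equiv.Perm (Fin n), symbol g [] = word (g, []) := fun g => symbol_map g []
  simp [symbolBdry, Finset.sum_range_succ, face, h, sub_eq_add_neg]

/-- The zeroth face of 1[g|l] is g[l]; the remaining faces are φ of the faces of g[l], with index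
shifted by one and hence opposite sign. For empty l the last face 1[] has no counterpart, since
degree-zero symbols have boundary 0 by convention; that case produces the augmentation term in
`bdry_contr`. -/
theorem symbolBdry_one_cons {n : ℕ} (g : Equiv.Perm (Fin n)) {l : List (Equiv.Perm (Fin n))}
    (hl : l ≠ []) : symbolBdry 1 (g :: l) = symbol g l - contr (symbolBdry g l) := by
  unfold symbolBdry
  rw [if_neg (by simp), if_neg hl, Finset.sum_range_succ', List.length_cons, map_sum,
    sub_eq_neg_add, ← Finset.sum_neg_distrib]
  obtain ⟨b, l, rfl⟩ := List.exists_cons_of_ne_nil hl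
  refine congrArg₂ (· + ·) (Finset.sum_congr rfl fun i _ => ?_) ?_
  · rw [map_smul, contr_symbol, pow_succ, mul_neg_one, neg_smul]
    rfl
  · simp [face]

/-- The augmentation of the bar resolution. -/
def aug {n : ℕ} : RS n →ₗ[ℤ] ℤ :=
  Finsupp.linearCombination ℤ fun w => if w.2 = [] then 1 else 0

theorem aug_word {n : ℕ} (w : BarWord n) : aug (word w) = if w.2 = [] then 1 else 0 := by
  simp [aug, word]

theorem bdry_contr {n : ℕ} (x : RS n) :
    bdry (contr x) = x - contr (bdry x) - aug x • word (1, []) := by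
  have : (bdry ∘ₗ contr : RS n →ₗ[ℤ] RS n) =
      LinearMap.id - contr ∘ₗ bdry - aug.smulRight (word (1, [])) := by
    refine RS_hom_ext fun ⟨g, l⟩ => ?_
    simp only [LinearMap.comp_apply, LinearMap.sub_apply, LinearMap.id_apply,
      LinearMap.smulRight_apply, aug_word]
    have key : ∀ (g a : Equiv.Perm (Fin n)) (l : List (Equiv.Perm (Fin n))),
        symbolBdry 1 (g :: a :: l) = symbol g (a :: l) - contr (symbolBdry g (a :: l)) :=
      fun g a l => symbolBdry_one_cons g (by simp)
    by_cases hg : g = 1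
    · subst hg
      rw [contr_word_one, map_zero]
      rcases l with _ | ⟨a, l⟩
      · simp [bdry_word_nil]
      -- For g = 1 the left side is zero, so φ∂ must be the identity on 1[a|l]. The leading face
      -- a[l] contributes φ(a[l]) = 1[a|l], and all other faces lie in the image of φ, where φφ = 0.
      · have h1 : contr (symbolBdry 1 ((a :: l).map (fun a => a.1))) = word (1, a :: l) := by
          rcases l with _ | ⟨b, l⟩
          · simp [symbolBdry_singleton, contr_word, a.2]
          · have hc : ∀ y : RS n, contr (contr y) = 0 := by
              intro y
              have : contr ∘ₗ contr = (0 : RS n →ₗ[ℤ] RS n) := RS_hom_ext fun w => by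
                simp only [LinearMap.comp_apply, contr_word, LinearMap.zero_apply]
                split_ifs
                · simp
                · simp [contr_word]
              exact LinearMap.congr_fun this y
            rw [List.map_cons, List.map_cons, key, map_sub, hc, sub_zero, contr_symbol,
              ← List.map_cons, ← List.map_cons, symbol_map]
        rw [bdry_word, h1]
        simp
    · rw [contr_word, dif_neg hg, bdry_word]
      rcases l with _ | ⟨a, l⟩
      · simp [symbolBdry_singleton, bdry_word_nil]
      · rw [List.map_cons, List.map_cons, key, ← List.map_cons, symbol_map, bdry_word]
        simp
  exact LinearMap.congr_fun this x

/-- The elements of `RS_n` of degree `p`. -/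
def homog (n p : ℕ) : Submodule ℤ (RS n) := Submodule.span ℤ (Set.image word {w | w.deg = p})

/-- The span of the symbols `1[g₁|…|g_p]` in `RS_n`. -/
def homogOne (n p : ℕ) : Submodule ℤ (RS n) :=
  Submodule.span ℤ (Set.image (fun l => word (1, l)) {l | l.length = p})

theorem word_mem_homog {n : ℕ} (w : BarWord n) : word w ∈ homog n w.deg :=
  Submodule.subset_span ⟨w, rfl, rfl⟩

theorem homog_induction {n p : ℕ} {M : Type*} [AddCommGroup M] {f g : RS n →ₗ[ℤ] M}
    (h : ∀ w : BarWord n, w.deg = p → f (word w) = g (word w)) {x : RS n} (hx : x ∈ homog n p) :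
    f x = g x := by
  refine LinearMap.eqOn_span ?_ hx
  rintro _ ⟨w, hw, rfl⟩
  exact h w hw

theorem homogOne_induction {n p : ℕ} {M : Type*} [AddCommGroup M] {f g : RS n →ₗ[ℤ] M}
    (h : ∀ l, l.length = p → f (word (1, l)) = g (word (1, l))) {x : RS n}
    (hx : x ∈ homogOne n p) : f x = g x := by
  refine LinearMap.eqOn_span ?_ hx
  rintro _ ⟨w, hw, rfl⟩
  exact h w hw

theorem homog_map_mem {n p : ℕ} {M : Type*} [AddCommGroup M] {f : RS n →ₗ[ℤ] M}
    {S : Submodule ℤ M} (h : ∀ w : BarWord n, w.deg = p → f (word w) ∈ S)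
    {x : RS n} (hx : x ∈ homog n p) : f x ∈ S := by
  have : homog n p ≤ S.comap f := Submodule.span_le.2 (by
    rintro _ ⟨w, hw, rfl⟩
    exact h w hw)
  exact this hx

theorem homog_induction₂ {n m p q : ℕ} {M : Type*} [AddCommGroup M]
    {f g : RS n →ₗ[ℤ] RS m →ₗ[ℤ] M}
    (h : ∀ (a : BarWord n) (b : BarWord m), a.deg = p → b.deg = q →
      f (word a) (word b) = g (word a) (word b))
    {x : RS n} (hx : x ∈ homog n p) {y : RS m} (hy : y ∈ homog m q) : f x y = g x y := by
  have h1 : ∀ a : BarWord n, a.deg = p → f (word a) y = g (word a) y := fun a ha =>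
    homog_induction (fun b hb => h a b ha hb) hy
  exact homog_induction (f := f.flip y) (g := g.flip y) h1 hx

theorem symbol_mem_homog {n p : ℕ} (g : Equiv.Perm (Fin n)) (l : List (Equiv.Perm (Fin n)))
    (h : l.length = p) : symbol g l ∈ homog n p := by
  unfold symbol
  split_ifs with h'
  · exact Submodule.subset_span ⟨_, by simpa [BarWord.deg] using h, rfl⟩
  · exact zero_mem _

theorem bdry_mem_homog {n p : ℕ} {x : RS n} (hx : x ∈ homog n (p + 1)) : bdry x ∈ homog n p := by
  refine homog_map_mem (fun ⟨g, l⟩ hw => ?_) hx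
  rw [bdry_word, symbolBdry]
  split_ifs
  · exact zero_mem _
  · refine sum_mem fun i _ => Submodule.smul_mem _ _ (symbol_mem_homog _ _ ?_)
    rw [length_face, List.length_map]
    exact Nat.sub_eq_of_eq_add hw

theorem bdry_eq_zero {n : ℕ} {x : RS n} (hx : x ∈ homog n 0) : bdry x = 0 :=
  homog_induction (g := 0) (fun ⟨g, l⟩ hw => by
    obtain rfl : l = [] := List.length_eq_zero_iff.1 hw
    simp [bdry_word_nil]) hx

theorem act_mem_homog {n p : ℕ} (σ : Equiv.Perm (Fin n)) {x : RS n} (hx : x ∈ homog n p) :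
    act σ x ∈ homog n p :=
  homog_map_mem (fun w hw => by
    rw [act_word]
    exact Submodule.subset_span ⟨(σ * w.1, w.2), hw, rfl⟩) hx

theorem contr_mem_homogOne {n p : ℕ} {x : RS n} (hx : x ∈ homog n p) :
    contr x ∈ homogOne n (p + 1) :=
  homog_map_mem (fun w hw => by
    rw [contr_word]
    split_ifs with h
    · exact zero_mem _
    · exact Submodule.subset_span ⟨_, congrArg (· + 1) hw, rfl⟩) hx

theorem homogOne_le (n p : ℕ) : homogOne n p ≤ homog n p := by
  refine Submodule.span_le.2 ?_
  rintro _ ⟨l, hl, rfl⟩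
  exact Submodule.subset_span ⟨(1, l), hl, rfl⟩

theorem aug_eq_zero {n p : ℕ} (hp : p ≠ 0) {x : RS n} (hx : x ∈ homog n p) : aug x = 0 :=
  homog_induction (g := 0) (fun w hw => by
    rw [aug_word, if_neg]
    · rfl
    · rintro h
      exact hp (by rw [← hw, BarWord.deg, h, List.length_nil])) hx

theorem aug_act {n : ℕ} (σ : Equiv.Perm (Fin n)) (x : RS n) : aug (act σ x) = aug x := by
  have : aug ∘ₗ act σ = aug := RS_hom_ext fun w => by simp [act_word, aug_word]
  exact LinearMap.congr_fun this x

theorem aug_bdry {n : ℕ} (x : RS n) : aug (bdry x) = 0 := by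
  have : aug ∘ₗ bdry = (0 : RS n →ₗ[ℤ] ℤ) := RS_hom_ext fun ⟨g, l⟩ => by
    rcases l with _ | ⟨a, _ | ⟨b, l⟩⟩
    · simp [bdry_word_nil]
    · simp [bdry_word, symbolBdry_singleton, aug_word]
    · exact aug_eq_zero (p := l.length + 1) (Nat.succ_ne_zero _)
        (bdry_mem_homog (p := l.length + 1) (word_mem_homog (g, a :: b :: l)))
  exact LinearMap.congr_fun this x

theorem act_word_one {n : ℕ} (w : BarWord n) : act w.1 (word (1, w.2)) = word w := by
  simp [act_word]

theorem word_one_cons {n : ℕ} (a : {g : Equiv.Perm (Fin n) // g ≠ 1})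
    (l : List {g : Equiv.Perm (Fin n) // g ≠ 1}) :
    word (1, a :: l) = contr (word (a.1, l)) := by
  rw [contr_word, dif_neg a.2]

/-- No simplicial identities are needed: by equivariance one may take 1[a|l] = φ(a[l]), and ∂∂φ is
rewritten by applying the homotopy formula twice, leaving φ∂∂ in lower degree and ε∂ = 0. -/
theorem bdry_bdry {n : ℕ} (x : RS n) : bdry (bdry x) = 0 := by
  have key : ∀ p, ∀ x ∈ homog n p, bdry (bdry x) = 0 := by
    intro p
    induction p with
    | zero => intro x hx; rw [bdry_eq_zero hx, map_zero]
    | succ p ih =>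
      intro x hx
      refine homog_induction (f := bdry ∘ₗ bdry) (g := 0) (fun w hw => ?_) hx
      rw [LinearMap.comp_apply, ← act_word_one, bdry_act, bdry_act]
      obtain ⟨g, _ | ⟨a, l⟩⟩ := w
      · simp [bdry_word_nil]
      · have hl : word (a.1, l) ∈ homog n p :=
          Submodule.subset_span ⟨(a.1, l), Nat.succ.inj (show l.length + 1 = p + 1 from hw), rfl⟩
        have h0 := ih _ hl
        simp only [word_one_cons]
        rw [bdry_contr, map_sub bdry, map_sub bdry, bdry_contr, h0, aug_bdry, map_smul, bdry_word_nil]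
        simp
  have : bdry ∘ₗ bdry = (0 : RS n →ₗ[ℤ] RS n) :=
    RS_hom_ext fun w => key _ _ (word_mem_homog w)
  exact LinearMap.congr_fun this x

/-! ### Block permutations -/

theorem blockPerm_inl {m : ℕ} (i : Fin (m + 1)) (n : ℕ) (σ : Equiv.Perm (Fin (m + 1)))
    (j : {j // j ≠ i}) : blockPerm i n σ (slotEquiv i n (.inl j)) =
      slotEquiv (σ i) n (.inl ⟨σ j, fun h => j.2 (σ.injective h)⟩) := by
  simp [blockPerm]

theorem blockPerm_inr {m : ℕ} (i : Fin (m + 1)) (n : ℕ) (σ : Equiv.Perm (Fin (m + 1)))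
    (t : Fin n) : blockPerm i n σ (slotEquiv i n (.inr t)) = slotEquiv (σ i) n (.inr t) := by
  simp [blockPerm]

theorem blockIncl_inl {m n : ℕ} (i : Fin (m + 1)) (τ : Equiv.Perm (Fin n))
    (j : {j // j ≠ i}) : blockIncl i τ (slotEquiv i n (.inl j)) = slotEquiv i n (.inl j) := by
  simp [blockIncl]

theorem blockIncl_inr {m n : ℕ} (i : Fin (m + 1)) (τ : Equiv.Perm (Fin n))
    (t : Fin n) : blockIncl i τ (slotEquiv i n (.inr t)) = slotEquiv i n (.inr (τ t)) := by
  simp [blockIncl]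

theorem perm_ext_slot {m n : ℕ} (i : Fin (m + 1)) {σ τ : Equiv.Perm (Fin (m + n))}
    (h1 : ∀ j, σ (slotEquiv i n (.inl j)) = τ (slotEquiv i n (.inl j)))
    (h2 : ∀ t, σ (slotEquiv i n (.inr t)) = τ (slotEquiv i n (.inr t))) : σ = τ := by
  ext1 x
  obtain ⟨y, rfl⟩ := (slotEquiv i n).surjective x
  rcases y with j | t
  exacts [h1 j, h2 t]

theorem perm_one_symm_apply {α : Type*} (a : α) : (1 : Equiv.Perm α).symm a = a := rfl

theorem blockPerm_one {m : ℕ} (i : Fin (m + 1)) (n : ℕ) : blockPerm i n 1 = 1 :=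
  perm_ext_slot i (fun j => by rw [blockPerm_inl]; rfl) fun t => by rw [blockPerm_inr]; rfl

theorem blockIncl_one {m n : ℕ} (i : Fin (m + 1)) :
    blockIncl i (1 : Equiv.Perm (Fin n)) = 1 :=
  perm_ext_slot i (fun j => by rw [blockIncl_inl]; simp) fun t => by rw [blockIncl_inr]; simp

theorem blockIncl_mul {m n : ℕ} (i : Fin (m + 1)) (σ τ : Equiv.Perm (Fin n)) :
    blockIncl i (σ * τ) = blockIncl i σ * blockIncl i τ :=
  perm_ext_slot i (fun j => by simp only [Equiv.Perm.mul_apply, blockIncl_inl])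
    fun t => by simp only [Equiv.Perm.mul_apply, blockIncl_inr]

/-- A cocycle rule rather than a homomorphism: after τ the long block has moved from place i to
place τ i. -/
theorem blockPerm_mul {m : ℕ} (i : Fin (m + 1)) (n : ℕ) (σ τ : Equiv.Perm (Fin (m + 1))) :
    blockPerm i n (σ * τ) = blockPerm (τ i) n σ * blockPerm i n τ :=
  perm_ext_slot i (fun j => by simp only [Equiv.Perm.mul_apply, blockPerm_inl]; rfl)
    fun t => by simp only [Equiv.Perm.mul_apply, blockPerm_inr]; rfl

theorem blockIncl_blockPerm {m n : ℕ} (i : Fin (m + 1)) (σ : Equiv.Perm (Fin (m + 1)))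
    (τ : Equiv.Perm (Fin n)) :
    blockIncl (σ i) τ * blockPerm i n σ = blockPerm i n σ * blockIncl i τ :=
  perm_ext_slot i
    (fun j => by simp only [Equiv.Perm.mul_apply, blockPerm_inl, blockIncl_inl])
    fun t => by simp only [Equiv.Perm.mul_apply, blockPerm_inr, blockIncl_inr]

/-! ### Compositions -/

/-- Valid for every recursion depth N, including depths that differ from the total degree of the
words. -/
theorem circAux_word {n m : ℕ} (N : ℕ) (i : Fin (m + 1)) (a : BarWord n) (b : BarWord (m + 1)) :
    circAux N i (word a) (word b) =
      act (blockPerm (b.1⁻¹ i) n b.1 * blockIncl (b.1⁻¹ i) a.1)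
        (circAux N (b.1⁻¹ i) (word (1, a.2)) (word (1, b.2))) := by
  cases N with
  | zero => simp [circAux, bilin_word, blockPerm_one, blockIncl_one, act_one]
  | succ N =>
    simp [circAux, bilin_word, blockPerm_one, blockIncl_one, act_one, BarWord.deg,
      perm_one_symm_apply]

theorem circ_word {n m : ℕ} (i : Fin (m + 1)) (a : BarWord n) (b : BarWord (m + 1)) :
    circ i (word a) (word b) =
      act (blockPerm (b.1⁻¹ i) n b.1 * blockIncl (b.1⁻¹ i) a.1)
        (circ (b.1⁻¹ i) (word (1, a.2)) (word (1, b.2))) := by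
  simp only [circ, bilin_word]
  rw [circAux_word]
  rfl

/-- The defining formula normalizes words one at a time; it is consistent with the group actions by
the cocycle rule for block permutations and because a permutation inside the block commutes with
moving the block. -/
theorem circ_act {n m : ℕ} (i : Fin (m + 1)) (τ : Equiv.Perm (Fin n))
    (σ : Equiv.Perm (Fin (m + 1))) (x : RS n) (y : RS (m + 1)) :
    circ (σ i) (act τ x) (act σ y) = act (blockPerm i n σ * blockIncl i τ) (circ i x y) := by
  have key : ∀ (a : BarWord n) (b : BarWord (m + 1)),
      circ (σ i) (act τ (word a)) (act σ (word b)) =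
        act (blockPerm i n σ * blockIncl i τ) (circ i (word a) (word b)) := by
    rintro ⟨g, l⟩ ⟨h, l'⟩
    have e : (σ * h)⁻¹ (σ i) = h⁻¹ i := by simp
    have e2 : blockIncl i τ = blockIncl (h (h⁻¹ i)) τ := by simp
    rw [act_word, act_word, circ_word, circ_word (n := n) i]
    simp only [e, ← act_mul]
    congr 2
    rw [blockIncl_mul, blockPerm_mul, e2, mul_assoc, mul_assoc, ← mul_assoc (blockIncl _ τ),
      blockIncl_blockPerm]
    simp [mul_assoc]
  have h1 : ∀ (a : BarWord n) (y : RS (m + 1)), circ (σ i) (act τ (word a)) (act σ y) =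
      act (blockPerm i n σ * blockIncl i τ) (circ i (word a) y) := fun a y =>
    LinearMap.congr_fun (RS_hom_ext (f := circ (σ i) (act τ (word a)) ∘ₗ act σ)
      (g := act (blockPerm i n σ * blockIncl i τ) ∘ₗ circ i (word a)) fun b => key a b) y
  exact LinearMap.congr_fun (RS_hom_ext (f := (circ (σ i)).flip (act σ y) ∘ₗ act τ)
      (g := act (blockPerm i n σ * blockIncl i τ) ∘ₗ (circ i).flip y) fun a => h1 a y) x

/-- `circ` chooses the recursion depth separately on each pair of words; on homogeneous arguments
this depth is constant, so the depth can be removed from the recursive formula. -/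
theorem circAux_eq_circ {n m p q : ℕ} (i : Fin (m + 1)) {x : RS n} {y : RS (m + 1)}
    (hx : x ∈ homog n p) (hy : y ∈ homog (m + 1) q) : circAux (p + q) i x y = circ i x y :=
  homog_induction₂ (fun a b ha hb => by simp only [circ, bilin_word, ha, hb]) hx hy

theorem circ_nil_nil {n m : ℕ} (i : Fin (m + 1)) :
    circ (n := n) i (word (1, [])) (word (1, [])) = word (1, []) := by
  simp [circ, circAux, bilin_word, BarWord.deg, blockPerm_one, blockIncl_one, act_one]

theorem circ_word_one {n m : ℕ} (i : Fin (m + 1)) (l : List {g : Equiv.Perm (Fin n) // g ≠ 1})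
    (l' : List {g : Equiv.Perm (Fin (m + 1)) // g ≠ 1}) (h : 0 < l.length + l'.length) :
    circ i (word (1, l)) (word (1, l')) =
      contr (circ i (bdry (word (1, l))) (word (1, l')) +
        (-1 : ℤ) ^ l.length • circ i (word (1, l)) (bdry (word (1, l')))) := by
  obtain ⟨N, hN⟩ : ∃ N, l.length + l'.length = N + 1 := ⟨_, (Nat.succ_pred_eq_of_pos h).symm⟩
  have h1 : circAux N i (bdry (word (1, l))) (word (1, l')) =
      circ i (bdry (word (1, l))) (word (1, l')) := by
    -- An empty list has zero boundary, so the degree p − 1 is only used for p > 0.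
    rcases l with _ | ⟨a, l⟩
    · simp [bdry_word_nil]
    · obtain rfl : N = l.length + l'.length := by simp at hN; omega
      exact circAux_eq_circ i (bdry_mem_homog (word_mem_homog (1, a :: l)))
        (word_mem_homog (1, l'))
  have h2 : circAux N i (word (1, l)) (bdry (word (1, l'))) =
      circ i (word (1, l)) (bdry (word (1, l'))) := by
    rcases l' with _ | ⟨a, l'⟩
    · simp [bdry_word_nil]
    · obtain rfl : N = l.length + l'.length := by simp at hN; omega
      exact circAux_eq_circ i (word_mem_homog (1, l))
        (bdry_mem_homog (word_mem_homog (1, a :: l')))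
  rw [← h1, ← h2]
  conv_lhs => rw [circ, bilin_word]
  simp only [BarWord.deg]
  rw [hN]
  simp [circAux, bilin_word, blockPerm_one, blockIncl_one, act_one, BarWord.deg,
      perm_one_symm_apply]

theorem circ_mem_homog_of {n m p q : ℕ} (i : Fin (m + 1))
    (h : ∀ (i : Fin (m + 1)) l l', l.length = p → l'.length = q →
      circ (n := n) i (word (1, l)) (word (1, l')) ∈ homog (m + n) (p + q))
    {x : RS n} {y : RS (m + 1)} (hx : x ∈ homog n p) (hy : y ∈ homog (m + 1) q) :
    circ i x y ∈ homog (m + n) (p + q) := by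
  refine homog_map_mem (f := (circ i).flip y) (fun a ha => ?_) hx
  refine homog_map_mem (f := circ i (word a)) (fun b hb => ?_) hy
  rw [circ_word]
  exact act_mem_homog _ (h _ _ _ ha hb)

/-- In positive degree the composition is a value of φ, hence a combination of symbols with g = 1.
This is stronger than homogeneity and is what later allows the Cartan recursion to be applied to a
∘_i b. -/
theorem circ_mem_aux {n m : ℕ} (N : ℕ) : ∀ (p q : ℕ), p + q = N → ∀ (i : Fin (m + 1)) l l',
    l.length = p → l'.length = q →
      circ (n := n) i (word (1, l)) (word (1, l')) ∈ homogOne (m + n) (p + q) := by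
  induction N with
  | zero =>
    intro p q hpq i l l' hl hl'
    obtain ⟨rfl, rfl⟩ : p = 0 ∧ q = 0 := by omega
    obtain rfl := List.length_eq_zero_iff.1 hl
    obtain rfl := List.length_eq_zero_iff.1 hl'
    rw [circ_nil_nil]
    exact Submodule.subset_span ⟨[], rfl, rfl⟩
  | succ N ih =>
    intro p q hpq i l l' hl hl'
    rw [circ_word_one i l l' (by omega), hpq]
    refine contr_mem_homogOne (add_mem ?_ (Submodule.smul_mem _ _ ?_))
    · rcases l with _ | ⟨a, l⟩
      · simp [bdry_word_nil]
      · obtain rfl : N = l.length + l'.length := by simp at hl; omega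
        exact circ_mem_homog_of i (fun i l l' h h' => homogOne_le _ _ (ih _ _ rfl i l l' h h'))
          (bdry_mem_homog (word_mem_homog (1, a :: l))) (word_mem_homog (1, l'))
    · rcases l' with _ | ⟨a, l'⟩
      · simp [bdry_word_nil]
      · obtain rfl : N = l.length + l'.length := by simp at hl'; omega
        exact circ_mem_homog_of i (fun i l l' h h' => homogOne_le _ _ (ih _ _ rfl i l l' h h'))
          (word_mem_homog (1, l)) (bdry_mem_homog (word_mem_homog (1, a :: l')))

theorem circ_mem_homogOne {n m : ℕ} (i : Fin (m + 1)) (l : List {g : Equiv.Perm (Fin n) // g ≠ 1})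
    (l' : List {g : Equiv.Perm (Fin (m + 1)) // g ≠ 1}) :
    circ i (word (1, l)) (word (1, l')) ∈ homogOne (m + n) (l.length + l'.length) :=
  circ_mem_aux _ _ _ rfl i l l' rfl rfl

theorem circ_mem_homog {n m p q : ℕ} (i : Fin (m + 1)) {x : RS n} {y : RS (m + 1)}
    (hx : x ∈ homog n p) (hy : y ∈ homog (m + 1) q) : circ i x y ∈ homog (m + n) (p + q) :=
  circ_mem_homog_of i (fun i l l' h h' => by
    subst h h'
    exact homogOne_le _ _ (circ_mem_homogOne i l l')) hx hy

/-- Needed to kill the augmentation term of the homotopy formula in `circ_bdry_aux`: together with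
ε∂ = 0 it makes ε vanish on ∂a ∘_i b and a ∘_i ∂b. -/
theorem aug_circ {n m : ℕ} (i : Fin (m + 1)) (x : RS n) (y : RS (m + 1)) :
    aug (circ i x y) = aug x * aug y := by
  have key : ∀ a b, aug (circ (n := n) (m := m) i (word a) (word b)) =
      aug (word a) * aug (word b) := by
    rintro ⟨g, l⟩ ⟨g', l'⟩
    by_cases h : l.length + l'.length = 0
    · obtain ⟨h1, h2⟩ : l.length = 0 ∧ l'.length = 0 := by omega
      obtain rfl := List.length_eq_zero_iff.1 h1
      obtain rfl := List.length_eq_zero_iff.1 h2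
      rw [circ_word, aug_act, circ_nil_nil]
      simp [aug_word]
    · rw [aug_eq_zero h (circ_mem_homog (p := l.length) (q := l'.length) i (word_mem_homog (g, l))
        (word_mem_homog (g', l'))), aug_word,
        aug_word]
      rcases l with _ | ⟨a, l⟩
      · rcases l' with _ | ⟨a, l'⟩
        · simp at h
        · simp
      · simp
  have h1 : ∀ a y, aug (circ (n := n) (m := m) i (word a) y) = aug (word a) * aug y := fun a y =>
    LinearMap.congr_fun (RS_hom_ext (f := aug ∘ₗ circ i (word a))
      (g := LinearMap.mulLeft ℤ (aug (word a)) ∘ₗ aug) fun b => key a b) y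
  exact LinearMap.congr_fun (RS_hom_ext (f := aug ∘ₗ (circ i).flip y)
      (g := LinearMap.mulRight ℤ (aug y) ∘ₗ aug) fun a => h1 a y) x

/-- After reduction to g = 1, x ∘_i y = φ(X) with X = ∂x ∘_i y ± x ∘_i ∂y, and ∂φX = X − φ∂X −
ε(X)[]. The inductive hypothesis gives ∂X = 0, and ε(X) = 0 by multiplicativity. -/
theorem circ_bdry_aux {n m : ℕ} (N : ℕ) : ∀ (p q : ℕ), p + q = N → ∀ (i : Fin (m + 1)),
    ∀ x ∈ homog n p, ∀ y ∈ homog (m + 1) q,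
    bdry (circ i x y) = circ i (bdry x) y + (-1 : ℤ) ^ p • circ i x (bdry y) := by
  induction N with
  | zero =>
    intro p q hpq i x hx y hy
    obtain ⟨rfl, rfl⟩ : p = 0 ∧ q = 0 := by omega
    rw [bdry_eq_zero hx, bdry_eq_zero hy, bdry_eq_zero (circ_mem_homog (p := 0) (q := 0) i hx hy)]
    simp
  | succ N ih =>
    intro p q hpq i x hx y hy
    refine homog_induction₂ (f := (circ i).compr₂ bdry)
      (g := (circ i) ∘ₗ bdry + (-1 : ℤ) ^ p • (circ i).compl₂ bdry) ?_ hx hy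
    rintro ⟨g, l⟩ ⟨g', l'⟩ ha hb
    simp only [LinearMap.compr₂_apply, LinearMap.add_apply, LinearMap.comp_apply,
      LinearMap.smul_apply, LinearMap.compl₂_apply]
    have hi : i = g' (g'⁻¹ i) := by simp
    have hl : l.length = p := ha
    have hl' : l'.length = q := hb
    rw [hi, ← act_word_one (g, l), ← act_word_one (g', l')]
    simp only [bdry_act, circ_act]
    rw [← map_smul, ← map_add]
    congr 1
    generalize g'⁻¹ i = i
    have hx := word_mem_homog (1, l)
    have hy := word_mem_homog (1, l')
    set x := word (1, l)
    set y := word (1, l')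
    have hX : bdry (circ i (bdry x) y + (-1 : ℤ) ^ p • circ i x (bdry y)) = 0 := by
      rw [map_add, map_smul]
      have h1 : bdry (circ i (bdry x) y) = (-1 : ℤ) ^ (p + 1) • circ i (bdry x) (bdry y) := by
        rcases l with _ | ⟨a, l⟩
        · simp [x, bdry_word_nil]
        · rw [ih l.length q (by simp at hl; omega) i _ (bdry_mem_homog hx) y (hl' ▸ hy), bdry_bdry,
            ← hl]
          simp [pow_add]
      have h2 : bdry (circ i x (bdry y)) = circ i (bdry x) (bdry y) := by
        rcases l' with _ | ⟨a, l'⟩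
        · simp [y, bdry_word_nil]
        · rw [ih p l'.length (by simp at hl'; omega) i x (hl ▸ hx) _ (bdry_mem_homog hy),
            bdry_bdry]
          simp
      rw [h1, h2, pow_succ]
      simp
    rw [circ_word_one i l l' (by omega), bdry_contr, hl, hX, map_add, map_smul, aug_circ, aug_circ,
      aug_bdry, aug_bdry]
    simp [x, y]

theorem bdry_circ {n m p : ℕ} (i : Fin (m + 1)) {x : RS n} (hx : x ∈ homog n p)
    (y : RS (m + 1)) :
    bdry (circ i x y) = circ i (bdry x) y + (-1 : ℤ) ^ p • circ i x (bdry y) :=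
  LinearMap.congr_fun (RS_hom_ext (f := bdry ∘ₗ circ i x)
    (g := circ i (bdry x) + (-1 : ℤ) ^ p • circ i x ∘ₗ bdry) fun b =>
    circ_bdry_aux _ p b.deg rfl i x hx _ (word_mem_homog b)) y

end SymOperad

/-! ### Koszul signs -/

/-- The sign `-1` for `true` and `1` for `false`. -/
def boolSign (b : Bool) : ℤ := if b = true then -1 else 1

theorem boolSign_not (a : Bool) : boolSign (!a) = -boolSign a := by
  cases a <;> simp [boolSign]

theorem boolSign_mul_self (a : Bool) : boolSign a * boolSign a = 1 := by
  cases a <;> simp [boolSign]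

theorem boolSign_odd (k : ℕ) : boolSign (decide (Odd k)) = (-1) ^ k := by
  by_cases h : Odd k
  · simp [boolSign, h, h.neg_one_pow]
  · simp [boolSign, h, (Nat.not_odd_iff_even.1 h).neg_one_pow]

/-- Regroups a product over ordered pairs by unordered pairs, so that signs can be compared even
when a permutation reverses the order of a pair. -/
theorem prod_prod_eq_prod_lt {n : ℕ} (f : Fin n → Fin n → ℤ) (h : ∀ j, f j j = 1) :
    ∏ j, ∏ k, f j k = ∏ j, ∏ k, if j < k then f j k * f k j else 1 := by
  have h1 : ∀ j k, f j k = (if j < k then f j k else 1) * (if k < j then f j k else 1) := by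
    intro j k
    rcases lt_trichotomy j k with h' | rfl | h'
    · simp [h', h'.not_gt]
    · simp [h]
    · simp [h', h'.not_gt]
  have h2 : ∏ j, ∏ k, f j k = (∏ j, ∏ k, if j < k then f j k else 1) *
      ∏ j, ∏ k, if k < j then f j k else 1 := by
    simp only [← Finset.prod_mul_distrib]
    exact Finset.prod_congr rfl fun j _ => Finset.prod_congr rfl fun k _ => h1 j k
  rw [h2, Finset.prod_comm (f := fun j k => if k < j then f j k else 1)]
  simp only [← Finset.prod_mul_distrib]
  refine Finset.prod_congr rfl fun j _ => Finset.prod_congr rfl fun k _ => ?_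
  split_ifs <;> simp

namespace TP

/-- A pair is inverted by στ exactly when it is inverted once, by τ or afterwards by σ; a pair
inverted twice contributes (−1)² = 1. -/
theorem koszul_mul {n : ℕ} (σ τ : Equiv.Perm (Fin n)) (e : Fin n → Bool) :
    koszul (σ * τ) e = koszul σ (e ∘ τ.symm) * koszul τ e := by
  have h1 : koszul σ (e ∘ τ.symm) = ∏ j : Fin n, ∏ k : Fin n,
      if τ j < τ k ∧ σ (τ k) < σ (τ j) ∧ e j = true ∧ e k = true then -1 else 1 := by
    unfold koszul
    rw [← Equiv.prod_comp τ]
    refine Finset.prod_congr rfl fun j _ => ?_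
    rw [← Equiv.prod_comp τ]
    simp
  rw [h1, prod_prod_eq_prod_lt _ (by simp)]
  unfold koszul
  simp only [← Finset.prod_mul_distrib]
  refine Finset.prod_congr rfl fun j _ => Finset.prod_congr rfl fun k _ => ?_
  by_cases hjk : j < k
  · have h2 : τ j ≠ τ k := fun h => hjk.ne (τ.injective h)
    have h3 : σ (τ j) ≠ σ (τ k) := fun h => h2 (σ.injective h)
    simp only [hjk, true_and, if_true, Equiv.Perm.mul_apply]
    rcases lt_or_gt_of_ne h2 with h2 | h2 <;> rcases lt_or_gt_of_ne h3 with h3 | h3 <;>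
      simp only [h2, h3, h2.not_gt, h3.not_gt, true_and, false_and, if_false, and_comm] <;>
      (try split_ifs) <;> simp
  · simp [hjk]

/-- Changing the parity of factor i multiplies the sign by the parities of the factors that cross
it. Such factors lie before i either in the source or in the target but not in both; factors before
i in both appear twice in the two products and cancel. It governs both the differential and the
insertion of an odd operation. -/
theorem koszul_update_not {n : ℕ} (σ : Equiv.Perm (Fin n)) (e : Fin n → Bool) (i : Fin n) :
    koszul σ (Function.update e i (!e i)) = koszul σ e *
      (∏ k, if k < i then boolSign (e k) else 1) *
        ∏ k, if σ k < σ i then boolSign (e k) else 1 := by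
  have h1 : ∀ j k, (if j < k ∧ σ k < σ j ∧ Function.update e i (!e i) j = true ∧
        Function.update e i (!e i) k = true then (-1 : ℤ) else 1) =
      (if j < k ∧ σ k < σ j ∧ e j = true ∧ e k = true then -1 else 1) *
      ((if j = i then (if i < k ∧ σ k < σ i then boolSign (e k) else 1) else 1) *
        (if k = i then (if j < i ∧ σ i < σ j then boolSign (e j) else 1) else 1)) := by
    intro j k
    by_cases hj : j = i
    · subst hj
      by_cases hk : k = j
      · subst hk; simp
      · cases hej : e j <;> cases hek : e k <;> simp [hk, hek, boolSign]
        all_goals split_ifs <;> simp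
    · by_cases hk : k = i
      · subst hk
        cases hej : e j <;> cases hek : e k <;> simp [hj, hej, boolSign]
        all_goals split_ifs <;> simp
      · simp [hj, hk]
  unfold koszul
  simp only [h1, Finset.prod_mul_distrib, Finset.prod_ite_eq', Finset.mem_univ, if_true]
  rw [mul_assoc]
  congr 1
  have h2 : ∀ j, (∏ k, if j = i then (if i < k ∧ σ k < σ i then boolSign (e k) else 1) else 1) =
      if j = i then ∏ k, (if i < k ∧ σ k < σ i then boolSign (e k) else 1) else 1 := by
    intro j
    split_ifs <;> simp
  simp only [h2, Finset.prod_ite_eq', Finset.mem_univ, if_true]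
  simp only [← Finset.prod_mul_distrib]
  refine Finset.prod_congr rfl fun k _ => ?_
  rcases lt_trichotomy k i with h | rfl | h
  · have h3 : σ k ≠ σ i := fun h' => h.ne (σ.injective h')
    rcases lt_or_gt_of_ne h3 with h3 | h3 <;> simp [h, h3, h.not_gt, h3.not_gt, boolSign_mul_self]
  · simp
  · simp [h, h.not_gt]

end TP

/-! ### Relative order of the letters inside and outside a block -/

namespace SymOperad

theorem slotEquiv_inl_lt_inl {m : ℕ} (i : Fin (m + 1)) (n : ℕ) (j k : {j // j ≠ i}) :
    slotEquiv i n (.inl j) < slotEquiv i n (.inl k) ↔ j.1 < k.1 := by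
  have hj : j.1.1 ≠ i.1 := fun h => j.2 (Fin.ext h)
  have hk : k.1.1 ≠ i.1 := fun h => k.2 (Fin.ext h)
  change (slotFun i n (.inl j)).1 < (slotFun i n (.inl k)).1 ↔ j.1.1 < k.1.1
  simp only [slotFun, Fin.lt_def]
  split_ifs <;> omega

theorem slotEquiv_inl_lt_inr {m : ℕ} (i : Fin (m + 1)) (n : ℕ) (j : {j // j ≠ i}) (t : Fin n) :
    slotEquiv i n (.inl j) < slotEquiv i n (.inr t) ↔ j.1 < i := by
  have hj : j.1.1 ≠ i.1 := fun h => j.2 (Fin.ext h)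
  have := t.2
  change (slotFun i n (.inl j)).1 < (slotFun i n (.inr t)).1 ↔ j.1.1 < i.1
  simp only [slotFun, Fin.lt_def]
  split_ifs <;> omega

theorem slotEquiv_inr_lt_inl {m : ℕ} (i : Fin (m + 1)) (n : ℕ) (t : Fin n) (j : {j // j ≠ i}) :
    slotEquiv i n (.inr t) < slotEquiv i n (.inl j) ↔ i < j.1 := by
  have hj : j.1.1 ≠ i.1 := fun h => j.2 (Fin.ext h)
  have := t.2
  change (slotFun i n (.inr t)).1 < (slotFun i n (.inl j)).1 ↔ i.1 < j.1.1
  simp only [slotFun, Fin.lt_def]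
  split_ifs <;> omega

theorem slotEquiv_inr_lt_inr {m : ℕ} (i : Fin (m + 1)) (n : ℕ) (s t : Fin n) :
    slotEquiv (m := m) i n (.inr s) < slotEquiv i n (.inr t) ↔ s < t := by
  change (slotFun i n (.inr s)).1 < (slotFun i n (.inr t)).1 ↔ s.1 < t.1
  simp only [slotFun]
  omega

theorem slotEquiv_one_inl {m : ℕ} (i : Fin (m + 1)) (j : {j // j ≠ i}) :
    slotEquiv i 1 (.inl j) = j.1 := by
  apply Fin.ext
  change (slotFun i 1 (.inl j)).1 = j.1.1
  simp only [slotFun]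
  split_ifs <;> omega

theorem slotEquiv_one_inr {m : ℕ} (i : Fin (m + 1)) (t : Fin 1) :
    slotEquiv (m := m) i 1 (.inr t) = i := by
  apply Fin.ext
  change (slotFun i 1 (.inr t)).1 = i.1
  simp only [slotFun]
  omega

theorem blockPerm_eq_self {m : ℕ} (i : Fin (m + 1)) (σ : Equiv.Perm (Fin (m + 1))) :
    blockPerm i 1 σ = σ :=
  perm_ext_slot i (fun j => by rw [blockPerm_inl, slotEquiv_one_inl, slotEquiv_one_inl])
    fun t => by rw [blockPerm_inr, slotEquiv_one_inr, slotEquiv_one_inr]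

end SymOperad

/-! ### Koszul signs of block permutations -/

namespace TP

open SymOperad

/-- The function on a row of `m + n` letters given by its values outside and inside the block in
position `i`. -/
def elim {m n : ℕ} {α : Type*} (i : Fin (m + 1)) (e : {j // j ≠ i} → α) (e' : Fin n → α) :
    Fin (m + n) → α :=
  fun t => Sum.elim e e' ((slotEquiv i n).symm t)

theorem elim_inl {m n : ℕ} {α : Type*} (i : Fin (m + 1)) (e : {j // j ≠ i} → α) (e' : Fin n → α)
    (j : {j // j ≠ i}) : elim i e e' (slotEquiv i n (.inl j)) = e j := by
  simp [elim]

theorem elim_inr {m n : ℕ} {α : Type*} (i : Fin (m + 1)) (e : {j // j ≠ i} → α) (e' : Fin n → α)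
    (t : Fin n) : elim i e e' (slotEquiv i n (.inr t)) = e' t := by
  simp [elim]

theorem elim_ext {m n : ℕ} {α : Type*} (i : Fin (m + 1)) {f g : Fin (m + n) → α}
    (h1 : ∀ j, f (slotEquiv i n (.inl j)) = g (slotEquiv i n (.inl j)))
    (h2 : ∀ t, f (slotEquiv i n (.inr t)) = g (slotEquiv i n (.inr t))) : f = g := by
  funext x
  obtain ⟨y, rfl⟩ := (slotEquiv i n).surjective x
  rcases y with j | t
  exacts [h1 j, h2 t]

theorem prod_slot {m n : ℕ} (i : Fin (m + 1)) (f : Fin (m + n) → ℤ) :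
    ∏ x, f x = (∏ j, f (slotEquiv i n (.inl j))) * ∏ t, f (slotEquiv i n (.inr t)) := by
  rw [← Equiv.prod_comp (slotEquiv i n), Fintype.prod_sum_type]

theorem sum_slot {m n : ℕ} {M : Type*} [AddCommMonoid M] (i : Fin (m + 1)) (f : Fin (m + n) → M) :
    ∑ x, f x = (∑ j, f (slotEquiv i n (.inl j))) + ∑ t, f (slotEquiv i n (.inr t)) := by
  rw [← Equiv.sum_comp (slotEquiv i n), Fintype.sum_sum_type]

theorem koszul_blockIncl {m n : ℕ} (i : Fin (m + 1)) (τ : Equiv.Perm (Fin n))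
    (e : {j // j ≠ i} → Bool) (e' : Fin n → Bool) :
    koszul (blockIncl i τ) (elim i e e') = koszul τ e' := by
  unfold koszul
  simp only [prod_slot i, blockIncl_inl, blockIncl_inr, slotEquiv_inl_lt_inl, slotEquiv_inl_lt_inr,
    slotEquiv_inr_lt_inl, slotEquiv_inr_lt_inr, elim_inr]
  have h1 : ∀ (j k : {j // j ≠ i}) (P : Prop), (j.1 < k.1 ∧ k.1 < j.1 ∧ P) ↔ False := by
    intro j k P; simp only [iff_false]; rintro ⟨h1, h2, -⟩; exact h1.not_gt h2
  have h2 : ∀ (j : {j // j ≠ i}) (P : Prop), (j.1 < i ∧ i < j.1 ∧ P) ↔ False := by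
    intro j P; simp only [iff_false]; rintro ⟨h1, h2, -⟩; exact h1.not_gt h2
  have h3 : ∀ (j : {j // j ≠ i}) (P : Prop), (i < j.1 ∧ j.1 < i ∧ P) ↔ False := by
    intro j P; simp only [iff_false]; rintro ⟨h1, h2, -⟩; exact h1.not_gt h2
  simp only [h1, h2, h3, if_false, Finset.prod_const_one, one_mul]

/-- A block moved as a whole crosses each outer factor with all its letters, so only its total
parity counts; the order inside the block does not change. -/
theorem koszul_blockPerm {m n : ℕ} (i : Fin (m + 1)) (σ : Equiv.Perm (Fin (m + 1)))
    (e : Fin (m + 1) → Bool) (e' : Fin n → Bool) (h : ∏ t, boolSign (e' t) = boolSign (e i)) :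
    koszul (blockPerm i n σ) (elim i (fun j => e j) e') = koszul σ e := by
  -- Regarding σ as a block permutation with a block of length one gives both sides the same shape.
  have h0 : koszul σ e = koszul (blockPerm i 1 σ) (elim i (fun j => e j) fun _ => e i) := by
    rw [blockPerm_eq_self]
    congr 1
    refine elim_ext i (fun j => ?_) fun t => ?_
    · rw [elim_inl, slotEquiv_one_inl]
    · rw [elim_inr, slotEquiv_one_inr]
  rw [h0]
  unfold koszul
  simp only [prod_slot i, blockPerm_inl, blockPerm_inr, slotEquiv_inl_lt_inl, slotEquiv_inl_lt_inr,
    slotEquiv_inr_lt_inl, slotEquiv_inr_lt_inr, elim_inr, elim_inl]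
  have hP : ∀ (P : Prop) [Decidable P],
      (∏ t, if P ∧ e' t = true then (-1 : ℤ) else 1) = if P ∧ e i = true then -1 else 1 := by
    intro P _
    by_cases hp : P
    · simpa [hp, boolSign] using h
    · simp [hp]
  have h1 : ∀ {k : ℕ} (s t : Fin k) (P : Prop), (s < t ∧ t < s ∧ P) ↔ False := by
    intro k j k P; simp only [iff_false]; rintro ⟨h1, h2, -⟩; exact h1.not_gt h2
  simp only [h1, if_false, Finset.prod_const_one, mul_one, Finset.univ_unique, Finset.prod_singleton]
  rw [Finset.prod_comm (s := Finset.univ (α := Fin n))]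
  congr 1
  · refine Finset.prod_congr rfl fun j _ => ?_
    congr 1
    have := hP (j.1 < i ∧ σ i < σ j ∧ e j = true)
    simpa only [and_assoc] using this
  · refine Finset.prod_congr rfl fun j _ => ?_
    have := hP (i < j.1 ∧ σ j < σ i ∧ e j = true)
    simpa only [and_assoc, and_comm (a := e j = true)] using this

end TP

namespace Tot

variable {C D : ChainComplex AddCommGrpCat.{u} ℕ}

/-! ### Total modules -/

theorem sgn_of (p k : ℕ) (x : C.X k) : sgn C p (of C k x) = (-1 : ℤ) ^ (p * k) • of C k x := by
  simp [sgn]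

theorem parity_of (e : Bool) (k : ℕ) (x : C.X k) :
    parity C e (of C k x) = if decide (Odd k) = e then of C k x else 0 := by
  rw [parity, desc_of]
  split_ifs <;> rfl

theorem d_of (k : ℕ) (x : C.X k) : d C (of C k x) = of C (k - 1) ((C.d k (k - 1)).hom x) := by
  simp [d]

/-- In degree 0 the truncated index k − 1 is again 0, and `C.d 0 0` vanishes because 0 → 0 is not a
relation of the complex shape. -/
theorem d_of_zero (x : C.X 0) : d C (of C 0 x) = 0 := by
  rw [d_of, C.shape _ _ (by simp)]
  simp

theorem d_of_succ (k : ℕ) (x : C.X (k + 1)) :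
    d C (of C (k + 1) x) = of C k ((C.d (k + 1) k).hom x) := d_of _ _

theorem map_of (f : C ⟶ D) (k : ℕ) (x : C.X k) :
    map f (of C k x) = of D k ((f.f k).hom x) := by
  simp [map]

theorem d_d (x : Tot C) : d C (d C x) = 0 := by
  have : d C ∘ₗ d C = 0 := hom_ext fun k x => by
    rw [LinearMap.comp_apply, LinearMap.zero_apply]
    rcases k with _ | _ | k
    · rw [d_of_zero, map_zero]
    · rw [d_of_succ, d_of_zero]
    · rw [d_of_succ, d_of_succ]
      have h := ConcreteCategory.congr_hom (C.d_comp_d (k + 1 + 1) (k + 1) k) x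
      exact (congrArg (of C k) h).trans (map_zero _)
  exact LinearMap.congr_fun this x

theorem map_d (f : C ⟶ D) (x : Tot C) : map f (d C x) = d D (map f x) := by
  have : map f ∘ₗ d C = d D ∘ₗ map f := hom_ext fun k x => by
    simp only [LinearMap.comp_apply]
    rcases k with _ | k
    · rw [d_of_zero, map_of, d_of_zero, map_zero]
    · rw [d_of_succ, map_of, map_of, d_of_succ]
      exact congrArg (of D k) (ConcreteCategory.congr_hom (f.comm (k + 1) k) x).symm
  exact LinearMap.congr_fun this x

theorem map_sgn (f : C ⟶ D) (p : ℕ) (x : Tot C) : map f (sgn C p x) = sgn D p (map f x) := by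
  have : map f ∘ₗ sgn C p = sgn D p ∘ₗ map f := hom_ext fun k x => by
    simp only [LinearMap.comp_apply, sgn_of, map_of, map_smul]
  exact LinearMap.congr_fun this x

theorem sgn_sgn (p q : ℕ) (x : Tot C) : sgn C p (sgn C q x) = sgn C (p + q) x := by
  have : sgn C p ∘ₗ sgn C q = sgn C (p + q) := hom_ext fun k x => by
    rw [LinearMap.comp_apply, sgn_of, sgn_of, map_smul, sgn_of, smul_smul, ← pow_add, add_mul,
      add_comm]
  exact LinearMap.congr_fun this x

theorem sgn_comm (p q : ℕ) (x : Tot C) : sgn C p (sgn C q x) = sgn C q (sgn C p x) := by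
  rw [sgn_sgn, sgn_sgn, add_comm]

theorem sgn_add_two (p : ℕ) : sgn C (p + 2) = sgn C p :=
  hom_ext fun k x => by
    rw [sgn_of, sgn_of, add_mul, pow_add]
    simp [pow_mul]

theorem sgn_d (p : ℕ) (x : Tot C) : sgn C p (d C x) = (-1 : ℤ) ^ p • d C (sgn C p x) := by
  have : sgn C p ∘ₗ d C = (-1 : ℤ) ^ p • d C ∘ₗ sgn C p := hom_ext fun k x => by
    simp only [LinearMap.comp_apply, LinearMap.smul_apply]
    rcases k with _ | k
    · rw [sgn_of, map_smul, d_of_zero]; simp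
    · rw [d_of_succ, sgn_of, sgn_of, map_smul, d_of_succ, smul_smul, ← pow_add]
      congr 1
      have : p + p * (k + 1) = p * k + 2 * p := by ring
      rw [this, pow_add, pow_mul (-1) 2]
      simp
  exact LinearMap.congr_fun this x

theorem d_parity (b : Bool) (x : Tot C) : d C (parity C b x) = parity C (!b) (d C x) := by
  have : d C ∘ₗ parity C b = parity C (!b) ∘ₗ d C := hom_ext fun k x => by
    simp only [LinearMap.comp_apply]
    rcases k with _ | k
    · rw [parity_of, d_of_zero]
      split_ifs <;> simp [d_of_zero]
    · rw [d_of_succ, parity_of, parity_of]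
      have : (decide (Odd (k + 1)) = b) ↔ (decide (Odd k) = !b) := by
        by_cases hk : Odd k <;> cases b <;> simp [Nat.odd_add_one, hk]
      simp only [this]
      split_ifs
      · rw [d_of_succ]
      · simp
  exact LinearMap.congr_fun this x

theorem parity_parity (a b : Bool) (x : Tot C) :
    parity C a (parity C b x) = if a = b then parity C b x else 0 := by
  have : parity C a ∘ₗ parity C b = if a = b then parity C b else 0 := hom_ext fun k x => by
    rw [LinearMap.comp_apply, parity_of]
    split_ifs with h1 h2 h2
    · rw [parity_of, if_pos (h1.trans h2.symm), parity_of, if_pos h1]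
    · rw [parity_of, if_neg (fun h => h2 (h.symm.trans h1))]; simp
    · rw [parity_of, if_neg h1]; simp
    · simp
  rw [← LinearMap.comp_apply, this]
  split_ifs <;> rfl

theorem sgn_parity (p : ℕ) (b : Bool) (x : Tot C) :
    sgn C p (parity C b x) = boolSign b ^ p • parity C b x := by
  have : sgn C p ∘ₗ parity C b = boolSign b ^ p • parity C b := hom_ext fun k x => by
    simp only [LinearMap.comp_apply, LinearMap.smul_apply, parity_of]
    split_ifs with h
    · rw [sgn_of, ← h, boolSign_odd, ← pow_mul, mul_comm]
    · simp
  exact LinearMap.congr_fun this x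

/-- An element all of whose components have the given parity. -/
def HasParity (b : Bool) (x : Tot C) : Prop := parity C b x = x

theorem HasParity.of (k : ℕ) (x : C.X k) : HasParity (decide (Odd k)) (of C k x) := by
  rw [HasParity, parity_of, if_pos rfl]

theorem HasParity.d {b : Bool} {x : Tot C} (h : HasParity b x) : HasParity (!b) (d C x) := by
  rw [HasParity, ← d_parity, h]

theorem HasParity.parity_eq {b : Bool} {x : Tot C} (h : HasParity b x) (a : Bool) :
    parity C a x = if a = b then x else 0 := by
  rw [← h, parity_parity, h]

theorem HasParity.sgn_eq {b : Bool} {x : Tot C} (h : HasParity b x) (p : ℕ) :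
    sgn C p x = boolSign b ^ p • x := by
  rw [← h, sgn_parity, h]

/-- What makes homogeneous tensors suffice in `TP.hom_ext`, so that signs can be computed from
honest parities. -/
theorem span_of_eq_top :
    Submodule.span ℤ (Set.range fun x : Σ k, C.X k => of C x.1 x.2) = ⊤ := by
  rw [← (Submodule.span ℤ _).ker_mkQ, LinearMap.ker_eq_top]
  refine hom_ext fun k x => ?_
  rw [Submodule.mkQ_apply, LinearMap.zero_apply, Submodule.Quotient.mk_eq_zero]
  exact Submodule.subset_span ⟨⟨k, x⟩, rfl⟩

end Tot

namespace TP

open SymOperad PiTensorProduct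

variable {C D : ChainComplex AddCommGrpCat.{u} ℕ}

/-! ### Tensor powers -/

theorem hom_ext {n : ℕ} {M : Type*} [AddCommGroup M] {f g : TP C n →ₗ[ℤ] M}
    (h : ∀ (p : Fin n → ℕ) (x : ∀ j, C.X (p j)),
      f (tprod ℤ fun j => Tot.of C (p j) (x j)) = g (tprod ℤ fun j => Tot.of C (p j) (x j))) :
    f = g :=
  PiTensorProduct.ext_of_span_eq_top (γ := fun _ => Σ k, C.X k)
    (g := fun _ (x : Σ k, C.X k) => Tot.of C x.1 x.2) (fun _ => Tot.span_of_eq_top)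
    fun j => h (fun i => (j i).1) fun i => (j i).2

theorem hom_ext_tprod {n : ℕ} {M : Type*} [AddCommGroup M] {f g : TP C n →ₗ[ℤ] M}
    (h : ∀ x : Fin n → Tot C, f (tprod ℤ x) = g (tprod ℤ x)) : f = g :=
  PiTensorProduct.ext (MultilinearMap.ext h)

theorem deg_induction {n k : ℕ} {M : Type*} [AddCommGroup M] {f g : TP C n →ₗ[ℤ] M}
    (h : ∀ (p : Fin n → ℕ) (x : ∀ j, C.X (p j)), ∑ j, p j = k →
      f (tprod ℤ fun j => Tot.of C (p j) (x j)) = g (tprod ℤ fun j => Tot.of C (p j) (x j)))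
    {z : TP C n} (hz : z ∈ deg C n k) : f z = g z := by
  refine LinearMap.eqOn_span ?_ hz
  rintro _ ⟨p, x, hp, rfl⟩
  exact h p x hp

theorem deg_map_mem {n k : ℕ} {M : Type*} [AddCommGroup M] {f : TP C n →ₗ[ℤ] M}
    {S : Submodule ℤ M} (h : ∀ (p : Fin n → ℕ) (x : ∀ j, C.X (p j)), ∑ j, p j = k →
      f (tprod ℤ fun j => Tot.of C (p j) (x j)) ∈ S) {z : TP C n} (hz : z ∈ deg C n k) :
    f z ∈ S := by
  have : deg C n k ≤ S.comap f := Submodule.span_le.2 (by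
    rintro _ ⟨p, x, hp, rfl⟩
    exact h p x hp)
  exact this hz

theorem tprod_mem_deg {n k : ℕ} (p : Fin n → ℕ) (hp : ∑ j, p j = k) {x : Fin n → Tot C}
    (hx : ∀ j, ∃ y, x j = Tot.of C (p j) y) : tprod ℤ x ∈ deg C n k := by
  choose y hy using hx
  obtain rfl : x = fun j => Tot.of C (p j) (y j) := funext hy
  exact Submodule.subset_span ⟨p, y, hp, rfl⟩

theorem d_tprod {n : ℕ} (x : Fin n → Tot C) : d C n (tprod ℤ x) =
    ∑ j, tprod ℤ fun k => if k < j then Tot.sgn C 1 (x k) else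
      if k = j then Tot.d C (x k) else x k := by
  rw [d, LinearMap.sum_apply]
  refine Finset.sum_congr rfl fun j _ => ?_
  rw [map_tprod]
  congr 1
  funext k
  split_ifs <;> rfl

theorem d_tprod_parity {n : ℕ} {x : Fin n → Tot C} {e : Fin n → Bool}
    (h : ∀ j, Tot.HasParity (e j) (x j)) : d C n (tprod ℤ x) =
    ∑ j, (∏ k, if k < j then boolSign (e k) else 1) •
      tprod ℤ (Function.update x j (Tot.d C (x j))) := by
  rw [d_tprod]
  refine Finset.sum_congr rfl fun j _ => ?_
  rw [← MultilinearMap.map_smul_univ]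
  congr 1
  funext k
  rcases lt_trichotomy k j with hk | rfl | hk
  · simp [hk, hk.ne, (h k).sgn_eq]
  · simp
  · simp [hk.not_gt, hk.ne']

/-- In the sum over all parity patterns, the projections annihilate every pattern other than e. -/
theorem perm_tprod {n : ℕ} (σ : Equiv.Perm (Fin n)) {x : Fin n → Tot C} {e : Fin n → Bool}
    (h : ∀ j, Tot.HasParity (e j) (x j)) :
    perm C σ (tprod ℤ x) = koszul σ e • tprod ℤ fun j => x (σ.symm j) := by
  rw [perm, LinearMap.sum_apply, Finset.sum_eq_single e]
  · simp only [LinearMap.smul_apply, LinearMap.comp_apply, map_tprod, LinearEquiv.coe_coe]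
    congr 1
    have h1 : (fun j => Tot.parity C (e j) (x j)) = x := funext h
    rw [h1]
    exact reindex_tprod σ x
  · intro e' _ he
    obtain ⟨j, hj⟩ : ∃ j, e' j ≠ e j := Function.ne_iff.1 he
    simp only [LinearMap.smul_apply, LinearMap.comp_apply, map_tprod]
    rw [MultilinearMap.map_coord_zero _ j, map_zero, smul_zero]
    rw [(h j).parity_eq, if_neg hj]
  · simp

theorem perm_mul {n : ℕ} (σ τ : Equiv.Perm (Fin n)) (z : TP C n) :
    perm C (σ * τ) z = perm C σ (perm C τ z) := by
  have : perm C (σ * τ) = perm C σ ∘ₗ perm C τ := hom_ext fun p x => by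
    have h := fun j => Tot.HasParity.of (p j) (x j)
    rw [LinearMap.comp_apply, perm_tprod _ h, perm_tprod _ h, map_smul,
      perm_tprod σ (fun j => h (τ.symm j)), smul_smul, koszul_mul, mul_comm]
    rfl
  exact LinearMap.congr_fun this z

theorem perm_one {n : ℕ} (z : TP C n) : perm C 1 z = z := by
  have : perm C 1 = LinearMap.id (M := TP C n) := hom_ext fun p x => by
    have h := fun j => Tot.HasParity.of (p j) (x j)
    rw [perm_tprod _ h]
    have h1 : koszul (1 : Equiv.Perm (Fin n)) (fun j => decide (Odd (p j))) = 1 := by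
      unfold koszul
      refine Finset.prod_eq_one fun j _ => Finset.prod_eq_one fun k _ => if_neg ?_
      rintro ⟨h1, h2, -⟩
      exact h1.not_gt h2
    rw [h1, one_smul]
    rfl
  exact LinearMap.congr_fun this z

/-- Differentiating factor i flips its parity. By `koszul_update_not` the resulting change of the
permutation sign is the quotient of the signs for moving ∂ to place i before permuting and to place
σ i afterwards. -/
theorem d_perm {n : ℕ} (σ : Equiv.Perm (Fin n)) (z : TP C n) :
    d C n (perm C σ z) = perm C σ (d C n z) := by
  have : d C n ∘ₗ perm C σ = perm C σ ∘ₗ d C n := hom_ext fun p x => by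
    suffices H : ∀ (X : Fin n → Tot C) (e : Fin n → Bool), (∀ j, Tot.HasParity (e j) (X j)) →
        d C n (perm C σ (tprod ℤ X)) = perm C σ (d C n (tprod ℤ X)) from
      H _ _ fun j => Tot.HasParity.of (p j) (x j)
    intro X e h
    rw [perm_tprod _ h, map_smul, d_tprod_parity h, d_tprod_parity fun j => h (σ.symm j), map_sum,
      Finset.smul_sum, ← Equiv.sum_comp σ]
    refine Finset.sum_congr rfl fun i _ => ?_
    have h' : ∀ j, Tot.HasParity (Function.update e i (!e i) j)
        (Function.update X i (Tot.d C (X i)) j) := by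
      intro j
      by_cases hj : j = i
      · subst hj; simpa using (h j).d
      · simpa [hj] using h j
    rw [map_smul, perm_tprod σ h', smul_smul, smul_smul, koszul_update_not]
    have h1 : (∏ k, if k < σ i then boolSign (e (σ.symm k)) else 1) =
        ∏ k, if σ k < σ i then boolSign (e k) else 1 := by
      rw [← Equiv.prod_comp σ]; simp
    have h2 : (∏ k, if k < i then boolSign (e k) else 1) *
        (∏ k, if k < i then boolSign (e k) else 1) = 1 := by
      rw [← Finset.prod_mul_distrib]
      refine Finset.prod_eq_one fun k _ => ?_
      split_ifs <;> simp [boolSign_mul_self]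
    have h3 : Function.update (fun j => X (σ.symm j)) (σ i) (Tot.d C (X (σ.symm (σ i)))) =
        fun j => Function.update X i (Tot.d C (X i)) (σ.symm j) := by
      funext j
      by_cases hj : j = σ i
      · subst hj; simp
      · have : σ.symm j ≠ i := fun h => hj (by simp [← h])
        simp [hj, this]
    rw [h1, h3]
    congr 1
    rw [mul_comm, mul_assoc, mul_comm (koszul σ e), ← mul_assoc, ← mul_assoc, h2, one_mul,
      mul_comm]
  exact LinearMap.congr_fun this z

theorem perm_mem_deg {n k : ℕ} (σ : Equiv.Perm (Fin n)) {z : TP C n} (hz : z ∈ deg C n k) :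
    perm C σ z ∈ deg C n k :=
  deg_map_mem (fun p x hp => by
    rw [perm_tprod _ (fun j => Tot.HasParity.of (p j) (x j))]
    refine Submodule.smul_mem _ _ (tprod_mem_deg (fun j => p (σ.symm j)) ?_ fun j => ⟨_, rfl⟩)
    rw [← hp, Equiv.sum_comp σ.symm p]) hz

theorem map_mem_deg {n k : ℕ} (f : C ⟶ D) {z : TP C n} (hz : z ∈ deg C n k) :
    map f n z ∈ deg D n k :=
  deg_map_mem (fun p x hp => by
    rw [map, map_tprod]
    exact tprod_mem_deg p hp fun j => ⟨_, Tot.map_of _ _ _⟩) hz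

theorem map_perm {n : ℕ} (f : C ⟶ D) (σ : Equiv.Perm (Fin n)) (z : TP C n) :
    map f n (perm C σ z) = perm D σ (map f n z) := by
  have : map f n ∘ₗ perm C σ = perm D σ ∘ₗ map f n := hom_ext fun p x => by
    simp only [LinearMap.comp_apply]
    rw [perm_tprod _ (fun j => Tot.HasParity.of (p j) (x j)), map_smul, map, map_tprod, map_tprod]
    simp only [Tot.map_of]
    rw [perm_tprod _ (fun j => Tot.HasParity.of (p j) _)]
  exact LinearMap.congr_fun this z

theorem map_d {n : ℕ} (f : C ⟶ D) (z : TP C n) : map f n (d C n z) = d D n (map f n z) := by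
  have : map f n ∘ₗ d C n = d D n ∘ₗ map f n := hom_ext_tprod fun x => by
    simp only [LinearMap.comp_apply]
    rw [d_tprod, map_sum, map, map_tprod, d_tprod]
    refine Finset.sum_congr rfl fun j _ => ?_
    rw [map_tprod]
    congr 1
    funext k
    split_ifs
    · rw [Tot.map_sgn]
    · rw [Tot.map_d]
    · rfl
  exact LinearMap.congr_fun this z

theorem map_id (n : ℕ) (z : TP C n) : map (𝟙 C) n z = z := by
  simp only [map, Tot.map_id, PiTensorProduct.map_id, LinearMap.id_apply]

theorem map_comp {E : ChainComplex AddCommGrpCat.{u} ℕ} (f : C ⟶ D) (g : D ⟶ E) (n : ℕ)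
    (z : TP C n) : map (f ≫ g) n z = map g n (map f n z) := by
  simp only [map, Tot.map_comp, PiTensorProduct.map_comp, LinearMap.comp_apply]

/-! ### Insertion of a map in one tensor factor -/

/-- The tensor `y₁ ⊗ ⋯ ⊗ z ⊗ ⋯ ⊗ y_m` with `z ∈ C^n` in position `i`. -/
def glue {m n : ℕ} (i : Fin (m + 1)) (y : {j // j ≠ i} → Tot C) : TP C n →ₗ[ℤ] TP C (m + n) :=
  (reindex ℤ (fun _ => Tot C) (slotEquiv i n)).toLinearMap ∘ₗ
    (tmulEquiv ℤ (Tot C)).toLinearMap ∘ₗ TensorProduct.mk ℤ _ _ (tprod ℤ y)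

theorem glue_tprod {m n : ℕ} (i : Fin (m + 1)) (y : {j // j ≠ i} → Tot C) (z : Fin n → Tot C) :
    glue i y (tprod ℤ z) = tprod ℤ (elim i y z) := by
  simp only [glue, LinearMap.comp_apply, TensorProduct.mk_apply, LinearEquiv.coe_coe]
  rw [tmulEquiv_apply]
  exact reindex_tprod _ _

theorem glue_smul {m n : ℕ} (i : Fin (m + 1)) (c : {j // j ≠ i} → ℤ) (y : {j // j ≠ i} → Tot C)
    (z : TP C n) : glue i (fun j => c j • y j) z = (∏ j, c j) • glue i y z := by
  simp only [glue, LinearMap.comp_apply, MultilinearMap.map_smul_univ, map_smul,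
    LinearMap.smul_apply]

theorem glue_eq_zero {m n : ℕ} (i : Fin (m + 1)) (y : {j // j ≠ i} → Tot C)
    (z : TP C n) (j : {j // j ≠ i}) (h : y j = 0) : glue i y z = 0 := by
  simp only [glue, LinearMap.comp_apply, MultilinearMap.map_coord_zero _ j h, map_zero,
    LinearMap.zero_apply]

theorem map_glue {m n : ℕ} (i : Fin (m + 1)) (h : Fin (m + n) → Tot C →ₗ[ℤ] Tot D)
    (y : {j // j ≠ i} → Tot C) (z : TP C n) :
    PiTensorProduct.map h (glue i y z) =
      glue i (fun j => h (slotEquiv i n (.inl j)) (y j))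
        (PiTensorProduct.map (fun t => h (slotEquiv i n (.inr t))) z) := by
  have : PiTensorProduct.map h ∘ₗ glue i y =
      glue i (fun j => h (slotEquiv i n (.inl j)) (y j)) ∘ₗ
        PiTensorProduct.map (fun t => h (slotEquiv i n (.inr t))) := hom_ext_tprod fun z => by
    simp only [LinearMap.comp_apply]
    rw [glue_tprod, map_tprod, map_tprod, glue_tprod]
    congr 1
    refine elim_ext i (fun j => ?_) fun t => ?_
    · simp only [elim_inl]
    · simp only [elim_inr]
  exact LinearMap.congr_fun this z

theorem insert_tprod {m n : ℕ} (i : Fin (m + 1)) (f : Tot C →ₗ[ℤ] TP C n)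
    (x : Fin (m + 1) → Tot C) : insert i f (tprod ℤ x) = glue i (fun j => x j) (f (x i)) := by
  have h1 : reindex ℤ (fun _ => Tot C) (slotEquiv i 1).symm (tprod ℤ x) =
      tprod ℤ (Sum.elim (fun j : {j // j ≠ i} => x j) fun _ : Fin 1 => x i) := by
    refine (reindex_tprod _ _).trans ?_
    congr 1
    funext t
    rcases t with j | t
    · exact congrArg x (slotEquiv_one_inl i j)
    · exact congrArg x (slotEquiv_one_inr i t)
  have h2 : (tmulEquiv ℤ (Tot C)).symm
      (tprod ℤ (Sum.elim (fun j : {j // j ≠ i} => x j) fun _ : Fin 1 => x i)) =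
      tprod ℤ (fun j : {j // j ≠ i} => x j) ⊗ₜ tprod ℤ (fun _ : Fin 1 => x i) := by
    rw [LinearEquiv.symm_apply_eq, tmulEquiv_apply]
  simp only [insert, glue, LinearMap.comp_apply, LinearEquiv.coe_coe, TensorProduct.mk_apply]
  rw [h1, h2, TensorProduct.map_tmul, LinearMap.id_apply, LinearMap.comp_apply,
    LinearEquiv.coe_coe, subsingletonEquiv_apply_tprod]

theorem insertKoszul_tprod {m n : ℕ} (i : Fin (m + 1)) (p : ℕ) (f : Tot C →ₗ[ℤ] TP C n)
    (x : Fin (m + 1) → Tot C) : insertKoszul i p f (tprod ℤ x) =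
      glue i (fun j => if j.1 < i then Tot.sgn C p (x j) else x j) (f (x i)) := by
  rw [insertKoszul, LinearMap.comp_apply, map_tprod, insert_tprod, if_neg (lt_irrefl i)]
  congr 2
  funext j
  split_ifs <;> rfl

end TP

/-! ### Leibniz rule and equivariance for inserted operations -/

namespace TP

open SymOperad PiTensorProduct

variable {C : ChainComplex AddCommGrpCat.{u} ℕ}

/-- The map `z ↦ (-1)^{|z|} z` of `C^n`. -/
def sgn (n : ℕ) : TP C n →ₗ[ℤ] TP C n := PiTensorProduct.map fun _ => Tot.sgn C 1

/-- The differential (a = sign, b = ∂) and Φ (a = ε, b = s) both have the form ∑ a⊗⋯⊗a⊗b⊗1⊗⋯⊗1; this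
is the common expansion according to whether b falls outside or inside the block. -/
theorem sum_map_glue {m n : ℕ} (a b : Tot C →ₗ[ℤ] Tot C) (i : Fin (m + 1))
    (y : {j // j ≠ i} → Tot C) (z : TP C n) :
    (∑ s, PiTensorProduct.map fun t : Fin (m + n) =>
      if t < s then a else if t = s then b else LinearMap.id) (glue i y z) =
      (∑ j : {j // j ≠ i}, glue i (fun k => if k.1 < j.1 then a (y k) else
        if k.1 = j.1 then b (y k) else y k)
          (if i < j.1 then PiTensorProduct.map (fun _ => a) z else z)) +
      glue i (fun k => if k.1 < i then a (y k) else y k)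
        ((∑ s, PiTensorProduct.map fun t : Fin n =>
          if t < s then a else if t = s then b else LinearMap.id) z) := by
  rw [LinearMap.sum_apply, sum_slot i]
  congr 1
  · refine Finset.sum_congr rfl fun j _ => ?_
    rw [map_glue]
    simp only [slotEquiv_inl_lt_inl, slotEquiv_inr_lt_inl, EmbeddingLike.apply_eq_iff_eq,
      Sum.inl.injEq, reduceCtorEq, if_false]
    congr 1
    · congr 1
      funext k
      simp only [Subtype.ext_iff]
      split_ifs <;> rfl
    · split_ifs
      · rfl
      · exact LinearMap.congr_fun PiTensorProduct.map_id z
  · rw [LinearMap.sum_apply, map_sum]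
    refine Finset.sum_congr rfl fun t _ => ?_
    rw [map_glue]
    simp only [slotEquiv_inl_lt_inr, slotEquiv_inr_lt_inr, EmbeddingLike.apply_eq_iff_eq,
      Sum.inr.injEq, reduceCtorEq, if_false]
    congr 2
    funext k
    split_ifs <;> rfl

theorem d_glue {m n : ℕ} (i : Fin (m + 1)) (y : {j // j ≠ i} → Tot C) (z : TP C n) :
    d C (m + n) (glue i y z) =
      (∑ j : {j // j ≠ i}, glue i (fun k => if k.1 < j.1 then Tot.sgn C 1 (y k) else
        if k.1 = j.1 then Tot.d C (y k) else y k) (if i < j.1 then sgn n z else z)) +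
      glue i (fun k => if k.1 < i then Tot.sgn C 1 (y k) else y k) (d C n z) :=
  sum_map_glue _ _ i y z

/-- The Leibniz rule labels the boundary of a degree p operation with p + 1, while its actual degree
is p − 1; the sign only depends on parity. -/
theorem insertKoszul_add_two {m n : ℕ} (i : Fin (m + 1)) (p : ℕ) (f : Tot C →ₗ[ℤ] TP C n) :
    insertKoszul i (p + 2) f = insertKoszul i p f := by
  simp only [insertKoszul, Tot.sgn_add_two]

theorem sum_ne {m : ℕ} {M : Type*} [AddCommMonoid M] (i : Fin (m + 1)) (f : Fin (m + 1) → M) :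
    ∑ x, f x = (∑ j : {j // j ≠ i}, f j) + f i := by
  rw [sum_slot (n := 1) i]
  simp [slotEquiv_one_inl, slotEquiv_one_inr]

/-- The Leibniz rule for the insertion of a map of degree `p`. -/
theorem d_insertKoszul {m n : ℕ} (i : Fin (m + 1)) (p : ℕ) (f : Tot C →ₗ[ℤ] TP C n)
    (hf : ∀ x, f (Tot.sgn C 1 x) = (-1 : ℤ) ^ p • sgn n (f x)) (z : TP C (m + 1)) :
    d C (m + n) (insertKoszul i p f z) =
      insertKoszul i (p + 1) (d C n ∘ₗ f - (-1 : ℤ) ^ p • f ∘ₗ Tot.d C) z +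
        (-1 : ℤ) ^ p • insertKoszul i p f (d C (m + 1) z) := by
  have hp : (-1 : ℤ) ^ p * (-1) ^ p = 1 := by rw [← mul_pow]; simp
  have : d C (m + n) ∘ₗ insertKoszul i p f =
      insertKoszul i (p + 1) (d C n ∘ₗ f - (-1 : ℤ) ^ p • f ∘ₗ Tot.d C) +
        (-1 : ℤ) ^ p • insertKoszul i p f ∘ₗ d C (m + 1) := hom_ext_tprod fun x => by
    simp only [LinearMap.comp_apply, LinearMap.add_apply, LinearMap.smul_apply]
    rw [d_tprod, map_sum, sum_ne i]
    simp only [insertKoszul_tprod]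
    rw [d_glue, smul_add, Finset.smul_sum, add_left_comm]
    congr 1
    · refine Finset.sum_congr rfl fun j _ => ?_
      -- When ∂ acts on a factor after the block, the sign (−1)^p arises from carrying the degree
      -- sign through f.
      have h1 : (if i < j.1 then sgn n (f (x i)) else f (x i)) =
          (if i < j.1 then (-1 : ℤ) ^ p else 1) • f (if i < j.1 then Tot.sgn C 1 (x i) else
            if i = j.1 then Tot.d C (x i) else x i) := by
        split_ifs with h h'
        · rw [hf, smul_smul, hp, one_smul]
        · exact absurd h'.symm j.2
        · rw [one_smul]
      rw [h1, map_smul]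
      -- When ∂ acts on a factor before the block, the sign (−1)^p arises instead from commuting ∂
      -- with the Koszul sign of f on that single factor.
      have h2 : (fun k : {j // j ≠ i} => if k.1 < i then
            Tot.sgn C p (if k.1 < j.1 then Tot.sgn C 1 (x k) else
              if k.1 = j.1 then Tot.d C (x k) else x k)
          else (if k.1 < j.1 then Tot.sgn C 1 (x k) else
              if k.1 = j.1 then Tot.d C (x k) else x k)) =
          fun k : {j // j ≠ i} => (if k = j then (if j.1 < i then (-1 : ℤ) ^ p else 1) else 1) •
            (if k.1 < j.1 then Tot.sgn C 1 (if k.1 < i then Tot.sgn C p (x k) else x k) else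
              if k.1 = j.1 then Tot.d C (if k.1 < i then Tot.sgn C p (x k) else x k) else
                (if k.1 < i then Tot.sgn C p (x k) else x k)) := by
        funext k
        rcases lt_trichotomy k.1 j.1 with h | h | h
        · have hne : k ≠ j := fun h' => h.ne (congrArg _ h')
          simp only [h, hne, if_true, if_false, one_smul]
          split_ifs
          · rw [Tot.sgn_comm]
          · rfl
        · obtain rfl : k = j := Subtype.ext h
          simp only [lt_irrefl, if_true, if_false]
          split_ifs
          · rw [Tot.sgn_d]
          · rw [one_smul]
        · have hne : k ≠ j := fun h' => h.ne' (congrArg _ h')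
          simp only [h.not_gt, h.ne', hne, if_false, one_smul]
      rw [h2, glue_smul, Finset.prod_ite_eq', if_pos (Finset.mem_univ _), smul_smul]
      congr 1
      rcases lt_or_gt_of_ne j.2 with h | h
      · simp [h, h.not_gt, hp]
      · simp [h, h.not_gt]
    · simp only [lt_irrefl, if_false, if_true, LinearMap.sub_apply, LinearMap.smul_apply,
        LinearMap.comp_apply, map_sub, map_smul]
      have h3 : (fun k : {j // j ≠ i} => if k.1 < i then Tot.sgn C p (if k.1 < i then
            Tot.sgn C 1 (x k) else if k.1 = i then Tot.d C (x k) else x k) else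
            if k.1 < i then Tot.sgn C 1 (x k) else if k.1 = i then Tot.d C (x k) else x k) =
          fun k : {j // j ≠ i} => if k.1 < i then Tot.sgn C (p + 1) (x k) else x k := by
        funext k
        by_cases h : k.1 < i
        · simp only [h, if_true, Tot.sgn_sgn]
        · simp only [h, if_false, if_neg k.2]
      have h4 : (fun k : {j // j ≠ i} => if k.1 < i then Tot.sgn C 1 (if k.1 < i then
            Tot.sgn C p (x k) else x k) else if k.1 < i then Tot.sgn C p (x k) else x k) =
          fun k : {j // j ≠ i} => if k.1 < i then Tot.sgn C (p + 1) (x k) else x k := by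
        funext k
        by_cases h : k.1 < i
        · simp only [h, if_true, Tot.sgn_sgn, add_comm]
        · simp only [h, if_false]
      rw [h3, h4, sub_add_cancel]
  exact LinearMap.congr_fun this z

theorem prod_ne {m : ℕ} (i : Fin (m + 1)) (f : Fin (m + 1) → ℤ) :
    ∏ x, f x = (∏ j : {j // j ≠ i}, f j) * f i := by
  rw [prod_slot (n := 1) i]
  simp [slotEquiv_one_inl, slotEquiv_one_inr]

theorem sgn_eq_of_mem_deg {n k : ℕ} {z : TP C n} (hz : z ∈ deg C n k) :
    sgn n z = (-1 : ℤ) ^ k • z :=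
  deg_induction (g := (-1 : ℤ) ^ k • LinearMap.id) (fun p x hp => by
    rw [sgn, map_tprod, LinearMap.smul_apply, LinearMap.id_apply, ← hp,
      ← Finset.prod_pow_eq_pow_sum, ← MultilinearMap.map_smul_univ]
    congr 1
    funext j
    rw [Tot.sgn_of, one_mul]) hz

theorem insertKoszul_tprod_parity {m n : ℕ} (i : Fin (m + 1)) (p : ℕ)
    (f : Tot C →ₗ[ℤ] TP C n) {x : Fin (m + 1) → Tot C} {e : Fin (m + 1) → Bool}
    (h : ∀ j, Tot.HasParity (e j) (x j)) : insertKoszul i p f (tprod ℤ x) =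
      (∏ k, if k < i then boolSign (e k) else 1) ^ p • glue i (fun j => x j) (f (x i)) := by
  rw [insertKoszul_tprod, prod_ne i, if_neg (lt_irrefl i), mul_one, ← Finset.prod_pow, ← glue_smul]
  congr 2
  funext j
  split_ifs
  · rw [(h j).sgn_eq]
  · rw [one_pow, one_smul]

/-- Equivariance of the insertion of a map of degree `p`. -/
theorem insertKoszul_perm {m n : ℕ} (i : Fin (m + 1)) (p : ℕ) (f : Tot C →ₗ[ℤ] TP C n)
    (hf : ∀ k x, f (Tot.of C k x) ∈ deg C n (p + k)) (σ : Equiv.Perm (Fin (m + 1)))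
    (τ : Equiv.Perm (Fin n)) (z : TP C (m + 1)) :
    insertKoszul (σ i) p (perm C τ ∘ₗ f) (perm C σ z) =
      perm C (blockPerm i n σ * blockIncl i τ) (insertKoszul i p f z) := by
  have : insertKoszul (σ i) p (perm C τ ∘ₗ f) ∘ₗ perm C σ =
      perm C (blockPerm i n σ * blockIncl i τ) ∘ₗ insertKoszul i p f := hom_ext fun q x => by
    simp only [LinearMap.comp_apply]
    have hX := fun j => Tot.HasParity.of (q j) (x j)
    rw [perm_tprod σ hX, map_smul, insertKoszul_tprod_parity (σ i) p _ fun j => hX (σ.symm j),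
      insertKoszul_tprod_parity i p f hX, map_smul, LinearMap.comp_apply, Equiv.symm_apply_apply]
    have key : ∀ w ∈ deg C n (p + q i),
        koszul σ (fun j => decide (Odd (q j))) •
          (∏ k, if k < σ i then boolSign (decide (Odd (q (σ.symm k)))) else 1) ^ p •
            glue (σ i) (fun j : {j // j ≠ σ i} => Tot.of C _ (x (σ.symm j))) (perm C τ w) =
        (∏ k, if k < i then boolSign (decide (Odd (q k))) else 1) ^ p •
          perm C (blockPerm i n σ * blockIncl i τ)
            (glue i (fun j : {j // j ≠ i} => Tot.of C _ (x j)) w) := by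
      intro w hw
      refine deg_induction (f := koszul σ (fun j => decide (Odd (q j))) •
          (∏ k, if k < σ i then boolSign (decide (Odd (q (σ.symm k)))) else 1) ^ p •
            glue (σ i) (fun j : {j // j ≠ σ i} => Tot.of C _ (x (σ.symm j))) ∘ₗ perm C τ)
        (g := (∏ k, if k < i then boolSign (decide (Odd (q k))) else 1) ^ p •
          perm C (blockPerm i n σ * blockIncl i τ) ∘ₗ
            glue i (fun j : {j // j ≠ i} => Tot.of C _ (x j))) (fun r y hr => ?_) hw
      have hY := fun j => Tot.HasParity.of (r j) (y j)
      simp only [LinearMap.smul_apply, LinearMap.comp_apply]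
      set e : Fin (m + 1) → Bool := fun j => decide (Odd (q j))
      set e' : Fin n → Bool := fun j => decide (Odd (r j))
      have hE : ∀ t, Tot.HasParity (elim i (fun j => e j) e' t)
          (elim i (fun j : {j // j ≠ i} => Tot.of C _ (x j)) (fun j => Tot.of C _ (y j)) t) := by
        intro t
        obtain ⟨t, rfl⟩ := (slotEquiv i n).surjective t
        rcases t with j | t
        · rw [elim_inl, elim_inl]; exact hX j
        · rw [elim_inr, elim_inr]; exact hY t
      rw [perm_tprod τ hY, map_smul, glue_tprod, glue_tprod, perm_tprod _ hE, koszul_mul,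
        koszul_blockIncl]
      have h1 : elim i (fun j => e j) e' ∘ (blockIncl i τ).symm =
          elim i (fun j => e j) (e' ∘ τ.symm) := by
        rw [← Equiv.eq_comp_symm, Equiv.symm_symm]
        refine elim_ext i (fun j => ?_) fun t => ?_
        · rw [Function.comp_apply, blockIncl_inl, elim_inl, elim_inl]
        · rw [Function.comp_apply, blockIncl_inr, elim_inr, elim_inr]
          simp
      have h2 : (fun t => elim i (fun j : {j // j ≠ i} => Tot.of C _ (x j))
            (fun j => Tot.of C _ (y j)) ((blockPerm i n σ * blockIncl i τ).symm t)) =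
          elim (σ i) (fun j : {j // j ≠ σ i} => Tot.of C _ (x (σ.symm j)))
            fun j => Tot.of C _ (y (τ.symm j)) := by
        refine (Equiv.comp_symm_eq (blockPerm i n σ * blockIncl i τ) _
          (elim i (fun j : {j // j ≠ i} => Tot.of C _ (x j)) fun j => Tot.of C _ (y j))).2 ?_
        refine elim_ext i (fun j => ?_) fun t => ?_
        · rw [Function.comp_apply, Equiv.Perm.mul_apply, blockIncl_inl, blockPerm_inl, elim_inl,
            elim_inl]
          exact congrArg (fun j => Tot.of C (q j) (x j)) (σ.symm_apply_apply j.1).symm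
        · rw [Function.comp_apply, Equiv.Perm.mul_apply, blockIncl_inr, blockPerm_inr, elim_inr,
            elim_inr]
          exact congrArg (fun j => Tot.of C (r j) (y j)) (τ.symm_apply_apply t).symm
      -- The block has total degree p + |x_i|, so for even p it moves like x_i itself and for odd p
      -- like a factor of the opposite parity.
      have h3 : ∏ t, boolSign ((e' ∘ τ.symm) t) = (-1) ^ p * boolSign (e i) := by
        simp only [Function.comp_apply]
        rw [Equiv.prod_comp τ.symm fun t => boolSign (e' t)]
        simp only [e, e', boolSign_odd]
        rw [Finset.prod_pow_eq_pow_sum, hr, pow_add]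
      have h4 : (∏ k, if k < σ i then boolSign (decide (Odd (q (σ.symm k)))) else 1) =
          ∏ k, if σ k < σ i then boolSign (e k) else 1 := by
        rw [← Equiv.prod_comp σ]; simp [e]
      have h5 : ∀ {P : Fin (m + 1) → Prop} [DecidablePred P],
          (∏ k, if P k then boolSign (e k) else 1) *
            (∏ k, if P k then boolSign (e k) else 1) = 1 := by
        intro P _
        rw [← Finset.prod_mul_distrib]
        refine Finset.prod_eq_one fun k _ => ?_
        split_ifs <;> simp [boolSign_mul_self]
      rw [h1, h2, h4, smul_smul, smul_smul, smul_smul]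
      congr 1
      rcases Nat.even_or_odd p with hp | hp
      · rw [hp.neg_one_pow, one_mul] at h3
        rw [koszul_blockPerm i σ e _ h3]
        obtain ⟨r, rfl⟩ := hp
        rw [← two_mul, pow_mul, pow_mul, pow_two, pow_two, h5, h5]
        ring
      -- For odd p the correction from flipping the parity at i is exactly the quotient of the
      -- prefix signs of f before and after σ.
      · have h6 : ∏ t, boolSign ((e' ∘ τ.symm) t) =
            boolSign (Function.update e i (!e i) i) := by
          rw [h3, Function.update_self, boolSign_not, hp.neg_one_pow, neg_one_mul]
        have h7 : (fun j : {j // j ≠ i} => e j) =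
            fun j : {j // j ≠ i} => Function.update e i (!e i) j := by
          funext j
          rw [Function.update_of_ne j.2]
        rw [h7, koszul_blockPerm i σ _ _ h6, koszul_update_not]
        obtain ⟨r, rfl⟩ := hp
        rw [pow_succ, pow_succ, pow_mul, pow_mul, pow_two, pow_two, h5, h5]
        have h8 := h5 (P := fun k => k < i)
        simp only [one_pow, one_mul]
        linear_combination (-koszul σ e * koszul τ e' *
          ∏ k, if σ k < σ i then boolSign (e k) else 1) * h8
    exact key _ (hf _ _)
  exact LinearMap.congr_fun this z

end TP

open Simplicial

/-! ### Normalized chains -/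

/-- The normalized chain of degree `k` given by a simplex. -/
def simplexChain (X : SSet.{u}) {k : ℕ} (x : X _⦋k⦌) : (simplicialChains.obj X).X k :=
  (SSet.ιNormalizedChainComplex (R := AddCommGrpCat.of (ULift.{u} ℤ)) X x).hom (ULift.up 1)

theorem chain_eq_of (X : SSet.{u}) {k : ℕ} (x : X _⦋k⦌) :
    chain X x = Tot.of (simplicialChains.obj X) k (simplexChain X x) := rfl

theorem simplexChain_hom_ext {X : SSet.{u}} {k : ℕ} {M : Type u} [AddCommGroup M]
    {f g : (simplicialChains.obj X).X k →+ M}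
    (h : ∀ x ∈ X.nonDegenerate k, f (simplexChain X x) = g (simplexChain X x)) : f = g := by
  have key : (AddCommGrpCat.ofHom f : (simplicialChains.obj X).X k ⟶ AddCommGrpCat.of M) =
      AddCommGrpCat.ofHom g := by
    refine SSet.normalizedChainComplex_hom_ext (R := AddCommGrpCat.of (ULift.{u} ℤ))
      (X := X) fun x hx => ?_
    ext ⟨a⟩
    have h1 : (ULift.up a : ULift.{u} ℤ) = a • ULift.up 1 := by
      ext; simp
    have h2 := h x hx
    rw [h1, map_zsmul, map_zsmul]
    exact congrArg _ h2
  exact congrArg AddCommGrpCat.Hom.hom key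

theorem chain_hom_ext {X : SSet.{u}} {M : Type u} [AddCommGroup M]
    {f g : Tot (simplicialChains.obj X) →ₗ[ℤ] M}
    (h : ∀ (k : ℕ) (x : X _⦋k⦌), x ∈ X.nonDegenerate k → f (chain X x) = g (chain X x)) :
    f = g :=
  Tot.hom_ext fun k c => DFunLike.congr_fun
    (simplexChain_hom_ext (f := f.toAddMonoidHom.comp (Tot.of (simplicialChains.obj X) k))
      (g := g.toAddMonoidHom.comp (Tot.of (simplicialChains.obj X) k)) (h k)) c

theorem chainDesc_simplexChain {X : SSet.{u}} {M : Type u} [AddCommGroup M] {k : ℕ}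
    (f : X _⦋k⦌ → M) {x : X _⦋k⦌} (hx : x ∈ X.nonDegenerate k) :
    chainDesc X f (simplexChain X x) = f x := by
  have h := (SSet.isColimitCofanNormalizedChainComplex X (AddCommGrpCat.of (ULift.{u} ℤ)) k).fac
    (Cofan.mk (AddCommGrpCat.of M) fun x =>
      AddCommGrpCat.ofHom ((zmultiplesHom M (f x.1)).comp
        (AddEquiv.ulift : ULift.{u} ℤ ≃+ ℤ).toAddMonoidHom)) ⟨⟨x, hx⟩⟩
  exact (ConcreteCategory.congr_hom h (ULift.up 1)).trans (one_zsmul _)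

theorem chain_eq_zero {X : SSet.{u}} {k : ℕ} {x : X _⦋k⦌} (hx : x ∈ X.degenerate k) :
    chain X x = 0 := by
  rw [chain, SSet.ιNormalizedChainComplex_eq_zero X x hx]
  exact map_zero _

theorem chain_σ {X : SSet.{u}} {k : ℕ} (x : X _⦋k⦌) (i : Fin (k + 1)) :
    chain X (X.σ i x) = 0 :=
  chain_eq_zero (SSet.σ_mem_degenerate X i x)

theorem exists_σ_of_mem_degenerate {X : SSet.{u}} {k : ℕ} {x : X _⦋k⦌}
    (hx : x ∈ X.degenerate k) :
    ∃ (j : ℕ) (h : k = j + 1) (i : Fin (j + 1)) (y : X _⦋j⦌), h ▸ x = X.σ i y := by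
  rcases k with _ | j
  · simp at hx
  · rw [SSet.degenerate_eq_iUnion_range_σ, Set.mem_iUnion] at hx
    obtain ⟨i, y, hy⟩ := hx
    exact ⟨j, rfl, i, y, hy.symm⟩

theorem map_simplexChain {X Y : SSet.{u}} (g : X ⟶ Y) {k : ℕ} (x : X _⦋k⦌) :
    ((simplicialChains.map g).f k).hom (simplexChain X x) = simplexChain Y (g.app _ x) := by
  have h : ((SSet.normalizedChainComplexMap g (AddCommGrpCat.of (ULift.{u} ℤ))).f k).hom
      ((SSet.ιNormalizedChainComplex (R := AddCommGrpCat.of (ULift.{u} ℤ)) X x).hom (ULift.up 1)) =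
      (SSet.ιNormalizedChainComplex (R := AddCommGrpCat.of (ULift.{u} ℤ)) Y (g.app _ x)).hom
        (ULift.up 1) := by
    rw [← SSet.ι_normalizedChainComplexMap_f]
    rfl
  exact h

theorem map_chain {X Y : SSet.{u}} (g : X ⟶ Y) {k : ℕ} (x : X _⦋k⦌) :
    Tot.map (simplicialChains.map g) (chain X x) = chain Y (g.app _ x) :=
  (Tot.map_of _ _ _).trans (congrArg (Tot.of (simplicialChains.obj Y) k) (map_simplexChain g x))

theorem d_chain_zero {X : SSet.{u}} (x : X _⦋0⦌) : Tot.d _ (chain X x) = 0 :=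
  Tot.d_of_zero _

theorem AddCommGrpCat_sum_hom {A B : AddCommGrpCat.{u}} {ι : Type*} (s : Finset ι)
    (f : ι → (A ⟶ B)) (x : A) : (∑ i ∈ s, f i).hom x = ∑ i ∈ s, (f i).hom x := by
  classical
  induction s using Finset.induction_on with
  | empty => simp
  | insert a s ha ih =>
    rw [Finset.sum_insert ha, Finset.sum_insert ha, ← ih]
    rfl

theorem d_chain {X : SSet.{u}} {k : ℕ} (x : X _⦋k + 1⦌) :
    Tot.d _ (chain X x) = ∑ i : Fin (k + 2), (-1 : ℤ) ^ i.1 • chain X (X.δ i x) := by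
  rw [chain_eq_of, Tot.d_of_succ]
  have h := ConcreteCategory.congr_hom
    (SSet.ιNormalizedChainComplex_d X (R := AddCommGrpCat.of (ULift.{u} ℤ)) x) (ULift.up 1)
  refine (congrArg (Tot.of (simplicialChains.obj X) k) h).trans ?_
  refine (congrArg (Tot.of (simplicialChains.obj X) k)
    (AddCommGrpCat_sum_hom _ _ _)).trans ?_
  rw [map_sum]
  refine Finset.sum_congr rfl fun i _ => ?_
  exact map_zsmul (Tot.of (simplicialChains.obj X) k) _ _

theorem desc_chainDesc {X : SSet.{u}} {M : Type u} [AddCommGroup M] (f : ∀ j, X _⦋j⦌ → M) {k : ℕ}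
    {x : X _⦋k⦌} (hx : x ∈ X.nonDegenerate k) :
    Tot.desc (C := simplicialChains.obj X) (fun j => chainDesc X (j := j) (f j)) (chain X x) =
      f k x := by
  rw [chain_eq_of, Tot.desc_of, chainDesc_simplexChain _ hx]

/-- `chainDesc` only records values on nondegenerate simplices; a formula that vanishes on
degenerate ones then holds without a case distinction. -/
theorem desc_chainDesc_of_degenerate {X : SSet.{u}} {M : Type u} [AddCommGroup M]
    (f : ∀ j, X _⦋j⦌ → M) (hf : ∀ j x, x ∈ X.degenerate j → f j x = 0) {k : ℕ} (x : X _⦋k⦌) :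
    Tot.desc (C := simplicialChains.obj X) (fun j => chainDesc X (j := j) (f j)) (chain X x) =
      f k x := by
  by_cases hx : x ∈ X.degenerate k
  · rw [chain_eq_zero hx, map_zero, hf k x hx]
  · exact desc_chainDesc f hx

namespace StandardSimplex

/-! ### The contraction of the chains of a standard simplex -/

variable (k : ℕ)

theorem append_castSucc {j : ℕ} (x : (Δ[k] : SSet.{u}) _⦋j⦌) (t : Fin (j + 1)) :
    append k x t.castSucc = x t := by
  change Fin.snoc (α := fun _ => Fin (k + 1)) (fun t : Fin (j + 1) => x t) (Fin.last k) _ = _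
  simp

theorem append_last {j : ℕ} (x : (Δ[k] : SSet.{u}) _⦋j⦌) :
    append k x (Fin.last (j + 1)) = Fin.last k := by
  change Fin.snoc (α := fun _ => Fin (k + 1)) (fun t : Fin (j + 1) => x t) (Fin.last k) _ = _
  simp

theorem ext_last {j : ℕ} {x y : (Δ[k] : SSet.{u}) _⦋j + 1⦌}
    (h1 : ∀ t : Fin (j + 1), x t.castSucc = y t.castSucc)
    (h2 : x (Fin.last (j + 1)) = y (Fin.last (j + 1))) : x = y := by
  ext1 t
  induction t using Fin.lastCases with
  | last => exact h2
  | cast t => exact h1 t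

theorem castSucc_succAbove_last {n : ℕ} (i : Fin (n + 1)) :
    i.castSucc.succAbove (Fin.last n) = Fin.last (n + 1) := by
  rw [Fin.succAbove_of_le_castSucc _ _ (Fin.castSucc_le_castSucc_iff.2 (Fin.le_last i)),
    Fin.succ_last]

theorem append_σ {j : ℕ} (i : Fin (j + 1)) (x : (Δ[k] : SSet.{u}) _⦋j⦌) :
    append k ((Δ[k] : SSet.{u}).σ i x) = (Δ[k] : SSet.{u}).σ i.castSucc (append k x) := by
  refine ext_last k (fun t => ?_) ?_
  · rw [append_castSucc, SSet.stdSimplex.σ_apply, SSet.stdSimplex.σ_apply,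
      Fin.castSucc_predAbove_castSucc, append_castSucc]
  · rw [append_last, SSet.stdSimplex.σ_apply, Fin.predAbove_right_last, append_last]

theorem append_mem_degenerate {j : ℕ} {x : (Δ[k] : SSet.{u}) _⦋j⦌}
    (hx : x ∈ (Δ[k] : SSet.{u}).degenerate j) :
    append k x ∈ (Δ[k] : SSet.{u}).degenerate (j + 1) := by
  obtain ⟨j, rfl, i, y, rfl⟩ := exists_σ_of_mem_degenerate hx
  rw [append_σ]
  exact SSet.σ_mem_degenerate _ _ _

/-- The source of the clause "zero if i_j = k": repeating the last vertex is a degeneracy. It yields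
both sε = 0 and ss = 0. -/
theorem append_of_last {j : ℕ} (x : (Δ[k] : SSet.{u}) _⦋j⦌) (hx : x (Fin.last j) = Fin.last k) :
    append k x = (Δ[k] : SSet.{u}).σ (Fin.last j) x := by
  refine ext_last k (fun t => ?_) ?_
  · rw [append_castSucc, SSet.stdSimplex.σ_apply, Fin.predAbove_last_castSucc]
  · rw [append_last, SSet.stdSimplex.σ_apply, Fin.predAbove_right_last, hx]

theorem δ_castSucc_append {j : ℕ} (i : Fin (j + 2)) (x : (Δ[k] : SSet.{u}) _⦋j + 1⦌) :
    (Δ[k] : SSet.{u}).δ i.castSucc (append k x) = append k ((Δ[k] : SSet.{u}).δ i x) := by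
  refine ext_last k (fun t => ?_) ?_
  · rw [append_castSucc, SSet.stdSimplex.δ_apply, SSet.stdSimplex.δ_apply,
      Fin.castSucc_succAbove_castSucc, append_castSucc]
  · rw [append_last, SSet.stdSimplex.δ_apply, castSucc_succAbove_last, append_last]

theorem δ_last_append {j : ℕ} (x : (Δ[k] : SSet.{u}) _⦋j⦌) :
    (Δ[k] : SSet.{u}).δ (Fin.last (j + 1)) (append k x) = x := by
  ext1 t
  rw [SSet.stdSimplex.δ_apply, Fin.succAbove_last, append_castSucc]

theorem δ_zero_append (x : (Δ[k] : SSet.{u}) _⦋0⦌) :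
    (Δ[k] : SSet.{u}).δ 0 (append k x) = lastVertex k := by
  ext1 t
  rw [SSet.stdSimplex.δ_apply]
  have h : (0 : Fin 2).succAbove t = Fin.last 1 := by fin_cases t; rfl
  rw [h, append_last]
  rfl

theorem contr_chain {j : ℕ} (x : (Δ[k] : SSet.{u}) _⦋j⦌) :
    contr k (chain _ x) = (-1 : ℤ) ^ (j + 1) • chain _ (append k x) :=
  desc_chainDesc_of_degenerate
    (fun j x => (-1 : ℤ) ^ (j + 1) • chain (Δ[k] : SSet.{u}) (append k x))
    (fun j x hx => by rw [chain_eq_zero (append_mem_degenerate k hx), smul_zero]) x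

theorem aug_chain {j : ℕ} (x : (Δ[k] : SSet.{u}) _⦋j⦌) :
    aug k (chain _ x) = if j = 0 then chain _ (lastVertex k) else 0 :=
  desc_chainDesc_of_degenerate
    (fun j _ => if j = 0 then chain (Δ[k] : SSet.{u}) (lastVertex k) else 0)
    (fun j x hx => if_neg (by rintro rfl; simp at hx)) x

theorem aug_of {j : ℕ} (hj : j ≠ 0) (c : (simplicialChains.obj (Δ[k] : SSet.{u})).X j) :
    aug k (Tot.of _ j c) = 0 := by
  rw [aug, Tot.desc_of]
  have : (chainDesc (Δ[k] : SSet.{u}) (j := j) fun _ =>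
      if j = 0 then chain (Δ[k] : SSet.{u}) (lastVertex k) else 0) = 0 :=
    simplexChain_hom_ext fun x hx => by
      rw [chainDesc_simplexChain _ hx, if_neg hj]
      rfl
  rw [this]
  rfl

theorem contr_of {j : ℕ} (c : (simplicialChains.obj (Δ[k] : SSet.{u})).X j) :
    ∃ y, contr k (Tot.of _ j c) = Tot.of _ (j + 1) y := by
  refine ⟨chainDesc (Δ[k] : SSet.{u}) (fun x => (-1 : ℤ) ^ (j + 1) •
    simplexChain (Δ[k] : SSet.{u}) (append k x)) c, ?_⟩
  rw [contr, Tot.desc_of, ← AddMonoidHom.comp_apply]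
  refine DFunLike.congr_fun (simplexChain_hom_ext fun x hx => ?_) c
  rw [AddMonoidHom.comp_apply, chainDesc_simplexChain _ hx, chainDesc_simplexChain _ hx, map_zsmul]
  rfl

theorem contr_lastVertex : contr k (chain (Δ[k] : SSet.{u}) (lastVertex k)) = 0 := by
  rw [contr_chain, append_of_last k _ rfl, chain_σ, smul_zero]

theorem contr_aug (x : Tot (simplicialChains.obj (Δ[k] : SSet.{u}))) : contr k (aug k x) = 0 := by
  have : contr k ∘ₗ aug.{u} k = 0 := chain_hom_ext fun j x _ => by
    rw [LinearMap.comp_apply, aug_chain]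
    split_ifs
    · rw [contr_lastVertex]; rfl
    · rw [map_zero]; rfl
  exact LinearMap.congr_fun this x

theorem aug_contr (x : Tot (simplicialChains.obj (Δ[k] : SSet.{u}))) : aug k (contr k x) = 0 := by
  have : aug k ∘ₗ contr.{u} k = 0 := chain_hom_ext fun j x _ => by
    rw [LinearMap.comp_apply, contr_chain, map_smul, aug_chain, if_neg (Nat.succ_ne_zero j),
      smul_zero]
    rfl
  exact LinearMap.congr_fun this x

theorem contr_contr (x : Tot (simplicialChains.obj (Δ[k] : SSet.{u}))) :
    contr k (contr k x) = 0 := by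
  have : contr k ∘ₗ contr.{u} k = 0 := chain_hom_ext fun j x _ => by
    rw [LinearMap.comp_apply, contr_chain, map_smul, contr_chain,
      append_of_last k _ (append_last k x), chain_σ, smul_zero, smul_zero]
    rfl
  exact LinearMap.congr_fun this x

theorem aug_d (x : Tot (simplicialChains.obj (Δ[k] : SSet.{u}))) : aug k (Tot.d _ x) = 0 := by
  have : aug.{u} k ∘ₗ Tot.d _ = 0 := chain_hom_ext fun j x _ => by
    rw [LinearMap.comp_apply, LinearMap.zero_apply]
    rcases j with _ | _ | j
    · rw [d_chain_zero, map_zero]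
    · rw [d_chain]
      simp [Fin.sum_univ_two, aug_chain]
    · rw [d_chain]
      simp [aug_chain]
  exact LinearMap.congr_fun this x

theorem d_aug (x : Tot (simplicialChains.obj (Δ[k] : SSet.{u}))) : Tot.d _ (aug k x) = 0 := by
  have : Tot.d _ ∘ₗ aug.{u} k = 0 := chain_hom_ext fun j x _ => by
    rw [LinearMap.comp_apply, LinearMap.zero_apply, aug_chain]
    split_ifs
    · rw [d_chain_zero]
    · rw [map_zero]
  exact LinearMap.congr_fun this x

/-- Appending k is an extra degeneracy: the last face returns x, with sign cancelling (−1)^(j+1),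
and the other faces cancel against s∂. In dimension 0 the other face is the vertex [k], which is the
term −ε. -/
theorem d_contr (x : Tot (simplicialChains.obj (Δ[k] : SSet.{u}))) :
    Tot.d _ (contr k x) + contr k (Tot.d _ x) = x - aug k x := by
  have : Tot.d _ ∘ₗ contr.{u} k + contr k ∘ₗ Tot.d _ = LinearMap.id - aug k :=
    chain_hom_ext fun j x _ => by
    simp only [LinearMap.add_apply, LinearMap.comp_apply, LinearMap.sub_apply, LinearMap.id_apply]
    rw [contr_chain, map_smul, d_chain, aug_chain]
    rcases j with _ | j
    · have h1 : (Δ[k] : SSet.{u}).δ 1 (append k x) = x := δ_last_append k x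
      simp [Fin.sum_univ_two, d_chain_zero, δ_zero_append, h1]
      abel
    · rw [d_chain, if_neg (Nat.succ_ne_zero j), sub_zero, Fin.sum_univ_castSucc, δ_last_append,
        map_sum, smul_add, smul_smul]
      have h1 : (-1 : ℤ) ^ (j + 1 + 1) * (-1) ^ (Fin.last (j + 1 + 1)).1 = 1 := by
        rw [Fin.val_last, ← mul_pow]; simp
      rw [h1, one_smul, add_right_comm, Finset.smul_sum, ← Finset.sum_add_distrib,
        Finset.sum_eq_zero, zero_add]
      intro i _
      rw [δ_castSucc_append, map_smul, contr_chain, smul_smul, smul_smul, ← add_smul]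
      have h2 : (-1 : ℤ) ^ (j + 1 + 1) * (-1) ^ i.castSucc.1 + (-1) ^ i.1 * (-1) ^ (j + 1) = 0 := by
        rw [Fin.val_castSucc, pow_succ (-1 : ℤ) (j + 1)]; ring
      rw [h2, zero_smul]
  exact LinearMap.congr_fun this x

theorem of_chain {X : SSet.{u}} (p : ℕ) {j : ℕ} (x : X _⦋j⦌) :
    Tot.sgn _ p (chain X x) = (-1 : ℤ) ^ (p * j) • chain X x :=
  Tot.sgn_of _ _ _

theorem sgn_contr (p : ℕ) (x : Tot (simplicialChains.obj (Δ[k] : SSet.{u}))) :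
    Tot.sgn _ p (contr k x) = (-1 : ℤ) ^ p • contr k (Tot.sgn _ p x) := by
  have : Tot.sgn _ p ∘ₗ contr.{u} k = (-1 : ℤ) ^ p • contr k ∘ₗ Tot.sgn _ p :=
    chain_hom_ext fun j x _ => by
    simp only [LinearMap.comp_apply, LinearMap.smul_apply]
    rw [contr_chain, of_chain, map_smul, map_smul, of_chain, contr_chain, smul_smul, smul_smul,
      smul_smul]
    congr 1
    ring
  exact LinearMap.congr_fun this x

theorem sgn_aug (p : ℕ) (x : Tot (simplicialChains.obj (Δ[k] : SSet.{u}))) :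
    Tot.sgn _ p (aug k x) = aug k x := by
  have : Tot.sgn _ p ∘ₗ aug.{u} k = aug k :=
    chain_hom_ext fun j x _ => by
    rw [LinearMap.comp_apply, aug_chain]
    split_ifs
    · rw [of_chain]; simp
    · rw [map_zero]
  exact LinearMap.congr_fun this x

theorem aug_sgn (p : ℕ) (x : Tot (simplicialChains.obj (Δ[k] : SSet.{u}))) :
    aug k (Tot.sgn _ p x) = aug k x := by
  have : aug.{u} k ∘ₗ Tot.sgn _ p = aug k :=
    chain_hom_ext fun j x _ => by
    rw [LinearMap.comp_apply, of_chain, map_smul, aug_chain]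
    split_ifs with h
    · simp [h]
    · rw [smul_zero]
  exact LinearMap.congr_fun this x

variable {k}

/-- Only preservation of the last vertex is required, so degeneracies and all simplices ending in
the last vertex qualify. -/
theorem map_contr {r : ℕ} (y : (Δ[r] : SSet.{u}) _⦋k⦌) (hy : y (Fin.last k) = Fin.last r)
    (x : Tot (simplicialChains.obj (Δ[k] : SSet.{u}))) :
    Tot.map (simplicialChains.map (SSet.yonedaEquiv.symm y)) (contr k x) =
      contr r (Tot.map (simplicialChains.map (SSet.yonedaEquiv.symm y)) x) := by
  have : Tot.map (simplicialChains.map (SSet.yonedaEquiv.symm y)) ∘ₗ contr k =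
      contr r ∘ₗ Tot.map (simplicialChains.map (SSet.yonedaEquiv.symm y)) :=
    chain_hom_ext fun j x _ => by
    simp only [LinearMap.comp_apply]
    rw [contr_chain, map_smul, map_chain, map_chain, contr_chain]
    congr 2
    refine ext_last r (fun t => ?_) ?_
    · rw [append_castSucc]
      change y (append k x t.castSucc) = y (x t)
      rw [append_castSucc]
    · rw [append_last]
      change y (append k x (Fin.last _)) = _
      rw [append_last, hy]
  exact LinearMap.congr_fun this x

theorem map_aug {r : ℕ} (y : (Δ[r] : SSet.{u}) _⦋k⦌) (hy : y (Fin.last k) = Fin.last r)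
    (x : Tot (simplicialChains.obj (Δ[k] : SSet.{u}))) :
    Tot.map (simplicialChains.map (SSet.yonedaEquiv.symm y)) (aug k x) =
      aug r (Tot.map (simplicialChains.map (SSet.yonedaEquiv.symm y)) x) := by
  have : Tot.map (simplicialChains.map (SSet.yonedaEquiv.symm y)) ∘ₗ aug k =
      aug r ∘ₗ Tot.map (simplicialChains.map (SSet.yonedaEquiv.symm y)) :=
    chain_hom_ext fun j x _ => by
    simp only [LinearMap.comp_apply]
    rw [aug_chain, map_chain, aug_chain]
    split_ifs
    · rw [map_chain]
      congr 1
      ext1 t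
      exact hy
    · rw [map_zero]
  exact LinearMap.congr_fun this x

end StandardSimplex

/-! ### The contraction Φ of tensor powers -/

namespace StandardSimplex

open PiTensorProduct SymOperad

variable (k : ℕ)

/-- The map `ε ⊗ ⋯ ⊗ ε` on the tensor power of the chains of `Δ[k]`. -/
def augTP (n : ℕ) : TP (simplicialChains.obj (Δ[k] : SSet.{u})) n →ₗ[ℤ]
    TP (simplicialChains.obj (Δ[k] : SSet.{u})) n :=
  PiTensorProduct.map fun _ => aug k

theorem contrTP_tprod {n : ℕ} (x : Fin n → Tot (simplicialChains.obj (Δ[k] : SSet.{u}))) :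
    contrTP k n (tprod ℤ x) = ∑ j, tprod ℤ fun i => if i < j then aug k (x i) else
      if i = j then contr k (x i) else x i := by
  rw [contrTP, LinearMap.sum_apply]
  refine Finset.sum_congr rfl fun j _ => ?_
  rw [map_tprod]
  congr 1
  funext k
  split_ifs <;> rfl

theorem augTP_tprod {n : ℕ} (x : Fin n → Tot (simplicialChains.obj (Δ[k] : SSet.{u}))) :
    augTP k n (tprod ℤ x) = tprod ℤ fun i => aug k (x i) := by
  rw [augTP, map_tprod]

/-- If two copies of s fall in one factor, ss = 0 applies; otherwise the factor carrying the earlier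
or later s is hit by an ε from the other copy of Φ, and sε = 0 or εs = 0 applies. -/
theorem contrTP_contrTP {n : ℕ} (z : TP (simplicialChains.obj (Δ[k] : SSet.{u})) n) :
    contrTP k n (contrTP k n z) = 0 := by
  have : contrTP.{u} k n ∘ₗ contrTP k n = 0 := TP.hom_ext_tprod fun x => by
    rw [LinearMap.comp_apply, contrTP_tprod, map_sum, LinearMap.zero_apply]
    refine Finset.sum_eq_zero fun i _ => ?_
    rw [contrTP_tprod]
    refine Finset.sum_eq_zero fun j _ => ?_
    rcases lt_trichotomy j i with h | rfl | h
    · refine MultilinearMap.map_coord_zero _ j ?_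
      simp [h, contr_aug]
    · refine MultilinearMap.map_coord_zero _ j ?_
      simp [contr_contr]
    · refine MultilinearMap.map_coord_zero _ i ?_
      simp [h, aug_contr]
  exact LinearMap.congr_fun this z

theorem augTP_contrTP {n : ℕ} (z : TP (simplicialChains.obj (Δ[k] : SSet.{u})) n) :
    augTP k n (contrTP k n z) = 0 := by
  have : augTP.{u} k n ∘ₗ contrTP k n = 0 := TP.hom_ext_tprod fun x => by
    rw [LinearMap.comp_apply, contrTP_tprod, map_sum, LinearMap.zero_apply]
    refine Finset.sum_eq_zero fun i _ => ?_
    rw [augTP_tprod]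
    refine MultilinearMap.map_coord_zero _ i ?_
    simp [aug_contr]
  exact LinearMap.congr_fun this z

/-- Telescoping: T i is the tensor with ε applied to its first i factors. -/
theorem sum_tprod_aug_sub {n : ℕ} (x : Fin n → Tot (simplicialChains.obj (Δ[k] : SSet.{u}))) :
    ∑ i : Fin n, tprod ℤ (Function.update (fun t => if t < i then aug k (x t) else x t) i
      (x i - aug k (x i))) = tprod ℤ x - tprod ℤ fun i => aug k (x i) := by
  let T : ℕ → TP (simplicialChains.obj (Δ[k] : SSet.{u})) n := fun i =>
    tprod ℤ fun t : Fin n => if t.1 < i then aug k (x t) else x t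
  have h : ∀ i : Fin n, tprod ℤ (Function.update (fun t => if t < i then aug k (x t) else x t) i
      (x i - aug k (x i))) = T i - T (i + 1) := by
    intro i
    rw [MultilinearMap.map_update_sub]
    congr 2
    · funext t
      by_cases ht : t = i
      · subst ht; simp
      · simp [ht]
    · funext t
      by_cases ht : t = i
      · subst ht; simp
      · have : t.1 ≠ i.1 := fun h => ht (Fin.ext h)
        have h2 : t.1 < i.1 + 1 ↔ t < i := by rw [Fin.lt_def]; omega
        simp only [Function.update_of_ne ht, h2]
  rw [Finset.sum_congr rfl fun i _ => h i, Fin.sum_univ_eq_sum_range fun i => T i - T (i + 1),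
    Finset.sum_range_sub']
  simp [T]

theorem d_contrTP {n : ℕ} (z : TP (simplicialChains.obj (Δ[k] : SSet.{u})) n) :
    TP.d _ n (contrTP k n z) + contrTP k n (TP.d _ n z) = z - augTP k n z := by
  have : TP.d _ n ∘ₗ contrTP.{u} k n + contrTP k n ∘ₗ TP.d _ n = LinearMap.id - augTP k n :=
    TP.hom_ext_tprod fun x => by
    simp only [LinearMap.add_apply, LinearMap.comp_apply, LinearMap.sub_apply, LinearMap.id_apply]
    rw [contrTP_tprod, map_sum, TP.d_tprod, map_sum, augTP_tprod, ← sum_tprod_aug_sub]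
    simp only [TP.d_tprod, contrTP_tprod]
    -- The outer index is now the factor carrying s in both sums, and the inner index the factor
    -- carrying ∂. Equal indices give 1 − ε in that factor, hence the telescoping sum; unequal ones
    -- contribute nothing.
    refine (congrArg _ Finset.sum_comm).trans ?_
    rw [← Finset.sum_add_distrib]
    refine Finset.sum_congr rfl fun i _ => ?_
    rw [← Finset.sum_add_distrib, Finset.sum_eq_single i]
    · simp only [← d_contr]
      rw [MultilinearMap.map_update_add]
      congr 2
      · funext t
        rcases lt_trichotomy t i with h | rfl | h
        · simp [h, h.ne, sgn_aug]
        · simp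
        · simp [h.not_gt, h.ne']
      · funext t
        rcases lt_trichotomy t i with h | rfl | h
        · simp [h, h.ne, aug_sgn]
        · simp
        · simp [h.not_gt, h.ne']
    · intro j _ hj
      rcases lt_or_gt_of_ne hj with h | h
      · rw [MultilinearMap.map_coord_zero _ j (by simp [h, d_aug]),
          MultilinearMap.map_coord_zero _ j (by simp [h, aug_d]), add_zero]
      -- With ∂ to the right of s, the two orders differ by the sign of moving ∂ past s, an operator
      -- of degree one. With ∂ to the left it meets an ε, and each term is zero.
      · have h1 : (fun t => if t < i then aug k (if t < j then Tot.sgn _ 1 (x t) else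
              if t = j then Tot.d _ (x t) else x t) else if t = i then contr k
              (if t < j then Tot.sgn _ 1 (x t) else if t = j then Tot.d _ (x t) else x t) else
              if t < j then Tot.sgn _ 1 (x t) else if t = j then Tot.d _ (x t) else x t) =
            fun t => (if t = i then (-1 : ℤ) else 1) • (if t < j then Tot.sgn _ 1
              (if t < i then aug k (x t) else if t = i then contr k (x t) else x t) else
              if t = j then Tot.d _
              (if t < i then aug k (x t) else if t = i then contr k (x t) else x t) else
              if t < i then aug k (x t) else if t = i then contr k (x t) else x t) := by
          funext t
          rcases lt_trichotomy t i with h' | rfl | h'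
          · simp only [h', h'.trans h, h'.ne, if_true, if_false, one_smul, aug_sgn, sgn_aug]
          · simp only [lt_irrefl, h, if_true, if_false, sgn_contr]
            simp
          · simp only [h'.not_gt, h'.ne', if_false, one_smul]
        rw [h1, MultilinearMap.map_smul_univ, Finset.prod_ite_eq', if_pos (Finset.mem_univ _)]
        simp
    · simp
  exact LinearMap.congr_fun this z

variable {k}

theorem map_contrTP {r n : ℕ} (y : (Δ[r] : SSet.{u}) _⦋k⦌) (hy : y (Fin.last k) = Fin.last r)
    (z : TP (simplicialChains.obj (Δ[k] : SSet.{u})) n) :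
    TP.map (simplicialChains.map (SSet.yonedaEquiv.symm y)) n (contrTP k n z) =
      contrTP r n (TP.map (simplicialChains.map (SSet.yonedaEquiv.symm y)) n z) := by
  have : TP.map (simplicialChains.map (SSet.yonedaEquiv.symm y)) n ∘ₗ contrTP k n =
      contrTP r n ∘ₗ TP.map (simplicialChains.map (SSet.yonedaEquiv.symm y)) n :=
    TP.hom_ext_tprod fun x => by
    simp only [LinearMap.comp_apply]
    rw [contrTP_tprod, map_sum, TP.map, map_tprod, contrTP_tprod]
    refine Finset.sum_congr rfl fun j _ => ?_
    rw [map_tprod]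
    congr 1
    funext i
    split_ifs
    · rw [map_aug y hy]
    · rw [map_contr y hy]
    · rfl
  exact LinearMap.congr_fun this z

variable (k)

theorem augTP_eq_zero {n p : ℕ} (hp : p ≠ 0)
    {z : TP (simplicialChains.obj (Δ[k] : SSet.{u})) n} (hz : z ∈ TP.deg _ n p) :
    augTP k n z = 0 :=
  TP.deg_induction (g := 0) (fun q x hq => by
    obtain ⟨j, hj⟩ : ∃ j, q j ≠ 0 := by
      by_contra! h
      exact hp (by rw [← hq]; exact Finset.sum_eq_zero fun j _ => h j)
    rw [augTP_tprod, MultilinearMap.map_coord_zero _ j (aug_of k hj _)]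
    rfl) hz

theorem aug_of_mem {j : ℕ} (c : (simplicialChains.obj (Δ[k] : SSet.{u})).X j) :
    ∃ y, aug k (Tot.of _ j c) = Tot.of _ j y := by
  by_cases hj : j = 0
  · subst hj
    refine ⟨chainDesc (Δ[k] : SSet.{u}) (fun x => simplexChain _ (lastVertex k)) c, ?_⟩
    rw [aug, Tot.desc_of, ← AddMonoidHom.comp_apply]
    refine DFunLike.congr_fun (simplexChain_hom_ext fun x hx => ?_) c
    rw [AddMonoidHom.comp_apply, chainDesc_simplexChain _ hx, chainDesc_simplexChain _ hx,
      if_pos rfl]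
    rfl
  · exact ⟨0, by rw [aug_of k hj, map_zero]⟩

theorem contrTP_mem_deg {n p : ℕ} {z : TP (simplicialChains.obj (Δ[k] : SSet.{u})) n}
    (hz : z ∈ TP.deg _ n p) : contrTP k n z ∈ TP.deg _ n (p + 1) :=
  TP.deg_map_mem (fun q x hq => by
    rw [contrTP_tprod]
    refine sum_mem fun j _ => TP.tprod_mem_deg (fun i => q i + if i = j then 1 else 0) ?_
      fun i => ?_
    · rw [Finset.sum_add_distrib, hq]
      simp
    · rcases lt_trichotomy i j with h | rfl | h
      · have e : (q i + if i = j then 1 else 0) = q i := by simp [h.ne]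
        rw [e, if_pos h]
        exact aug_of_mem k (x i)
      · have e : (q i + if i = i then 1 else 0) = q i + 1 := by simp
        rw [e, if_neg (lt_irrefl i), if_pos rfl]
        exact contr_of k (x i)
      · have e : (q i + if i = j then 1 else 0) = q i := by simp [h.ne']
        rw [e, if_neg h.not_gt, if_neg h.ne']
        exact ⟨_, rfl⟩) hz

theorem contrTP_glue {m n : ℕ} (i : Fin (m + 1))
    (y : {j // j ≠ i} → Tot (simplicialChains.obj (Δ[k] : SSet.{u})))
    (z : TP (simplicialChains.obj (Δ[k] : SSet.{u})) n) :
    contrTP k (m + n) (TP.glue i y z) =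
      (∑ j : {j // j ≠ i}, TP.glue i (fun l => if l.1 < j.1 then aug k (y l) else
        if l.1 = j.1 then contr k (y l) else y l) (if i < j.1 then augTP k n z else z)) +
      TP.glue i (fun l => if l.1 < i then aug k (y l) else y l) (contrTP k n z) :=
  TP.sum_map_glue _ _ i y z

/-- Insertion, in one factor of a tensor in the image of the contraction, of a map whose values
on the images of `s` and `ε` are killed by the contraction. -/
theorem contrTP_insertKoszul_contrTP {m n : ℕ} (i : Fin (m + 1)) (p : ℕ)
    {f : Tot (simplicialChains.obj (Δ[k] : SSet.{u})) →ₗ[ℤ]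
      TP (simplicialChains.obj (Δ[k] : SSet.{u})) n}
    (h1 : ∀ x, contrTP k n (f (contr k x)) = 0) (h2 : ∀ x, augTP k n (f (contr k x)) = 0)
    (h3 : ∀ x, contrTP k n (f (aug k x)) = 0)
    (z : TP (simplicialChains.obj (Δ[k] : SSet.{u})) (m + 1)) :
    contrTP k (m + n) (TP.insertKoszul i p f (contrTP k (m + 1) z)) = 0 := by
  have : contrTP k (m + n) ∘ₗ TP.insertKoszul i p f ∘ₗ contrTP k (m + 1) = 0 :=
    TP.hom_ext_tprod fun x => by
    rw [LinearMap.comp_apply, LinearMap.comp_apply, contrTP_tprod, map_sum, map_sum,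
      LinearMap.zero_apply]
    refine Finset.sum_eq_zero fun j _ => ?_
    have hs : ∀ x, contr.{u} k (Tot.sgn _ p (contr k x)) = 0 := fun x => by
      rw [sgn_contr, map_smul, contr_contr, smul_zero]
    have he : ∀ x, aug.{u} k (Tot.sgn _ p (contr k x)) = 0 := fun x => by
      rw [aug_sgn, aug_contr]
    have hse : ∀ x, contr.{u} k (Tot.sgn _ p (aug k x)) = 0 := fun x => by
      rw [sgn_aug, contr_aug]
    -- Here j is the factor where the inner Φ puts s. The outer Φ puts its s either inside the block
    -- or on an outer factor J; in every case one factor shows ss, sε or εs, or else a hypothesis on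
    -- f kills the block.
    rw [TP.insertKoszul_tprod, contrTP_glue, Finset.sum_eq_zero, zero_add]
    · rcases lt_trichotomy j i with h | rfl | h
      · refine TP.glue_eq_zero i _ _ ⟨j, h.ne⟩ ?_
        simp [h, he]
      · simp [h1]
      · simp [h, h3]
    · intro J _
      rcases lt_trichotomy J.1 j with h | h | h
      · refine TP.glue_eq_zero i _ _ J ?_
        simp only [lt_irrefl, if_false, if_true, h]
        split_ifs
        · exact hse _
        · exact contr_aug _ _
      · refine TP.glue_eq_zero i _ _ J ?_
        simp only [lt_irrefl, if_false, if_true, h]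
        split_ifs
        · exact hs _
        · exact contr_contr _ _
      · by_cases hj : j = i
        · subst hj
          simp [h, h2]
        · refine TP.glue_eq_zero i _ _ ⟨j, hj⟩ ?_
          simp only [lt_irrefl, if_false, if_true, h]
          split_ifs
          · exact he _
          · exact aug_contr _ _
  exact LinearMap.congr_fun this z

theorem augTP_insertKoszul_contrTP {m n : ℕ} (i : Fin (m + 1)) (p : ℕ)
    {f : Tot (simplicialChains.obj (Δ[k] : SSet.{u})) →ₗ[ℤ]
      TP (simplicialChains.obj (Δ[k] : SSet.{u})) n}
    (h2 : ∀ x, augTP k n (f (contr k x)) = 0)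
    (z : TP (simplicialChains.obj (Δ[k] : SSet.{u})) (m + 1)) :
    augTP k (m + n) (TP.insertKoszul i p f (contrTP k (m + 1) z)) = 0 := by
  have : augTP k (m + n) ∘ₗ TP.insertKoszul i p f ∘ₗ contrTP k (m + 1) = 0 :=
    TP.hom_ext_tprod fun x => by
    rw [LinearMap.comp_apply, LinearMap.comp_apply, contrTP_tprod, map_sum, map_sum,
      LinearMap.zero_apply]
    refine Finset.sum_eq_zero fun j _ => ?_
    rw [TP.insertKoszul_tprod, augTP, TP.map_glue]
    by_cases hj : j = i
    · subst hj
      have := h2 (x j)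
      rw [augTP] at this
      simp [this]
    · refine TP.glue_eq_zero i _ _ ⟨j, hj⟩ ?_
      simp only [lt_irrefl, if_false, if_true]
      split_ifs
      · rw [aug_sgn, aug_contr]
      · exact aug_contr _ _
  exact LinearMap.congr_fun this z

end StandardSimplex

/-! ### The Cartan construction -/

/-- The map of chains induced by the classifying map `Δ[k] ⟶ X` of a simplex. -/
def classify (X : SSet.{u}) {k : ℕ} (x : X _⦋k⦌) :
    simplicialChains.obj (Δ[k] : SSet.{u}) ⟶ simplicialChains.obj X :=
  simplicialChains.map (SSet.yonedaEquiv.symm x)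

theorem classify_top (k : ℕ) : classify.{u} _ (StandardSimplex.top k) = 𝟙 _ := by
  rw [classify, StandardSimplex.top, SSet.yonedaEquiv_symm_stdSimplex_id,
    simplicialChains.map_id]

theorem classify_app {X Y : SSet.{u}} (g : X ⟶ Y) {k : ℕ} (x : X _⦋k⦌) :
    classify Y (g.app _ x) = classify X x ≫ simplicialChains.map g := by
  rw [classify, ← SSet.yonedaEquiv_symm_comp, simplicialChains.map_comp, classify]

theorem app_top {X : SSet.{u}} {k : ℕ} (x : X _⦋k⦌) :
    (SSet.yonedaEquiv.symm x).app _ (StandardSimplex.top k) = x :=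
  SSet.yonedaEquiv_symm_app_id x

theorem map_classify_top {X : SSet.{u}} {k : ℕ} (x : X _⦋k⦌) :
    Tot.map (classify X x) (chain _ (StandardSimplex.top k)) = chain X x := by
  rw [classify, map_chain, app_top]

namespace CartanDiagonal

open StandardSimplex SymOperad PiTensorProduct

variable {m : ℕ}

/-- The natural, equivariant maps `RS_m ⊗ C(X) → C(X)^m` given by elements of `C(Δ[k])^m`
for `1[a₁|…|a_p] ⊗ [0, …, k]`. -/
def extend (F : List {g : Equiv.Perm (Fin m) // g ≠ 1} → (k : ℕ) →
    TP (simplicialChains.obj (Δ[k] : SSet.{u})) m) (X : SSet.{u}) :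
    RS m →ₗ[ℤ] Tot (simplicialChains.obj X) →ₗ[ℤ] TP (simplicialChains.obj X) m :=
  Finsupp.linearCombination ℤ fun w => Tot.desc (C := simplicialChains.obj X) fun k =>
    chainDesc X (j := k) fun x => TP.perm _ w.1 (TP.map (classify X x) m (F w.2 k))

theorem extend_word_chain (F : List {g : Equiv.Perm (Fin m) // g ≠ 1} → (k : ℕ) →
    TP (simplicialChains.obj (Δ[k] : SSet.{u})) m) {X : SSet.{u}} (w : BarWord m) {k : ℕ}
    {x : X _⦋k⦌} (hx : x ∈ X.nonDegenerate k) :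
    extend F X (word w) (chain X x) = TP.perm _ w.1 (TP.map (classify X x) m (F w.2 k)) := by
  rw [extend, word, Finsupp.linearCombination_single, one_smul]
  exact desc_chainDesc (fun k x => TP.perm _ w.1 (TP.map (classify X x) m (F w.2 k))) hx

/-- The values `f_m(1[a₁|…|a_p] ⊗ [0, …, k])`, by recursion on `p + k`. -/
def valueAux (N : ℕ) : List {g : Equiv.Perm (Fin m) // g ≠ 1} → (k : ℕ) →
    TP (simplicialChains.obj (Δ[k] : SSet.{u})) m :=
  -- The base value is assigned to all l and k, but `value` reads depth 0 only at l = [], k = 0,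
  -- where the last vertex is [0].
  Nat.rec (fun _ k => tprod ℤ fun _ => chain _ (lastVertex k))
    (fun _ F l k => contrTP k m (extend F _ (bdry (word (1, l))) (chain _ (top k)) +
      (-1 : ℤ) ^ l.length • extend F _ (word (1, l)) (Tot.d _ (chain _ (top k))))) N

theorem valueAux_succ (N : ℕ) (l : List {g : Equiv.Perm (Fin m) // g ≠ 1}) (k : ℕ) :
    valueAux.{u} (N + 1) l k =
      contrTP k m (extend (valueAux N) _ (bdry (word (1, l))) (chain _ (top k)) +
        (-1 : ℤ) ^ l.length • extend (valueAux N) _ (word (1, l)) (Tot.d _ (chain _ (top k)))) :=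
  rfl

/-- The values `f_m(1[a₁|…|a_p] ⊗ [0, …, k])`. -/
def value (l : List {g : Equiv.Perm (Fin m) // g ≠ 1}) (k : ℕ) :
    TP (simplicialChains.obj (Δ[k] : SSet.{u})) m :=
  valueAux (l.length + k) l k

/-- The map `f_m : RS_m ⊗ C(X) → C(X)^m`. -/
def diag (m : ℕ) (X : SSet.{u}) :
    RS m →ₗ[ℤ] Tot (simplicialChains.obj X) →ₗ[ℤ] TP (simplicialChains.obj X) m :=
  extend value X

/-- Depth N is correct precisely in total degree N, and the recursion at depth N + 1 only consults
terms of that degree. -/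
theorem extend_valueAux {N p k : ℕ} (h : p + k = N) {X : SSet.{u}} {a : RS m} (ha : a ∈ homog m p)
    (x : X _⦋k⦌) : extend (valueAux N) X a (chain X x) = diag m X a (chain X x) := by
  by_cases hx : x ∈ X.degenerate k
  · rw [chain_eq_zero hx, map_zero, map_zero]
  · refine homog_induction (f := (extend (valueAux N) X).flip (chain X x))
      (g := (diag m X).flip (chain X x)) (fun w hw => ?_) ha
    rw [LinearMap.flip_apply, LinearMap.flip_apply, diag, extend_word_chain _ _ hx,
      extend_word_chain _ _ hx, value]
    rw [← h, ← hw]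
    rfl

theorem value_eq (l : List {g : Equiv.Perm (Fin m) // g ≠ 1}) (k : ℕ) (h : 0 < l.length + k) :
    value.{u} l k = contrTP k m (diag m _ (bdry (word (1, l))) (chain _ (top k)) +
      (-1 : ℤ) ^ l.length • diag m _ (word (1, l)) (Tot.d _ (chain _ (top k)))) := by
  obtain ⟨N, hN⟩ : ∃ N, l.length + k = N + 1 := ⟨_, (Nat.succ_pred_eq_of_pos h).symm⟩
  rw [value, hN, valueAux_succ]
  refine congrArg _ (congrArg₂ _ ?_ (congrArg _ ?_))
  · rcases l with _ | ⟨a, l⟩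
    · simp [bdry_word_nil]
    · exact extend_valueAux (p := l.length) (by simp at hN; omega)
        (bdry_mem_homog (word_mem_homog (1, a :: l))) _
  · rcases k with _ | k
    · rw [d_chain_zero, map_zero, map_zero]
    · rw [d_chain, map_sum, map_sum]
      refine Finset.sum_congr rfl fun i _ => ?_
      rw [map_smul, map_smul, extend_valueAux (p := l.length) (by omega) (word_mem_homog (1, l))]

theorem value_nil_zero : value.{u} (m := m) [] 0 = tprod ℤ fun _ => chain _ (lastVertex 0) := rfl

/-- The conditional form permits use at simplices where vanishing is already known, inside the
induction proving it everywhere. -/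
theorem diag_word_chain_of {X : SSet.{u}} (w : BarWord m) {k : ℕ} (x : X _⦋k⦌)
    (h : x ∈ X.degenerate k → TP.map (classify X x) m (value w.2 k) = 0) :
    diag m X (word w) (chain X x) = TP.perm _ w.1 (TP.map (classify X x) m (value w.2 k)) := by
  by_cases hx : x ∈ X.degenerate k
  · rw [chain_eq_zero hx, map_zero, h hx, map_zero]
  · exact extend_word_chain _ _ hx

theorem map_diag_of {p k : ℕ} (h : ∀ (X : SSet.{u}) (x : X _⦋k⦌)
    (l : List {g : Equiv.Perm (Fin m) // g ≠ 1}), l.length = p →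
    x ∈ X.degenerate k → TP.map (classify X x) m (value l k) = 0) {X Y : SSet.{u}} (g : X ⟶ Y)
    {a : RS m} (ha : a ∈ homog m p) (x : X _⦋k⦌) :
    TP.map (simplicialChains.map g) m (diag m X a (chain X x)) =
      diag m Y a (chain Y (g.app _ x)) := by
  refine homog_induction (f := TP.map (simplicialChains.map g) m ∘ₗ (diag m X).flip (chain X x))
    (g := (diag m Y).flip (chain Y (g.app _ x))) (fun w hw => ?_) ha
  rw [LinearMap.comp_apply, LinearMap.flip_apply, LinearMap.flip_apply,
    diag_word_chain_of w x (h _ x _ hw), diag_word_chain_of w _ (h _ _ _ hw), TP.map_perm,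
    classify_app, TP.map_comp]

/-- A degenerate simplex factors through a degeneracy Δ[j+1] → Δ[j]. This map preserves the last
vertex, so it passes through Φ. By induction naturality holds for the two boundary terms, which
become operations on the image of the top chain and on its boundary; that image is a degenerate
simplex, hence zero. -/
theorem map_value_of_degenerate (N : ℕ) : ∀ (l : List {g : Equiv.Perm (Fin m) // g ≠ 1}) (k : ℕ),
    l.length + k = N → ∀ (X : SSet.{u}) (x : X _⦋k⦌), x ∈ X.degenerate k →
      TP.map (classify X x) m (value l k) = 0 := by
  induction N with
  | zero =>
    intro l k hN X x hx
    obtain rfl : k = 0 := by omega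
    simp at hx
  | succ N ih =>
    intro l k hN X x hx
    obtain ⟨j, rfl, i, y, hy⟩ := exists_σ_of_mem_degenerate hx
    obtain rfl : x = X.σ i y := hy
    -- The degeneracy map itself, viewed as a (j+1)-simplex of Δ[j].
    let s : (Δ[j] : SSet.{u}) _⦋j + 1⦌ := (Δ[j] : SSet.{u}).σ i (top j)
    have hs : s (Fin.last (j + 1)) = Fin.last j := by
      rw [SSet.stdSimplex.σ_apply, Fin.predAbove_right_last]
      rfl
    have hs0 : chain _ s = 0 := chain_σ _ _
    have hxs : X.σ i y = (SSet.yonedaEquiv.symm y).app _ s := by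
      conv_lhs => rw [← app_top y]
      exact (ConcreteCategory.congr_hom
        (SimplicialObject.σ_naturality (SSet.yonedaEquiv.symm y) i) (top j)).symm
    have key : TP.map (classify _ s) m (value l (j + 1)) = 0 := by
      have h1 : TP.map (classify _ s) m (diag m _ (bdry (word (1, l))) (chain _ (top (j + 1)))) =
          0 := by
        rcases l with _ | ⟨a, l⟩
        · simp [bdry_word_nil]
        · rw [classify, map_diag_of (p := l.length) (fun X x l' hl' hx =>
            ih l' (j + 1) (by rw [hl']; simp at hN; omega) X x hx) _
            (bdry_mem_homog (word_mem_homog (1, a :: l))), app_top, hs0, map_zero]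
      have h2 : TP.map (classify _ s) m (diag m _ (word (1, l))
          (Tot.d _ (chain _ (top (j + 1))))) = 0 := by
        have h3 : TP.map (classify _ s) m (diag m _ (word (1, l))
            (Tot.d _ (chain _ (top (j + 1))))) = diag m _ (word (1, l))
              (Tot.map (classify _ s) (Tot.d _ (chain _ (top (j + 1))))) := by
          rw [d_chain, map_sum, map_sum, map_sum, map_sum]
          refine Finset.sum_congr rfl fun i _ => ?_
          rw [map_smul, map_smul, map_smul, map_smul, classify, map_chain,
            map_diag_of (p := l.length) (fun X x l' hl' hx =>
            ih l' j (by rw [hl']; omega) X x hx) _ (word_mem_homog (1, l))]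
        rw [h3, Tot.map_d, map_classify_top, hs0, map_zero, map_zero]
      rw [value_eq l (j + 1) (by omega), classify, map_contrTP s hs, map_add, map_smul]
      rw [classify] at h1 h2
      rw [h1, h2, smul_zero, add_zero, map_zero]
    rw [hxs, classify_app, TP.map_comp, key, map_zero]

theorem diag_word_chain {X : SSet.{u}} (w : BarWord m) {k : ℕ} (x : X _⦋k⦌) :
    diag m X (word w) (chain X x) = TP.perm _ w.1 (TP.map (classify X x) m (value w.2 k)) :=
  diag_word_chain_of w x (map_value_of_degenerate _ _ _ rfl X x)

theorem map_diag {X Y : SSet.{u}} (g : X ⟶ Y) (a : RS m) (c : Tot (simplicialChains.obj X)) :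
    TP.map (simplicialChains.map g) m (diag m X a c) =
      diag m Y a (Tot.map (simplicialChains.map g) c) := by
  have h1 : ∀ w, TP.map (simplicialChains.map g) m ∘ₗ diag m X (word w) =
      diag m Y (word w) ∘ₗ Tot.map (simplicialChains.map g) := fun w =>
    chain_hom_ext fun k x _ => by
      simp only [LinearMap.comp_apply]
      rw [map_chain, diag_word_chain, diag_word_chain, TP.map_perm, classify_app, TP.map_comp]
  exact LinearMap.congr_fun (RS_hom_ext
    (f := TP.map (simplicialChains.map g) m ∘ₗ (diag m X).flip c)
    (g := (diag m Y).flip (Tot.map (simplicialChains.map g) c))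
    fun w => LinearMap.congr_fun (h1 w) c) a

theorem diag_act {X : SSet.{u}} (σ : Equiv.Perm (Fin m)) (a : RS m)
    (c : Tot (simplicialChains.obj X)) :
    diag m X (act σ a) c = TP.perm _ σ (diag m X a c) := by
  have h1 : ∀ w, diag m X (act σ (word w)) = TP.perm _ σ ∘ₗ diag m X (word w) := fun w =>
    chain_hom_ext fun k x _ => by
      rw [LinearMap.comp_apply, act_word, diag_word_chain, diag_word_chain, TP.perm_mul]
  exact LinearMap.congr_fun (RS_hom_ext
    (f := (diag m X).flip c ∘ₗ act σ) (g := TP.perm _ σ ∘ₗ (diag m X).flip c)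
    fun w => LinearMap.congr_fun (h1 w) c) a

theorem diag_word_one_top (l : List {g : Equiv.Perm (Fin m) // g ≠ 1}) (k : ℕ) :
    diag.{u} m _ (word (1, l)) (chain _ (top k)) = value l k := by
  rw [diag_word_chain, classify_top, TP.map_id, TP.perm_one]

theorem diag_classify {X : SSet.{u}} (a : RS m) {k : ℕ} (x : X _⦋k⦌) :
    diag m X a (chain X x) = TP.map (classify X x) m (diag m _ a (chain _ (top k))) := by
  rw [classify, map_diag]
  exact congrArg _ (map_classify_top x).symm

theorem diag_classify_d {X : SSet.{u}} (a : RS m) {k : ℕ} (x : X _⦋k⦌) :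
    diag m X a (Tot.d _ (chain X x)) =
      TP.map (classify X x) m (diag m _ a (Tot.d _ (chain _ (top k)))) := by
  rw [classify, map_diag, Tot.map_d]
  exact congrArg _ (congrArg _ (map_classify_top x).symm)

/-- The recursion formula holds for all simplices `[i_0, …, i_j, r]` of `Δ[r]`. -/
theorem diag_word_one_chain {r k : ℕ} (l : List {g : Equiv.Perm (Fin m) // g ≠ 1})
    (h : 0 < l.length + k) (y : (Δ[r] : SSet.{u}) _⦋k⦌) (hy : y (Fin.last k) = Fin.last r) :
    diag m _ (word (1, l)) (chain _ y) = contrTP r m (diag m _ (bdry (word (1, l))) (chain _ y) +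
      (-1 : ℤ) ^ l.length • diag m _ (word (1, l)) (Tot.d _ (chain _ y))) := by
  rw [diag_classify (bdry _), diag_classify_d, ← map_smul, ← map_add, classify,
    ← map_contrTP y hy, ← value_eq l k h, ← diag_word_one_top, ← classify, ← diag_classify]

theorem diag_chain_mem_deg_of {p k : ℕ} (h : ∀ (l : List {g : Equiv.Perm (Fin m) // g ≠ 1}),
    l.length = p → value.{u} l k ∈ TP.deg _ m (p + k)) {X : SSet.{u}} {a : RS m}
    (ha : a ∈ homog m p) (x : X _⦋k⦌) : diag m X a (chain X x) ∈ TP.deg _ m (p + k) := by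
  refine homog_map_mem (f := (diag m X).flip (chain X x)) (fun w hw => ?_) ha
  rw [LinearMap.flip_apply, diag_word_chain]
  exact TP.perm_mem_deg _ (TP.map_mem_deg _ (h _ hw))

theorem value_mem_deg (N : ℕ) : ∀ (l : List {g : Equiv.Perm (Fin m) // g ≠ 1}) (k : ℕ),
    l.length + k = N → value.{u} l k ∈ TP.deg _ m N := by
  induction N with
  | zero =>
    intro l k hN
    obtain ⟨h1, rfl⟩ : l.length = 0 ∧ k = 0 := by omega
    obtain rfl := List.length_eq_zero_iff.1 h1
    rw [value_nil_zero]
    exact TP.tprod_mem_deg (fun _ => 0) (by simp) fun _ => ⟨_, rfl⟩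
  | succ N ih =>
    intro l k hN
    rw [value_eq l k (by omega)]
    refine contrTP_mem_deg k (add_mem ?_ (Submodule.smul_mem _ _ ?_))
    · rcases l with _ | ⟨a, l⟩
      · simp [bdry_word_nil]
      · obtain rfl : N = l.length + k := by simp at hN; omega
        exact diag_chain_mem_deg_of (fun l' hl' => ih l' k (by rw [hl']))
          (bdry_mem_homog (word_mem_homog (1, a :: l))) _
    · rcases k with _ | k
      · rw [d_chain_zero, map_zero]; exact zero_mem _
      · obtain rfl : N = l.length + k := by omega
        rw [d_chain, map_sum]
        refine sum_mem fun i _ => ?_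
        rw [map_smul]
        exact Submodule.smul_mem _ _ (diag_chain_mem_deg_of (fun l' hl' => ih l' k (by rw [hl']))
          (word_mem_homog (1, l)) _)

theorem diag_chain_mem_deg {p k : ℕ} {X : SSet.{u}} {a : RS m} (ha : a ∈ homog m p)
    (x : X _⦋k⦌) : diag m X a (chain X x) ∈ TP.deg _ m (p + k) :=
  diag_chain_mem_deg_of (fun l hl => value_mem_deg _ l k (by rw [hl])) ha x

theorem diag_mem_deg {p k : ℕ} {X : SSet.{u}} {a : RS m} (ha : a ∈ homog m p)
    (c : (simplicialChains.obj X).X k) :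
    diag m X a (Tot.of _ k c) ∈ TP.deg (simplicialChains.obj X) m (p + k) := by
  have h := simplexChain_hom_ext (X := X) (k := k)
    (f := ((TP.deg (simplicialChains.obj X) m (p + k)).mkQ ∘ₗ diag m X a).toAddMonoidHom.comp
      (Tot.of (simplicialChains.obj X) k)) (g := 0) fun x _ =>
        (Submodule.Quotient.mk_eq_zero _).2 (diag_chain_mem_deg ha x)
  exact (Submodule.Quotient.mk_eq_zero _).1 (DFunLike.congr_fun h c)

theorem diag_word_nil_vertex {X : SSet.{u}} (g : Equiv.Perm (Fin m)) (x : X _⦋0⦌) :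
    diag m X (word (g, [])) (chain X x) = tprod ℤ fun _ => chain X x := by
  have h1 : lastVertex.{u} 0 = top 0 := by
    ext1 t
    exact Fin.ext (by omega)
  rw [diag_word_chain, value_nil_zero, h1, TP.map, map_tprod, map_classify_top,
    TP.perm_tprod (e := fun _ => false)]
  · simp [TP.koszul]
  · intro j
    exact Tot.HasParity.of 0 (simplexChain X x)

theorem augTP_diag_vertex {k : ℕ} {a : RS m} (ha : a ∈ homog m 0) (x : (Δ[k] : SSet.{u}) _⦋0⦌) :
    augTP k m (diag m _ a (chain _ x)) = SymOperad.aug a • tprod ℤ fun _ => chain _ (lastVertex k) := by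
  refine homog_induction (f := augTP k m ∘ₗ (diag m _).flip (chain _ x))
    (g := SymOperad.aug.smulRight (tprod ℤ fun _ => chain _ (lastVertex k)))
    (fun ⟨g, l⟩ hw => ?_) ha
  obtain rfl := List.length_eq_zero_iff.1 hw
  rw [LinearMap.comp_apply, LinearMap.flip_apply, diag_word_nil_vertex, augTP_tprod,
    LinearMap.smulRight_apply, aug_word, if_pos rfl, one_smul]
  simp only [aug_chain, if_true]

end CartanDiagonal

/-! ### The chain map property and the unit -/

namespace CartanDiagonal

open StandardSimplex SymOperad PiTensorProduct

variable {m : ℕ}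

/-- Equivariance and naturality reduce a fixed bidegree (p, k) to words with g = 1 and top
simplices; stated bidegree by bidegree to serve within the induction. -/
theorem d_diag_of {p k : ℕ} (h : ∀ l : List {g : Equiv.Perm (Fin m) // g ≠ 1}, l.length = p →
    TP.d _ m (value.{u} l k) = diag m _ (bdry (word (1, l))) (chain _ (top k)) +
      (-1 : ℤ) ^ p • diag m _ (word (1, l)) (Tot.d _ (chain _ (top k))))
    {X : SSet.{u}} {a : RS m} (ha : a ∈ homog m p) (c : (simplicialChains.obj X).X k) :
    TP.d _ m (diag m X a (Tot.of _ k c)) = diag m X (bdry a) (Tot.of _ k c) +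
      (-1 : ℤ) ^ p • diag m X a (Tot.d _ (Tot.of _ k c)) := by
  have h1 : ∀ x : X _⦋k⦌, TP.d _ m (diag m X a (chain X x)) = diag m X (bdry a) (chain X x) +
      (-1 : ℤ) ^ p • diag m X a (Tot.d _ (chain X x)) := fun x =>
    homog_induction (f := TP.d _ m ∘ₗ (diag m X).flip (chain X x))
      (g := (diag m X).flip (chain X x) ∘ₗ bdry +
        (-1 : ℤ) ^ p • (diag m X).flip (Tot.d _ (chain X x))) (fun w hw => by
        simp only [LinearMap.comp_apply, LinearMap.add_apply, LinearMap.smul_apply,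
          LinearMap.flip_apply]
        rw [← act_word_one w, bdry_act, diag_act, diag_act, diag_act, TP.d_perm, ← map_smul,
          ← map_add, diag_classify (word (1, w.2)) x, diag_classify (bdry _) x, diag_classify_d,
          ← TP.map_d, diag_word_one_top, h _ hw, map_add, map_smul]) ha
  refine DFunLike.congr_fun (simplexChain_hom_ext (X := X) (k := k)
    (f := (TP.d _ m ∘ₗ diag m X a).toAddMonoidHom.comp (Tot.of (simplicialChains.obj X) k))
    (g := (diag m X (bdry a) + (-1 : ℤ) ^ p • diag m X a ∘ₗ Tot.d _).toAddMonoidHom.comp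
      (Tot.of (simplicialChains.obj X) k)) fun x _ => h1 x) c

/-- For degree reasons only p + k = 1 matters. For p = 1 the reason is ε∂ = 0 in the bar resolution;
for k = 1 the two endpoints of the edge have equal augmentation and opposite sign. -/
theorem augTP_boundary_eq_zero (l : List {g : Equiv.Perm (Fin m) // g ≠ 1}) (k : ℕ)
    (h : 0 < l.length + k) :
    augTP.{u} k m (diag m _ (bdry (word (1, l))) (chain _ (top k)) +
      (-1 : ℤ) ^ l.length • diag m _ (word (1, l)) (Tot.d _ (chain _ (top k)))) = 0 := by
  have h1 : augTP.{u} k m (diag m _ (bdry (word (1, l))) (chain _ (top k))) = 0 := by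
    rcases l with _ | ⟨a, l⟩
    · rw [bdry_word_nil, map_zero, LinearMap.zero_apply, map_zero]
    · have hb := bdry_mem_homog (p := l.length) (word_mem_homog (1, a :: l))
      by_cases h0 : l.length + k = 0
      · obtain ⟨h1, rfl⟩ : l.length = 0 ∧ k = 0 := by omega
        rw [h1] at hb
        rw [augTP_diag_vertex hb, SymOperad.aug_bdry, zero_smul]
      · exact augTP_eq_zero k h0 (diag_chain_mem_deg hb _)
  have h2 : augTP.{u} k m (diag m _ (word (1, l)) (Tot.d _ (chain _ (top k)))) = 0 := by
    rcases k with _ | k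
    · rw [d_chain_zero, map_zero, map_zero]
    · by_cases h0 : l.length + k = 0
      · obtain ⟨h2, rfl⟩ : l.length = 0 ∧ k = 0 := by omega
        have hb : word (1, l) ∈ homog m 0 := h2 ▸ word_mem_homog (1, l)
        rw [d_chain, Fin.sum_univ_two, map_add, map_smul, map_smul, map_add, map_smul, map_smul,
          augTP_diag_vertex hb, augTP_diag_vertex hb, ← add_smul]
        simp
      · refine augTP_eq_zero _ h0 ?_
        rw [chain_eq_of, Tot.d_of_succ]
        exact diag_mem_deg (word_mem_homog (1, l)) _
  rw [map_add, map_smul, h1, h2, smul_zero, add_zero]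

/-- By induction the boundary term y is a cycle and its augmentation vanishes, so dΦy = y. -/
theorem d_value (N : ℕ) : ∀ (l : List {g : Equiv.Perm (Fin m) // g ≠ 1}) (k : ℕ),
    l.length + k = N →
    TP.d _ m (value.{u} l k) = diag m _ (bdry (word (1, l))) (chain _ (top k)) +
      (-1 : ℤ) ^ l.length • diag m _ (word (1, l)) (Tot.d _ (chain _ (top k))) := by
  induction N with
  | zero =>
    intro l k hN
    obtain ⟨h1, rfl⟩ : l.length = 0 ∧ k = 0 := by omega
    obtain rfl := List.length_eq_zero_iff.1 h1
    rw [bdry_word_nil, map_zero, LinearMap.zero_apply, d_chain_zero, map_zero, smul_zero,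
      add_zero, value_nil_zero, TP.d_tprod]
    refine Finset.sum_eq_zero fun j _ => MultilinearMap.map_coord_zero _ j ?_
    rw [if_neg (lt_irrefl _), if_pos rfl, d_chain_zero]
  | succ N ih =>
    intro l k hN
    have h1 : TP.d _ m (diag.{u} m _ (bdry (word (1, l))) (chain _ (top k))) =
        (-1 : ℤ) ^ (l.length + 1) • diag m _ (bdry (word (1, l))) (Tot.d _ (chain _ (top k))) := by
      rcases l with _ | ⟨a, l⟩
      · simp [bdry_word_nil]
      · have hb := bdry_mem_homog (p := l.length) (word_mem_homog (1, a :: l))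
        have := d_diag_of (k := k) (fun l' hl' => hl' ▸ ih l' k (by simp at hN; omega)) hb
          (simplexChain _ (top k))
        rw [bdry_bdry, map_zero, LinearMap.zero_apply, zero_add] at this
        refine this.trans ?_
        rw [List.length_cons, pow_add, pow_add]
        norm_num
        rfl
    have h2 : TP.d _ m (diag.{u} m _ (word (1, l)) (Tot.d _ (chain _ (top k)))) =
        diag m _ (bdry (word (1, l))) (Tot.d _ (chain _ (top k))) := by
      rcases k with _ | k
      · rw [d_chain_zero, map_zero, map_zero, map_zero]
      · rw [chain_eq_of, Tot.d_of_succ, d_diag_of (p := l.length)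
          (fun l' hl' => hl' ▸ ih l' k (by omega)) (word_mem_homog (1, l)), ← Tot.d_of_succ,
          Tot.d_d, map_zero, smul_zero, add_zero]
    have h3 := d_contrTP k (diag m _ (bdry (word (1, l))) (chain _ (top k)) +
      (-1 : ℤ) ^ l.length • diag m _ (word (1, l)) (Tot.d _ (chain _ (top k))))
    rw [augTP_boundary_eq_zero l k (by omega), sub_zero, ← value_eq l k (by omega), map_add, map_smul, h1, h2, ← add_smul,
      pow_succ, mul_neg_one, neg_add_cancel, zero_smul, map_zero, add_zero] at h3
    exact h3

theorem d_diag {p : ℕ} {X : SSet.{u}} {a : RS m} (ha : a ∈ homog m p)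
    (c : Tot (simplicialChains.obj X)) :
    TP.d _ m (diag m X a c) = diag m X (bdry a) c + (-1 : ℤ) ^ p • diag m X a (Tot.d _ c) :=
  LinearMap.congr_fun (Tot.hom_ext (f := TP.d _ m ∘ₗ diag m X a)
    (g := diag m X (bdry a) + (-1 : ℤ) ^ p • diag m X a ∘ₗ Tot.d _) fun k c =>
      d_diag_of (k := k) (fun l hl => hl ▸ d_value _ l k rfl) ha c) c

theorem contr_top (k : ℕ) : contr k (chain (Δ[k] : SSet.{u}) (top k)) = 0 := by
  rw [contr_chain, append_of_last, chain_σ, smul_zero]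
  rfl

theorem contrTP_subsingleton {k : ℕ} (x : Tot (simplicialChains.obj (Δ[k] : SSet.{u}))) :
    contrTP k 1 (tprod ℤ fun _ => x) = tprod ℤ fun _ => contr k x := by
  rw [contrTP_tprod, Fin.sum_univ_one]
  refine congrArg _ (funext fun i => ?_)
  rw [Subsingleton.elim i 0, if_neg (lt_irrefl _), if_pos rfl]

theorem tprod_const_eq {M : Type*} [AddCommGroup M] (x : M) :
    (tprod ℤ fun _ : Fin 1 => x) =
      (PiTensorProduct.subsingletonEquiv (R := ℤ) (s := fun _ => M) (0 : Fin 1)).symm x :=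
  (LinearEquiv.symm_apply_eq _).2 (PiTensorProduct.subsingletonEquiv_apply_tprod _ _).symm |>.symm

/-- For n = 1, Φ is s. Since s[0,…,k] = 0, and ε vanishes in positive dimension, the homotopy
formula reads s∂[0,…,k] = [0,…,k]. -/
theorem value_one (k : ℕ) : value.{u} (m := 1) [] k = tprod ℤ fun _ => chain _ (top k) := by
  induction k with
  | zero =>
    rw [← diag_word_one_top, diag_word_nil_vertex]
  | succ k ih =>
    have h1 : ∀ (X : SSet.{u}) (c : (simplicialChains.obj X).X k),
        diag 1 X (word (1, [])) (Tot.of _ k c) = tprod ℤ fun _ => Tot.of _ k c := by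
      intro X c
      rw [tprod_const_eq]
      refine DFunLike.congr_fun (simplexChain_hom_ext (X := X) (k := k)
        (f := (diag 1 X (word (1, []))).toAddMonoidHom.comp (Tot.of (simplicialChains.obj X) k))
        (g := (PiTensorProduct.subsingletonEquiv (R := ℤ)
          (s := fun _ => Tot (simplicialChains.obj X)) (0 : Fin 1)).symm.toAddEquiv.toAddMonoidHom.comp
            (Tot.of (simplicialChains.obj X) k)) fun x _ => ?_) c
      refine Eq.trans ?_ (tprod_const_eq (chain X x))
      refine (diag_classify (word (1, [])) x).trans ?_
      rw [diag_word_one_top, ih, TP.map, map_tprod, map_classify_top]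
    rw [value_eq _ _ (by simp), bdry_word_nil, map_zero, LinearMap.zero_apply, zero_add,
      List.length_nil, pow_zero, one_smul, chain_eq_of, Tot.d_of_succ, h1, ← Tot.d_of_succ,
      contrTP_subsingleton]
    have h2 := d_contr (k + 1) (chain (Δ[k + 1] : SSet.{u}) (top (k + 1)))
    rw [contr_top, map_zero, zero_add, aug_chain, if_neg (by omega), sub_zero] at h2
    exact congrArg (fun x => PiTensorProduct.tprod ℤ fun _ : Fin 1 => x) h2

theorem diag_one {X : SSet.{u}} (c : Tot (simplicialChains.obj X)) :
    diag 1 X (word (1, [])) c = tprod ℤ fun _ => c := by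
  rw [tprod_const_eq]
  refine LinearMap.congr_fun (chain_hom_ext (f := diag 1 X (word (1, [])))
    (g := (PiTensorProduct.subsingletonEquiv (R := ℤ)
      (s := fun _ => Tot (simplicialChains.obj X)) (0 : Fin 1)).symm.toLinearMap)
    fun k x _ => ?_) c
  refine Eq.trans ?_ (tprod_const_eq (chain X x))
  rw [diag_classify, diag_word_one_top, value_one, TP.map, map_tprod, map_classify_top]

end CartanDiagonal

/-! ### Compatibility with the operad compositions -/

namespace TP

open PiTensorProduct

variable {C D : ChainComplex AddCommGrpCat.{u} ℕ} {m n : ℕ}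

/-- The map `f ↦ 1 ⊗ ⋯ ⊗ f ⊗ ⋯ ⊗ 1` as a linear map. -/
def insertKoszulHom (i : Fin (m + 1)) (p : ℕ) :
    (Tot C →ₗ[ℤ] TP C n) →ₗ[ℤ] TP C (m + 1) →ₗ[ℤ] TP C (m + n) where
  toFun := insertKoszul i p
  map_add' f g := hom_ext_tprod fun x => by
    simp only [LinearMap.add_apply, insertKoszul_tprod, map_add]
  map_smul' c f := hom_ext_tprod fun x => by
    simp only [LinearMap.smul_apply, insertKoszul_tprod, map_smul, RingHom.id_apply]

theorem map_insertKoszul (φ : C ⟶ D) (i : Fin (m + 1)) (p : ℕ) {f : Tot C →ₗ[ℤ] TP C n}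
    {g : Tot D →ₗ[ℤ] TP D n} (h : ∀ x, map φ n (f x) = g (Tot.map φ x)) (z : TP C (m + 1)) :
    map φ (m + n) (insertKoszul i p f z) = insertKoszul i p g (map φ (m + 1) z) := by
  refine LinearMap.congr_fun (hom_ext_tprod (f := map φ (m + n) ∘ₗ insertKoszul i p f)
    (g := insertKoszul i p g ∘ₗ map φ (m + 1)) fun x => ?_) z
  rw [LinearMap.comp_apply, LinearMap.comp_apply, insertKoszul_tprod, map, map_glue, map,
    map_tprod, insertKoszul_tprod, ← h]
  refine congrArg₂ _ (congrArg _ (funext fun j => ?_)) rfl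
  split_ifs
  · exact Tot.map_sgn _ _ _
  · rfl

end TP

namespace CartanDiagonal

open StandardSimplex SymOperad PiTensorProduct

variable {m n : ℕ}

/-- Combines the equivariance of ∘_i with that of insertion to pass from words with g = 1 on top
simplices to a whole tridegree (p, q, k). -/
theorem diag_circ_of {p q k : ℕ} (h : ∀ (i : Fin (m + 1))
    (l : List {g : Equiv.Perm (Fin n) // g ≠ 1}) (l' : List {g : Equiv.Perm (Fin (m + 1)) // g ≠ 1}),
    l.length = p → l'.length = q →
      diag.{u} (m + n) _ (circ i (word (1, l)) (word (1, l'))) (chain _ (top k)) =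
        TP.insertKoszul i p (diag n _ (word (1, l))) (diag (m + 1) _ (word (1, l'))
          (chain _ (top k)))) {X : SSet.{u}} (i : Fin (m + 1)) {a : RS n} {b : RS (m + 1)}
    (ha : a ∈ homog n p) (hb : b ∈ homog (m + 1) q) (c : (simplicialChains.obj X).X k) :
    diag (m + n) X (circ i a b) (Tot.of _ k c) =
      TP.insertKoszul i p (diag n X a) (diag (m + 1) X b (Tot.of _ k c)) := by
  have h1 : ∀ x : X _⦋k⦌, diag (m + n) X (circ i a b) (chain X x) =
      TP.insertKoszul i p (diag n X a) (diag (m + 1) X b (chain X x)) := fun x =>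
    homog_induction₂ (f := (circ i).compr₂ ((diag (m + n) X).flip (chain X x)))
      (g := (TP.insertKoszulHom i p ∘ₗ diag n X).compl₂ ((diag (m + 1) X).flip (chain X x)))
      (fun a b ha hb => by
        change diag (m + n) X (circ i (word a) (word b)) (chain X x) =
          TP.insertKoszul i p (diag n X (word a)) (diag (m + 1) X (word b) (chain X x))
        obtain ⟨σ, l'⟩ := b
        obtain ⟨τ, l⟩ := a
        obtain ⟨j, rfl⟩ := σ.surjective i
        rw [← act_word_one (τ, l), ← act_word_one (σ, l'), circ_act, diag_act, diag_act]
        have e : diag n X (act τ (word (1, l))) = TP.perm _ τ ∘ₗ diag n X (word (1, l)) :=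
          LinearMap.ext fun c => diag_act _ _ _
        rw [e, TP.insertKoszul_perm j p (diag n X (word (1, l)))
          (fun k x => diag_mem_deg (ha ▸ word_mem_homog (1, l)) x)]
        refine congrArg _ ?_
        rw [diag_classify, diag_classify (word (1, l')), h j l l' ha hb]
        exact TP.map_insertKoszul _ _ _ (fun x => map_diag _ _ _) _) ha hb
  refine DFunLike.congr_fun (simplexChain_hom_ext (X := X) (k := k)
    (f := (diag (m + n) X (circ i a b)).toAddMonoidHom.comp (Tot.of (simplicialChains.obj X) k))
    (g := (TP.insertKoszul i p (diag n X a) ∘ₗ diag (m + 1) X b).toAddMonoidHom.comp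
      (Tot.of (simplicialChains.obj X) k)) fun x _ => h1 x) c

/-- Supplies the parity hypothesis of `TP.d_insertKoszul`. -/
theorem diag_sgn {p : ℕ} {X : SSet.{u}} {a : RS n} (ha : a ∈ homog n p)
    (c : Tot (simplicialChains.obj X)) :
    diag n X a (Tot.sgn _ 1 c) = (-1 : ℤ) ^ p • TP.sgn n (diag n X a c) :=
  LinearMap.congr_fun (Tot.hom_ext (f := diag n X a ∘ₗ Tot.sgn _ 1)
    (g := (-1 : ℤ) ^ p • TP.sgn n ∘ₗ diag n X a) fun k c => by
      rw [LinearMap.comp_apply, LinearMap.smul_apply, LinearMap.comp_apply, Tot.sgn_of, map_smul,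
        TP.sgn_eq_of_mem_deg (diag_mem_deg ha c), smul_smul, ← pow_add, one_mul, ← add_assoc,
        pow_add, ← two_mul, pow_mul]
      norm_num) c

/-- The compatibility with the differential of the composite of two operations. -/
theorem d_insertKoszul_diag {p q : ℕ} {X : SSet.{u}} (i : Fin (m + 1)) {a : RS n} {b : RS (m + 1)}
    (ha : a ∈ homog n p) (hb : b ∈ homog (m + 1) q) (c : Tot (simplicialChains.obj X)) :
    TP.d _ (m + n) (TP.insertKoszul i p (diag n X a) (diag (m + 1) X b c)) =
      TP.insertKoszul i (p + 1) (diag n X (bdry a)) (diag (m + 1) X b c) +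
        (-1 : ℤ) ^ p • TP.insertKoszul i p (diag n X a) (diag (m + 1) X (bdry b) c) +
        (-1 : ℤ) ^ (p + q) • TP.insertKoszul i p (diag n X a) (diag (m + 1) X b (Tot.d _ c)) := by
  have e : TP.d _ n ∘ₗ diag n X a - (-1 : ℤ) ^ p • diag n X a ∘ₗ Tot.d _ = diag n X (bdry a) :=
    LinearMap.ext fun c => by
      rw [LinearMap.sub_apply, LinearMap.smul_apply, LinearMap.comp_apply, LinearMap.comp_apply,
        d_diag ha, add_sub_cancel_right]
  rw [TP.d_insertKoszul i p _ (diag_sgn ha), e, d_diag hb, map_add, map_smul, smul_add, smul_smul,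
    ← pow_add, add_assoc]

/-- The recursion is linear in the symbols 1[…], hence applies to combinations such as a ∘_i b. -/
theorem diag_homogOne_top {p k : ℕ} (h : 0 < p + k) {a : RS n} (ha : a ∈ homogOne n p) :
    diag.{u} n _ a (chain _ (top k)) = contrTP k n (diag n _ (bdry a) (chain _ (top k)) +
      (-1 : ℤ) ^ p • diag n _ a (Tot.d _ (chain _ (top k)))) := by
  refine homogOne_induction (f := (diag.{u} n _).flip (chain _ (top k)))
    (g := contrTP k n ∘ₗ ((diag n _).flip (chain _ (top k)) ∘ₗ bdry +
      (-1 : ℤ) ^ p • (diag n _).flip (Tot.d _ (chain _ (top k))))) (fun l hl => ?_) ha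
  subst hl
  exact (diag_word_one_top l k).trans (value_eq l k h)

section Vanishing

variable {k : ℕ} (l : List {g : Equiv.Perm (Fin n) // g ≠ 1})

/-- Every simplex occurring in s(x) has positive dimension and ends in the vertex k, so the
recursion writes the operation on it as a value of Φ. -/
theorem diag_contr {M : Type u} [AddCommGroup M]
    {Ψ : TP (simplicialChains.obj (Δ[k] : SSet.{u})) n →ₗ[ℤ] M} (hΨ : ∀ z, Ψ (contrTP k n z) = 0)
    (x : Tot (simplicialChains.obj (Δ[k] : SSet.{u}))) :
    Ψ (diag n _ (word (1, l)) (contr k x)) = 0 :=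
  LinearMap.congr_fun (chain_hom_ext (f := Ψ ∘ₗ diag n _ (word (1, l)) ∘ₗ contr k) (g := 0)
    fun j x _ => by
      rw [LinearMap.comp_apply, LinearMap.comp_apply, contr_chain, map_smul, map_smul,
        diag_word_one_chain l (by omega) _ (append_last k x), hΨ, smul_zero]
      rfl) x

/-- On the vertex [k] a word of positive degree gives a value of Φ, killed by ΦΦ = 0; the empty word
gives [k]⊗⋯⊗[k], killed because s[k] = 0. -/
theorem contrTP_diag_aug (x : Tot (simplicialChains.obj (Δ[k] : SSet.{u}))) :
    contrTP k n (diag n _ (word (1, l)) (aug k x)) = 0 :=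
  LinearMap.congr_fun (chain_hom_ext (f := contrTP k n ∘ₗ diag n _ (word (1, l)) ∘ₗ aug k) (g := 0)
    fun j x _ => by
      rw [LinearMap.comp_apply, LinearMap.comp_apply, aug_chain, LinearMap.zero_apply]
      split_ifs
      · rcases l with _ | ⟨a, l⟩
        · rw [diag_word_nil_vertex, contrTP_tprod]
          refine Finset.sum_eq_zero fun j _ => MultilinearMap.map_coord_zero _ j ?_
          rw [if_neg (lt_irrefl _), if_pos rfl, contr_lastVertex]
        · rw [diag_word_one_chain _ (by simp) (lastVertex k) rfl, contrTP_contrTP]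
      · rw [map_zero, map_zero]) x

end Vanishing

theorem contr_zero : StandardSimplex.contr.{u} 0 = 0 :=
  chain_hom_ext fun j x _ => by
    rw [contr_chain, append_of_last 0 x (Subsingleton.elim (α := Fin 1) _ _), chain_σ, smul_zero]
    rfl

theorem contrTP_zero : contrTP.{u} 0 n = 0 := TP.hom_ext_tprod fun x => by
  rw [contrTP_tprod]
  refine Finset.sum_eq_zero fun j _ => MultilinearMap.map_coord_zero _ j ?_
  rw [if_neg (lt_irrefl _), if_pos rfl, contr_zero, LinearMap.zero_apply]

/-- The two conditions under which the composite of operations is Φ of its own boundary. If the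
inner value is in the image of Φ, the side conditions propagate through the insertion. -/
theorem contrTP_insertKoszul_diag {k : ℕ} (i : Fin (m + 1))
    (l : List {g : Equiv.Perm (Fin n) // g ≠ 1}) (l' : List {g : Equiv.Perm (Fin (m + 1)) // g ≠ 1})
    (h : 0 < l.length + l'.length + k) :
    contrTP.{u} k (m + n) (TP.insertKoszul i l.length (diag n _ (word (1, l)))
      (diag (m + 1) _ (word (1, l')) (chain _ (top k)))) = 0 ∧
    augTP.{u} k (m + n) (TP.insertKoszul i l.length (diag n _ (word (1, l)))
      (diag (m + 1) _ (word (1, l')) (chain _ (top k)))) = 0 := by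
  by_cases h' : 0 < l'.length + k
  · rw [diag_word_one_top, value_eq l' k h']
    exact ⟨contrTP_insertKoszul_contrTP k i _ (diag_contr l (contrTP_contrTP k))
      (diag_contr l (augTP_contrTP k)) (contrTP_diag_aug l) _,
      augTP_insertKoszul_contrTP k i _ (diag_contr l (augTP_contrTP k)) _⟩
  -- The inner value is now [0]⊗⋯⊗[0], outside the image of Φ, so the outer word has positive
  -- degree. On Δ[0] Φ is zero, and hence the outer operation vanishes on [0].
  · obtain ⟨h1, rfl⟩ : l'.length = 0 ∧ k = 0 := by omega
    obtain rfl := List.length_eq_zero_iff.1 h1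
    have hz : diag.{u} n _ (word (1, l)) (chain _ (top 0)) = 0 := by
      rw [diag_word_one_top, value_eq l 0 h, contrTP_zero, LinearMap.zero_apply]
    rw [diag_word_nil_vertex, TP.insertKoszul_tprod, hz, map_zero]
    exact ⟨map_zero _, map_zero _⟩

/-- Both sides equal Φ applied to the same three boundary terms: ∂ on a, on b and on the simplex.
These agree by the inductive hypothesis in total degree one lower. -/
theorem diag_circ_aux (N : ℕ) : ∀ (p q k : ℕ), p + q + k = N → ∀ (i : Fin (m + 1))
    (l : List {g : Equiv.Perm (Fin n) // g ≠ 1}) (l' : List {g : Equiv.Perm (Fin (m + 1)) // g ≠ 1}),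
    l.length = p → l'.length = q →
      diag.{u} (m + n) _ (circ i (word (1, l)) (word (1, l'))) (chain _ (top k)) =
        TP.insertKoszul i p (diag n _ (word (1, l))) (diag (m + 1) _ (word (1, l'))
          (chain _ (top k))) := by
  induction N with
  | zero =>
    intro p q k hN i l l' hl hl'
    obtain ⟨h1, h2, rfl⟩ : l.length = 0 ∧ l'.length = 0 ∧ k = 0 := by omega
    obtain rfl := List.length_eq_zero_iff.1 h1
    obtain rfl := List.length_eq_zero_iff.1 h2
    rw [circ_nil_nil, diag_word_nil_vertex, diag_word_nil_vertex, TP.insertKoszul_tprod,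
      diag_word_nil_vertex, TP.glue_tprod]
    refine congrArg _ (TP.elim_ext i (fun j => ?_) fun t => ?_)
    · rw [TP.elim_inl, of_chain, mul_zero, pow_zero, one_smul, ite_self]
    · rw [TP.elim_inr]
  | succ N ih =>
    intro p q k hN i l l' hl hl'
    subst hl hl'
    have hw : word (1, l) ∈ homog n l.length := word_mem_homog (1, l)
    have hw' : word (1, l') ∈ homog (m + 1) l'.length := word_mem_homog (1, l')
    have t1 : diag.{u} (m + n) _ (circ i (bdry (word (1, l))) (word (1, l'))) (chain _ (top k)) =
        TP.insertKoszul i (l.length + 1) (diag n _ (bdry (word (1, l))))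
          (diag (m + 1) _ (word (1, l')) (chain _ (top k))) := by
      rcases l with _ | ⟨a, l⟩
      · rw [bdry_word_nil, map_zero, map_zero, LinearMap.zero_apply, map_zero,
          LinearMap.zero_apply]
        exact (LinearMap.congr_fun (map_zero (TP.insertKoszulHom i _)) _).symm
      · rw [List.length_cons, TP.insertKoszul_add_two]
        exact diag_circ_of (ih l.length _ k (by simp at hN; omega)) i
          (bdry_mem_homog (p := l.length) hw) hw' (simplexChain _ (top k))
    have t2 : diag.{u} (m + n) _ (circ i (word (1, l)) (bdry (word (1, l')))) (chain _ (top k)) =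
        TP.insertKoszul i l.length (diag n _ (word (1, l)))
          (diag (m + 1) _ (bdry (word (1, l'))) (chain _ (top k))) := by
      rcases l' with _ | ⟨a, l'⟩
      · simp only [bdry_word_nil, map_zero, LinearMap.zero_apply]
      · exact diag_circ_of (ih _ l'.length k (by simp at hN; omega)) i hw
          (bdry_mem_homog (p := l'.length) hw') (simplexChain _ (top k))
    have t3 : diag.{u} (m + n) _ (circ i (word (1, l)) (word (1, l'))) (Tot.d _ (chain _ (top k))) =
        TP.insertKoszul i l.length (diag n _ (word (1, l)))
          (diag (m + 1) _ (word (1, l')) (Tot.d _ (chain _ (top k)))) := by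
      rcases k with _ | k
      · rw [d_chain_zero, map_zero, map_zero, map_zero]
      · rw [chain_eq_of, Tot.d_of_succ]
        exact diag_circ_of (ih _ _ k (by omega)) i hw hw' _
    obtain ⟨v1, v2⟩ := contrTP_insertKoszul_diag.{u} (k := k) i l l' (by omega)
    have h3 := d_contrTP k (TP.insertKoszul i l.length (diag n _ (word (1, l)))
      (diag (m + 1) _ (word (1, l')) (chain _ (top k))))
    rw [v1, v2, map_zero, zero_add, sub_zero, d_insertKoszul_diag i hw hw'] at h3
    rw [diag_homogOne_top (by omega) (circ_mem_homogOne i l l')]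
    refine (congrArg _ ?_).trans h3
    rw [bdry_circ i hw, map_add, map_smul, LinearMap.add_apply, LinearMap.smul_apply, t1, t2, t3]

theorem diag_circ {p q : ℕ} {X : SSet.{u}} (i : Fin (m + 1)) {a : RS n} {b : RS (m + 1)}
    (ha : a ∈ homog n p) (hb : b ∈ homog (m + 1) q) (c : Tot (simplicialChains.obj X)) :
    diag (m + n) X (circ i a b) c =
      TP.insertKoszul i p (diag n X a) (diag (m + 1) X b c) :=
  LinearMap.congr_fun (Tot.hom_ext (f := diag (m + n) X (circ i a b))
    (g := TP.insertKoszul i p (diag n X a) ∘ₗ diag (m + 1) X b) fun k c =>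
      diag_circ_of (diag_circ_aux _ p q k rfl) i ha hb c) c

end CartanDiagonal

/-- The coalgebra structure over `𝔖` on the chains of a simplicial set. -/
def simplicialCoalg (X : SSet.{u}) : SCoalgStr (simplicialChains.obj X) where
  diag n := CartanDiagonal.diag (n + 1) X
  diag_deg _ a _ c := CartanDiagonal.diag_mem_deg (SymOperad.word_mem_homog a) c
  diag_bdry _ a c := CartanDiagonal.d_diag (SymOperad.word_mem_homog a) c
  diag_act _ σ a c := CartanDiagonal.diag_act σ a c
  diag_one c := CartanDiagonal.diag_one c
  diag_circ _ _ i a b c := CartanDiagonal.diag_circ i (SymOperad.word_mem_homog a)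
    (SymOperad.word_mem_homog b) c

theorem isCoalgHom_map {X Y : SSet.{u}} (g : X ⟶ Y) :
    IsCoalgHom (simplicialCoalg X) (simplicialCoalg Y) (simplicialChains.map g) :=
  fun _ a c => (CartanDiagonal.map_diag g a c).symm

theorem isCartanConstruction_simplicialCoalg :
    IsCartanConstruction.{u} fun k =>
      simplicialCoalg (SSet.stdSimplex.obj (SimplexCategory.mk k)) := by
  refine ⟨fun n => CartanDiagonal.diag_word_nil_vertex 1 _, fun n k l h => ?_⟩
  refine (CartanDiagonal.diag_word_one_top l k).trans ((CartanDiagonal.value_eq l k h).trans ?_)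
  rw [map_add, map_smul]
  rfl

open Classical in
/-- The module of normalized chains is free on the nondegenerate simplices. -/
def chainEquiv (X : SSet.{u}) (k : ℕ) :
    (simplicialChains.obj X).X k ≃+ (X.nonDegenerate k →₀ ℤ) :=
  AddMonoidHom.toAddEquiv
    (chainDesc X fun x => if h : x ∈ X.nonDegenerate k then Finsupp.single ⟨x, h⟩ 1 else 0)
    (Finsupp.liftAddHom fun x : X.nonDegenerate k =>
      zmultiplesHom _ (simplexChain X x.1))
    (simplexChain_hom_ext fun x hx => by
      rw [AddMonoidHom.comp_apply, chainDesc_simplexChain _ hx, dif_pos hx,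
        Finsupp.liftAddHom_apply_single]
      exact one_zsmul _)
    (Finsupp.addHom_ext' fun x => AddMonoidHom.ext_int (by
      simp only [AddMonoidHom.comp_apply, Finsupp.singleAddHom_apply,
        Finsupp.liftAddHom_apply_single, zmultiplesHom_apply, one_zsmul]
      rw [chainDesc_simplexChain _ x.2, dif_pos x.2]
      rfl))

/-! ### The m-coalgebra of a 2-reduced simplicial set -/

namespace SS

variable (X : SS.{u})

instance : Subsingleton ((SS.forget.obj X) _⦋0⦌) := X.2.2 0 (by omega)

instance : Subsingleton ((SS.forget.obj X) _⦋1⦌) := X.2.2 1 (by omega)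

/-- The base point. -/
def point : (SS.forget.obj X) _⦋0⦌ :=
  X.1.hom.app _ (StandardSimplex.top 0)

/-- The only 1-simplex is the degeneracy of the base point. -/
theorem subsingleton_chains_one : Subsingleton ((simplicialChains.obj (SS.forget.obj X)).X 1) := by
  have : IsEmpty ((SS.forget.obj X).nonDegenerate 1) := ⟨fun x => x.2 <| by
    rw [Subsingleton.elim x.1 ((SS.forget.obj X).σ (0 : Fin 1) X.point)]
    exact SSet.σ_mem_degenerate _ _ _⟩
  exact (chainEquiv _ 1).injective.subsingleton

/-- The base point as a nondegenerate simplex. -/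
def pointNonDegenerate : (SS.forget.obj X).nonDegenerate 0 :=
  ⟨X.point, by simp⟩

variable {X} {Y : SS.{u}} (f : X ⟶ Y)

theorem isIso_map_f_zero : IsIso ((simplicialChains.map (SS.forget.map f)).f 0) := by
  let A : (simplicialChains.obj (SS.forget.obj X)).X 0 →+
    (simplicialChains.obj (SS.forget.obj Y)).X 0 := ((simplicialChains.map (SS.forget.map f)).f 0).hom
  let B : (simplicialChains.obj (SS.forget.obj Y)).X 0 →+
    (simplicialChains.obj (SS.forget.obj X)).X 0 := chainDesc _ fun _ => simplexChain _ X.point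
  have hA : ∀ x, A (simplexChain _ x) = simplexChain _ Y.point := fun x =>
    (map_simplexChain _ x).trans (congrArg _ (Subsingleton.elim _ _))
  have hB : ∀ y, B (simplexChain _ y) = simplexChain _ X.point := fun y =>
    chainDesc_simplexChain _ (by simp)
  have h1 : B.comp A = AddMonoidHom.id _ := simplexChain_hom_ext fun x _ => by
    rw [AddMonoidHom.comp_apply, hA, hB, Subsingleton.elim x X.point]
    rfl
  have h2 : A.comp B = AddMonoidHom.id _ := simplexChain_hom_ext fun x _ => by
    rw [AddMonoidHom.comp_apply, hB, hA, Subsingleton.elim x Y.point]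
    rfl
  exact ⟨AddCommGrpCat.ofHom B, AddCommGrpCat.hom_ext h1, AddCommGrpCat.hom_ext h2⟩

theorem isZero_chains_one : IsZero ((simplicialChains.obj (SS.forget.obj X)).X 1) :=
  have := subsingleton_chains_one X
  AddCommGrpCat.isZero_of_subsingleton _

theorem isIso_homologyMap_zero :
    IsIso (HomologicalComplex.homologyMap (simplicialChains.map (SS.forget.map f)) 0) := by
  have h0 := isIso_map_f_zero f
  have h1 : IsIso ((simplicialChains.map (SS.forget.map f)).f 1) :=
    (isZero_chains_one (X := X)).isIso (isZero_chains_one (X := Y)) _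
  let φ := (HomologicalComplex.shortComplexFunctor AddCommGrpCat.{u} (ComplexShape.down ℕ) 0).map
    (simplicialChains.map (SS.forget.map f))
  have : IsIso φ.τ₁ := by
    change IsIso ((simplicialChains.map (SS.forget.map f)).f ((ComplexShape.down ℕ).prev 0))
    rw [ChainComplex.prev]
    exact h1
  have : IsIso φ.τ₂ := h0
  -- In `ComplexShape.down ℕ` the successor of 0 is 0 by convention, so the third term of the short
  -- complex is again in degree 0.
  have : IsIso φ.τ₃ := by
    change IsIso ((simplicialChains.map (SS.forget.map f)).f ((ComplexShape.down ℕ).next 0))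
    rw [ChainComplex.next_nat_zero]
    exact h0
  have : IsIso φ := ShortComplex.isIso_of_isIso φ
  exact inferInstanceAs (IsIso (ShortComplex.homologyMap φ))

theorem isIso_homologyMap_one :
    IsIso (HomologicalComplex.homologyMap (simplicialChains.map (SS.forget.map f)) 1) :=
  (ShortComplex.isZero_homology_of_isZero_X₂
    ((simplicialChains.obj (SS.forget.obj X)).sc 1) isZero_chains_one).isIso
    (ShortComplex.isZero_homology_of_isZero_X₂
    ((simplicialChains.obj (SS.forget.obj Y)).sc 1) isZero_chains_one) _

variable (X) in
/-- The m-coalgebra of chains. -/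
def mcoalg : MCoalg.{u} where
  cx := simplicialChains.obj (SS.forget.obj X)
  str := simplicialCoalg _
  free k := Module.Free.of_equiv (chainEquiv _ k).toIntLinearEquiv.symm
  zero := ⟨(chainEquiv _ 0).trans
    (Finsupp.uniqueLinearEquiv ℤ ℤ X.pointNonDegenerate).toAddEquiv⟩
  one := X.subsingleton_chains_one

/-- The functor of m-coalgebras of chains. -/
def mcoalgFunctor : SS.{u} ⥤ MCoalg.{u} where
  obj := mcoalg
  map f :=
    { toHom := simplicialChains.map (SS.forget.map f)
      isCoalgHom := isCoalgHom_map _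
      iso_zero := isIso_homologyMap_zero f
      iso_one := isIso_homologyMap_one f }
  map_id X := MCoalg.Hom.ext
    ((congrArg simplicialChains.map (SS.forget.map_id X)).trans (simplicialChains.map_id _))
  map_comp f g := MCoalg.Hom.ext
    ((congrArg simplicialChains.map (SS.forget.map_comp f g)).trans (simplicialChains.map_comp _ _))

end SS

end

theorem mainTheorem11 :
    ∃ (𝒞 : SS.{u} ⥤ MCoalg.{u})
      (h : 𝒞 ⋙ MCoalg.toComplex = SS.forget ⋙ simplicialChains)
      (S : ∀ X : SSet.{u}, SCoalgStr (simplicialChains.obj X)),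
      (∀ (X Y : SSet.{u}) (g : X ⟶ Y), IsCoalgHom (S X) (S Y) (simplicialChains.map g)) ∧
      (∀ X : SS.{u}, IsCoalgHom (𝒞.obj X).str (S (SS.forget.obj X)) ((eqToHom h).app X)) ∧
      IsCartanConstruction fun k => S (SSet.stdSimplex.obj (SimplexCategory.mk k)) := by
  refine ⟨SS.mcoalgFunctor, rfl, simplicialCoalg, fun _ _ g => isCoalgHom_map g, fun X => ?_,
    isCartanConstruction_simplicialCoalg⟩
  -- The equality of functors holds definitionally, so the comparison map `eqToHom` is the identity.
  change IsCoalgHom _ _ (𝟙 (simplicialChains.obj (SS.forget.obj X)))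
  intro n a c
  refine (congrArg _ (LinearMap.congr_fun (Tot.map_id _) c)).trans ?_
  exact (TP.map_id _ _).symm
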